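/- Fix integers $K,\Lambda,\ell\ge 0$ and $\mathfrak d\ge 1$, and reals $T\ge 0$, $\delta>0$. Consider the following classification problem on $n$ qubits. There are $K$ Hamiltonians $H^{(k)}=\sum_{X}\lambda^{(k)}_X h^{(k)}_X$, where $|\lambda^{(k)}_X|\le 1$, each $h^{(k)}_X$ is Hermitian with operator norm at most $1$ and acts on a nonempty set $X$ of at most $\Lambda$ qubits, and, in the interaction graph of each $H^{(k)}$ (whose vertices are the terms, two distinct terms being adjacent when they share a qubit), every vertex has degree at most $\mathfrak d$. The ansatz is $U(\boldsymbol\theta)=e^{-iH^{(1)}\theta_1}\cdots e^{-iH^{(K)}\theta_K}$ with $|\theta_k|\le T$. There are a Hermitian observable $O$ with $\|O\|\le 1$ acting on at most $\ell$ qubits, a feature map $x\mapsto|\phi(x)\rangle$ into pure $n$-qubit states, and a nonempty finite data set $\mathcal D=\{(x_i,y_i)\}$ with $y_i\in\mathbb R$. Put $$\mathrm{Loss}(\boldsymbol\theta)=\mathbb E_{(x_i,y_i)\sim\mathcal D}\bigl|\langle\phi(x_i)|U^\dagger(\boldsymbol\theta)OU(\boldsymbol\theta)|\phi(x_i)\rangle-y_i\bigr|,$$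 where $\mathbb E_{\mathcal D}$ is the uniform average over the data set, and call $\boldsymbol\theta^*$ optimal if it minimizes $\mathrm{Loss}$ over $\{\boldsymbol\theta:|\theta_k|\le T\}$. There are a single quantum-classical algorithm and a constant $C>0$, depending only on $K,\Lambda,\mathfrak d,\ell,T,\delta$, such that for every $n$, every such problem and every $\varepsilon>0$ with $n/\varepsilon\ge 2$ the following holds. The algorithm is a fixed program with real arithmetic. It is given $n$, $\varepsilon$, the labels $y_i$, the qubit sets of the terms of the $H^{(k)}$ and of $O$, and it can measure Pauli operators on fresh copies of the states $|\phi(x_i)\rangle$. On every run it halts after at most $$|\mathcal D|\,\bigl[4^{K\Lambda}e\,\mathfrak d\bigr]^{C\log(n/\varepsilon)}$$ steps and outputs a model $f(\rho)=\sum_j\alpha_j\operatorname{Tr}(Q_j\rho)$ with Pauli operators $Q_j$ and real coefficients $\alpha_j$. With probability at least $1-\delta$, this $f$ satisfies, for every optimal $\boldsymbol\theta^*$ simultaneously, $$\mathbb E_{x_i\sim\mathcal D}\Bigl|f\bigl(|\phi(x_i)\rangle\langle\phi(x_i)|\bigr)-\langle\phi(x_i)|U^\dagger(\boldsymbol\theta^*)OU(\boldsymbol\theta^*)|\phi(x_i)\rangle\Bigr|\le\varepsilon$$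 whenever $\mathrm{Loss}(\boldsymbol\theta^*)\le\varepsilon/3$ (the training problem is solvable to this accuracy), and in every case the left-hand side is at most $2\,\mathrm{Loss}(\boldsymbol\theta^*)+\varepsilon$. -/

import Mathlib

noncomputable section

namespace HVClassifier

open Matrix

/-! ## Qubits, observables, local Hamiltonians -/

/-- Labels of the computational basis of `n` qubits. -/
abbrev BasisLabel (n : ℕ) : Type := Fin n → Fin 2

/-- Linear operators on `n` qubits, as matrices in the computational basis. -/
abbrev Op (n : ℕ) : Type := Matrix (BasisLabel n) (BasisLabel n) ℂ

/-- Normalized pure states of `n` qubits. -/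
def PureState (n : ℕ) : Type := {φ : BasisLabel n → ℂ // star φ ⬝ᵥ φ = 1}

/-- The operator norm induced by the Euclidean (Hilbert space) norm. -/
def opNorm {n : ℕ} (A : Op n) : ℝ :=
  ‖Matrix.toEuclideanCLM (n := BasisLabel n) (𝕜 := ℂ) A‖

/-- `A` acts as the identity outside the qubit set `X`: `A = B_X ⊗ 1` for some `B` on `X`. -/
def ActsOn {n : ℕ} (A : Op n) (X : Finset (Fin n)) : Prop :=
  ∃ B : Matrix (X → Fin 2) (X → Fin 2) ℂ, ∀ x y : BasisLabel n,
    A x y = if ∀ q, q ∉ X → x q = y q then B (fun q => x q) (fun q => y q) else 0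

/-- The expectation value `⟨φ|A|φ⟩` (its real part; it is real for Hermitian `A`). -/
def expectation {n : ℕ} (A : Op n) (φ : PureState n) : ℝ :=
  (star φ.1 ⬝ᵥ (A *ᵥ φ.1)).re

/-- The density matrix `|φ⟩⟨φ|`. -/
def PureState.density {n : ℕ} (φ : PureState n) : Op n :=
  Matrix.vecMulVec φ.1 (star φ.1)

/-- Single-qubit Pauli matrices: `0, 1, 2` and all larger codes stand for `I, X, Y, Z`. -/
def pauliMatrix : ℕ → Matrix (Fin 2) (Fin 2) ℂ
  | 0 => 1
  | 1 => !![0, 1; 1, 0]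
  | 2 => !![0, -Complex.I; Complex.I, 0]
  | _ => !![1, 0; 0, -1]

/-- The `n`-qubit Pauli operator `⨂_q σ_{p q}`; only the first `n` codes of `p` matter. -/
def pauliString (n : ℕ) (p : ℕ → ℕ) : Op n :=
  fun x y => ∏ q : Fin n, pauliMatrix (p q) (x q) (y q)

/-- A Hamiltonian `H = ∑_X λ_X h_X` on `n` qubits: `|λ_X| ≤ 1`, each `h_X` is Hermitian, has
operator norm at most one, and acts on the nonempty set `X` of qubits. -/
structure LocalHamiltonian (n : ℕ) where
  numTerms : ℕ
  supp : Fin numTerms → Finset (Fin n)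
  coeff : Fin numTerms → ℝ
  term : Fin numTerms → Op n
  supp_nonempty : ∀ j, (supp j).Nonempty
  coeff_le : ∀ j, |coeff j| ≤ 1
  term_hermitian : ∀ j, (term j).IsHermitian
  term_norm_le : ∀ j, opNorm (term j) ≤ 1
  term_actsOn : ∀ j, ActsOn (term j) (supp j)

namespace LocalHamiltonian

variable {n : ℕ} (H : LocalHamiltonian n)

/-- The Hamiltonian as an operator. -/
def toOp : Op n := ∑ j, (H.coeff j : ℂ) • H.term j

/-- The interaction graph: vertices are the terms, and two distinct terms are adjacent when they
share a qubit. -/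
def interactionGraph : SimpleGraph (Fin H.numTerms) where
  Adj i j := i ≠ j ∧ (H.supp i ∩ H.supp j).Nonempty
  symm := ⟨fun _ _ h => ⟨h.1.symm, by rw [Finset.inter_comm]; exact h.2⟩⟩
  loopless := ⟨fun _ h => h.1 rfl⟩

/-- Every term acts on at most `Λ` qubits. -/
def LocalityLE (Λ : ℕ) : Prop := ∀ j, (H.supp j).card ≤ Λ

/-- Every vertex of the interaction graph has degree at most `d`. -/
def DegreeLE (d : ℕ) : Prop := ∀ j, (H.interactionGraph.neighborSet j).ncard ≤ d

end LocalHamiltonian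

/-- The ansatz `U(θ) = e^{-i H^{(1)} θ_1} ⋯ e^{-i H^{(K)} θ_K}` (product in this order). -/
def ansatz {n K : ℕ} (H : Fin K → LocalHamiltonian n) (θ : Fin K → ℝ) : Op n :=
  (List.ofFn fun k => NormedSpace.exp ((-Complex.I * (θ k : ℂ)) • (H k).toOp)).prod

/-! ## The classification problem -/

/-- A quantum variational classifier with `K` Hamiltonians on `n` qubits, whose classical data
live in `𝒳`: an observable `O` of norm at most one acting on the qubit set `obsSupp`, a quantum
feature map, and a nonempty finite data set of pairs `(x_i, y_i)`. -/
structure Problem (n K : ℕ) (𝒳 : Type*) where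
  ham : Fin K → LocalHamiltonian n
  obs : Op n
  obsSupp : Finset (Fin n)
  obs_hermitian : obs.IsHermitian
  obs_norm_le : opNorm obs ≤ 1
  obs_actsOn : ActsOn obs obsSupp
  feature : 𝒳 → PureState n
  size : ℕ
  size_pos : 0 < size
  point : Fin size → 𝒳
  label : Fin size → ℝ

namespace Problem

variable {n K : ℕ} {𝒳 : Type*} (P : Problem n K 𝒳)

/-- The feature state `|φ(x_i)⟩` of the `i`-th data point. -/
def state (i : Fin P.size) : PureState n := P.feature (P.point i)

/-- The prediction `⟨φ(x_i)| U(θ)† O U(θ) |φ(x_i)⟩`. -/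
def prediction (θ : Fin K → ℝ) (i : Fin P.size) : ℝ :=
  expectation ((ansatz P.ham θ)ᴴ * P.obs * ansatz P.ham θ) (P.state i)

/-- The average over the data set of the distance of the prediction to the label. -/
def loss (θ : Fin K → ℝ) : ℝ :=
  (∑ i, |P.prediction θ i - P.label i|) / P.size

/-- `θ` minimizes the loss over all parameters with `|θ_k| ≤ T`. -/
def IsOptimal (T : ℝ) (θ : Fin K → ℝ) : Prop :=
  (∀ k, |θ k| ≤ T) ∧ ∀ θ' : Fin K → ℝ, (∀ k, |θ' k| ≤ T) → P.loss θ ≤ P.loss θ'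

/-- The average over the data set of the distance between the model `f`, evaluated on the feature
states, and the predictions with parameters `θ`. -/
def modelError (f : Op n → ℝ) (θ : Fin K → ℝ) : ℝ :=
  (∑ i, |f (P.state i).density - P.prediction θ i|) / P.size

end Problem

/-! ## Quantum-classical algorithms with a step count

A program is a fixed finite text in a while-language over random access arrays of natural numbers
and arrays of real numbers, with unit-cost arithmetic (addition and truncated subtraction of
naturals, field operations and comparisons of reals, no rounding from reals to naturals). Array
names are constants of the program and entries are addressed by computed row and column numbers.
The only access to the feature states is the measurement of a Pauli operator on a fresh copy of a
chosen feature state. -/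

/-- Natural-number expressions. -/
inductive NatExpr : Type
  | lit (c : ℕ)
  | cell (a : ℕ) (row col : NatExpr)
  | add (e f : NatExpr)
  | sub (e f : NatExpr)

/-- Real-number expressions; the constants of a program are rational. -/
inductive RealExpr : Type
  | lit (c : ℚ)
  | cell (a : ℕ) (row col : NatExpr)
  | ofNat (e : NatExpr)
  | add (e f : RealExpr)
  | sub (e f : RealExpr)
  | mul (e f : RealExpr)
  | div (e f : RealExpr)

/-- Tests. -/
inductive Test : Type
  | natLE (e f : NatExpr)
  | realLE (e f : RealExpr)
  | neg (b : Test)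

/-- Programs. `measure i P r a row col` measures, on a fresh copy of the `i`-th feature state, the
Pauli operator whose codes are in row `r` of the natural array `P`, and stores the outcome `±1` in
the real array `a`. -/
inductive Program : Type
  | skip
  | setNat (a : ℕ) (row col : NatExpr) (e : NatExpr)
  | setReal (a : ℕ) (row col : NatExpr) (e : RealExpr)
  | seq (p q : Program)
  | ite (b : Test) (p q : Program)
  | loop (b : Test) (p : Program)
  | measure (i : NatExpr) (P : ℕ) (r : NatExpr) (a : ℕ) (row col : NatExpr)

/-- The classical memory: contents by array name, row and column. -/
structure Memory : Type where
  nat : ℕ → ℕ → ℕ → ℕ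
  real : ℕ → ℕ → ℕ → ℝ

/-- Overwrite one entry. -/
def store {α : Type} (m : ℕ → ℕ → ℕ → α) (a row col : ℕ) (v : α) : ℕ → ℕ → ℕ → α :=
  fun a' row' col' => if a' = a ∧ row' = row ∧ col' = col then v else m a' row' col'

def NatExpr.eval (m : Memory) : NatExpr → ℕ
  | .lit c => c
  | .cell a row col => m.nat a (row.eval m) (col.eval m)
  | .add e f => e.eval m + f.eval m
  | .sub e f => e.eval m - f.eval m

def RealExpr.eval (m : Memory) : RealExpr → ℝ
  | .lit c => (c : ℝ)
  | .cell a row col => m.real a (row.eval m) (col.eval m)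
  | .ofNat e => (e.eval m : ℝ)
  | .add e f => e.eval m + f.eval m
  | .sub e f => e.eval m - f.eval m
  | .mul e f => e.eval m * f.eval m
  | .div e f => e.eval m / f.eval m

def Test.Holds (m : Memory) : Test → Prop
  | .natLE e f => e.eval m ≤ f.eval m
  | .realLE e f => e.eval m ≤ f.eval m
  | .neg b => ¬ b.Holds m

/-- A configuration: the stack of program pieces that remain to be executed, and the memory. -/
structure Config : Type where
  todo : List Program
  mem : Memory

/-- The computation has ended. -/
def Config.Halted (c : Config) : Prop := c.todo = []

/-- A coin that shows `true` with probability `p` (clipped to `[0, 1]`). -/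
def coin (p : ℝ) : PMF Bool :=
  PMF.ofFintype
    (fun b => cond b (ENNReal.ofReal (max 0 (min 1 p))) (ENNReal.ofReal (1 - max 0 (min 1 p))))
    (by
      have h0 : (0 : ℝ) ≤ max 0 (min 1 p) := le_max_left _ _
      have h1 : max 0 (min 1 p) ≤ 1 := max_le zero_le_one (min_le_left _ _)
      rw [Fintype.sum_bool]
      simp only [cond_true, cond_false]
      rw [← ENNReal.ofReal_add h0 (by linarith)]
      simp)

/-- The Born rule: the outcome of measuring a Pauli operator `A` on the state `φ` is `+1`
(`true`) with probability `(1 + ⟨φ|A|φ⟩) / 2` and `-1` otherwise. -/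
def born {n : ℕ} (A : Op n) (φ : PureState n) : PMF Bool :=
  coin ((1 + expectation A φ) / 2)

open Classical in
/-- One step of a computation with access to the feature states `Φ`. Every rule costs one step,
and a measurement costs one further step for every qubit. Halted configurations do not move. -/
def step {n N : ℕ} (Φ : Fin N → PureState n) : Config → PMF Config
  | ⟨[], m⟩ => PMF.pure ⟨[], m⟩
  | ⟨.skip :: k, m⟩ => PMF.pure ⟨k, m⟩
  | ⟨.setNat a row col e :: k, m⟩ =>
      PMF.pure ⟨k, ⟨store m.nat a (row.eval m) (col.eval m) (e.eval m), m.real⟩⟩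
  | ⟨.setReal a row col e :: k, m⟩ =>
      PMF.pure ⟨k, ⟨m.nat, store m.real a (row.eval m) (col.eval m) (e.eval m)⟩⟩
  | ⟨.seq p q :: k, m⟩ => PMF.pure ⟨p :: q :: k, m⟩
  | ⟨.ite b p q :: k, m⟩ => PMF.pure (if b.Holds m then ⟨p :: k, m⟩ else ⟨q :: k, m⟩)
  | ⟨.loop b p :: k, m⟩ => PMF.pure (if b.Holds m then ⟨p :: .loop b p :: k, m⟩ else ⟨k, m⟩)
  | ⟨.measure i P r a row col :: k, m⟩ =>
      if h : i.eval m < N then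
        (born (pauliString n (m.nat P (r.eval m))) (Φ ⟨i.eval m, h⟩)).map fun o =>
          ⟨List.replicate n .skip ++ k,
            ⟨m.nat, store m.real a (row.eval m) (col.eval m) (if o then 1 else -1)⟩⟩
      else PMF.pure ⟨List.replicate n .skip ++ k, m⟩

/-- The law of the configuration after `t` steps. -/
def run {n N : ℕ} (Φ : Fin N → PureState n) : ℕ → Config → PMF Config
  | 0, c => PMF.pure c
  | t + 1, c => (step Φ c).bind (run Φ t)

/-- The model `f(ρ) = ∑_j α_j Tr(Q_j ρ)` that is stored in a memory: natural array `0`, entry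
`(0, 0)`, is the number of summands; row `j` of natural array `1` holds the codes of the Pauli
operator `Q_j`; real array `0`, entry `(0, j)`, is `α_j`. -/
def outputModel (n : ℕ) (m : Memory) (ρ : Op n) : ℝ :=
  ∑ j ∈ Finset.range (m.nat 0 0 0),
    m.real 0 0 j * (Matrix.trace (pauliString n (m.nat 1 j) * ρ)).re

open Classical in
/-- The classical input. Natural array `0`: row `0` holds the number of qubits and the number of
data points. Natural array `1`: row `0` is the indicator of the qubits of the observable. Natural
array `2`: row `0` holds the numbers of terms of the Hamiltonians. Natural array `3 + k`: row `j`
is the indicator of the qubits of the `j`-th term of the `k`-th Hamiltonian (counting from zero).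
Real array `0`, entry `(0, 0)`: the accuracy `ε`. Real array `1`: row `0` holds the labels. All
other entries are zero. The coefficients and the matrices of the terms, the matrix of the
observable and the parameters are not given. -/
def inputMemory {n K : ℕ} {𝒳 : Type*} (P : Problem n K 𝒳) (ε : ℝ) : Memory where
  nat
    | 0, 0, 0 => n
    | 0, 0, 1 => P.size
    | 1, 0, q => if ∃ h : q < n, (⟨q, h⟩ : Fin n) ∈ P.obsSupp then 1 else 0
    | 2, 0, k => if h : k < K then (P.ham ⟨k, h⟩).numTerms else 0
    | k + 3, j, q =>
        if ∃ (hk : k < K) (hj : j < (P.ham ⟨k, hk⟩).numTerms) (hq : q < n),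
          (⟨q, hq⟩ : Fin n) ∈ (P.ham ⟨k, hk⟩).supp ⟨j, hj⟩ then 1 else 0
    | _, _, _ => 0
  real
    | 0, 0, 0 => ε
    | 1, 0, i => if h : i < P.size then P.label ⟨i, h⟩ else 0
    | _, _, _ => 0

/-- The law of the configuration that the program reaches within `t` steps on the given problem
and accuracy. -/
def execute {n K : ℕ} {𝒳 : Type*} (A : Program) (P : Problem n K 𝒳) (ε : ℝ) (t : ℕ) : PMF Config :=
  run P.state t ⟨[A], inputMemory P ε⟩

/-- The probability that a configuration drawn from `μ` satisfies `E`. -/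
def prob (μ : PMF Config) (E : Config → Prop) : ENNReal := μ.toOuterMeasure {c | E c}

end HVClassifier

end

noncomputable section
namespace HVClassifier
open Matrix
open scoped Matrix.Norms.L2Operator

/-! ## Expectation values, norms and supports of operators -/

/-! In the Heisenberg picture a prediction is the expectation of U†OU, and this operator is almost
local. For short times the conjugation is a series of nested commutators. In each commutator only
the terms meeting the current support survive, so every summand acts on a connected cluster of terms
grown from the support of O, and a cluster of m terms can be enlarged in only O(m) ways. The
resulting rising factorials are beaten by the 1/r! of the exponential series, which leaves a
geometric tail (`Problem.ClusterSum.exists_short_evolution`). Evolution up to time T is cut into a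
constant number of short steps. Each step multiplies the cluster level by 4 and adds an error
2^(-Q), while unitarity keeps the earlier errors from growing (`Problem.exists_clusterSum_evolve`).
With Q of order log(n/ε) the final level is O(log(n/ε)).

Only Pauli operators supported in a cluster occur in the Pauli expansion of the approximant. A
cluster is covered by a walk of logarithmic length along supports of terms, starting at the
observable. Since degrees and localities are bounded, there are only polynomially many (in n/ε) such
walks with Pauli labels. Hence, for every admissible θ, the predictions are within ε/12 of a linear
combination, with coefficients at most 2, of Pauli expectations from a single list that is
computable from the qubit sets alone (`exists_pauli_approximation`, `length_iterate_extend_le`).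

Learning is then least absolute deviation regression. Every listed Pauli operator is measured S
times on every state, and averaged subgradient descent fits the labels. Comparing the fit with the
combination belonging to θ, by the triangle inequality through the labels, costs the loss twice
(`sum_abs_model_sub_le`). The only random event is that the total squared measurement error is
small. This event does not involve θ, so it serves all parameters at once, and Markov's inequality
bounds its failure by δ. The error is averaged over the data, so S does not depend on the number of
data points and the running time is linear in it.

For the programs, deterministic parts are handled by big-step semantics and the measurements by a
calculus of pre-expectations. Giving unfinished computations infinite cost makes one bound on an
expected cost yield both halting on every run and the success probability
(`halted_and_prob_of_optimalCost_le`). For ε ≥ 1 the zero model suffices. A running time (n/ε)^C per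
data point has the claimed form because the base of the claimed power is at least e
(`pow_le_rpow_log`). -/

lemma norm_star_dotProduct_mulVec_le {n : ℕ} (A : Op n) (φ : PureState n) :
    ‖star φ.1 ⬝ᵥ (A *ᵥ φ.1)‖ ≤ ‖A‖ := by
  set v : EuclideanSpace ℂ (BasisLabel n) := WithLp.toLp 2 φ.1
  have hv : ‖v‖ = 1 := by
    have h1 : inner ℂ v v = (1 : ℂ) := by
      rw [EuclideanSpace.inner_eq_star_dotProduct, dotProduct_comm]
      exact φ.2
    have h2 : (‖v‖ : ℝ) ^ 2 = 1 := by
      rw [← inner_self_eq_norm_sq (𝕜 := ℂ) v, h1]; simp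
    nlinarith [norm_nonneg v]
  have h : star φ.1 ⬝ᵥ (A *ᵥ φ.1) = inner ℂ v (toEuclideanCLM (n := BasisLabel n) (𝕜 := ℂ) A v) := by
    rw [EuclideanSpace.inner_eq_star_dotProduct, dotProduct_comm]
    rfl
  rw [h]
  refine (norm_inner_le_norm _ _).trans ?_
  rw [hv, one_mul]
  refine (ContinuousLinearMap.le_opNorm _ _).trans ?_
  rw [hv, mul_one]
  -- The matrix norm of the scope `Matrix.Norms.L2Operator` unfolds to the norm in `opNorm`; later
  -- the bounds stated with `opNorm` are used for it without conversion.
  exact le_of_eq rfl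

lemma abs_expectation_le {n : ℕ} (A : Op n) (φ : PureState n) : |expectation A φ| ≤ ‖A‖ :=
  (Complex.abs_re_le_norm _).trans (norm_star_dotProduct_mulVec_le A φ)

lemma expectation_sub {n : ℕ} (A B : Op n) (φ : PureState n) :
    expectation (A - B) φ = expectation A φ - expectation B φ := by
  simp [expectation, sub_mulVec, dotProduct_sub]

lemma trace_mul_density {n : ℕ} (A : Op n) (φ : PureState n) :
    (Matrix.trace (A * φ.density)).re = expectation A φ := by
  rw [PureState.density, mul_vecMulVec, trace_vecMulVec, dotProduct_comm]
  rfl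

lemma norm_entry_le {n : ℕ} (A : Op n) (x y : BasisLabel n) : ‖A x y‖ ≤ ‖A‖ := by
  set v : EuclideanSpace ℂ (BasisLabel n) := WithLp.toLp 2 (Pi.single y 1)
  have hv : ‖v‖ = 1 := by simp [v]
  have h1 : A x y = (toEuclideanCLM (n := BasisLabel n) (𝕜 := ℂ) A v) x := by
    simp [v]
  rw [h1]
  refine (PiLp.norm_apply_le _ x).trans ?_
  refine (ContinuousLinearMap.le_opNorm _ _).trans ?_
  rw [hv, mul_one]
  exact le_of_eq rfl

/-! ### Algebra of operators supported on a set of qubits. -/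

section ActsOn

variable {n : ℕ}

lemma ActsOn.zero (X : Finset (Fin n)) : ActsOn (0 : Op n) X :=
  ⟨0, fun x y => by simp⟩

lemma ActsOn.smul {A : Op n} {X : Finset (Fin n)} (h : ActsOn A X) (c : ℂ) : ActsOn (c • A) X := by
  obtain ⟨B, hB⟩ := h
  refine ⟨c • B, fun x y => ?_⟩
  rw [Matrix.smul_apply, hB]
  split_ifs <;> simp

lemma ActsOn.sub {A A' : Op n} {X : Finset (Fin n)} (h : ActsOn A X) (h' : ActsOn A' X) :
    ActsOn (A - A') X := by
  obtain ⟨B, hB⟩ := h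
  obtain ⟨B', hB'⟩ := h'
  refine ⟨B - B', fun x y => ?_⟩
  rw [Matrix.sub_apply, hB, hB']
  split_ifs <;> simp

/-- The matrix on X is tensored with the identity on Y \ X. -/
lemma ActsOn.mono {A : Op n} {X Y : Finset (Fin n)} (h : ActsOn A X) (hXY : X ⊆ Y) :
    ActsOn A Y := by
  obtain ⟨B, hB⟩ := h
  refine ⟨fun x y => if ∀ q : Y, (q : Fin n) ∉ X → x q = y q then
    B (fun q => x ⟨q, hXY q.2⟩) (fun q => y ⟨q, hXY q.2⟩) else 0, fun x y => ?_⟩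
  rw [hB]
  by_cases h1 : ∀ q, q ∉ X → x q = y q
  · have h2 : ∀ q, q ∉ Y → x q = y q := fun q hq => h1 q fun h => hq (hXY h)
    have h3 : ∀ q : Y, (q : Fin n) ∉ X → x q = y q := fun q hq => h1 q hq
    rw [if_pos h1, if_pos h2]
    exact (if_pos h3).symm
  · rw [if_neg h1]
    split_ifs with h2
    · refine (if_neg fun h3 => h1 fun q hq => ?_).symm
      exact if hY : q ∈ Y then h3 ⟨q, hY⟩ hq else h2 q hY
    · rfl

/-- The basis label that agrees with `u` on `X` and with `x` elsewhere. -/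
def overwrite (X : Finset (Fin n)) (x : BasisLabel n) (u : X → Fin 2) : BasisLabel n :=
  fun q => if h : q ∈ X then u ⟨q, h⟩ else x q

lemma overwrite_mem {X : Finset (Fin n)} (x : BasisLabel n) (u : X → Fin 2) {q : Fin n}
    (h : q ∈ X) : overwrite X x u q = u ⟨q, h⟩ := by simp [overwrite, h]

lemma overwrite_notMem {X : Finset (Fin n)} (x : BasisLabel n) (u : X → Fin 2) {q : Fin n}
    (h : q ∉ X) : overwrite X x u q = x q := by simp [overwrite, h]

/-- The labels that agree with x off X are exactly the overwrites of x on X. This reduces a product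
of operators acting on X to a matrix product over X alone. -/
lemma sum_agree_eq_sum_overwrite (X : Finset (Fin n)) (x : BasisLabel n) (f : BasisLabel n → ℂ) :
    ∑ z, (if ∀ q, q ∉ X → x q = z q then f z else 0) = ∑ u : X → Fin 2, f (overwrite X x u) := by
  rw [← Finset.sum_filter]
  symm
  refine Finset.sum_bij (fun u _ => overwrite X x u) ?_ ?_ ?_ ?_
  · intro u _
    simp only [Finset.mem_filter, Finset.mem_univ, true_and]
    intro q hq
    rw [overwrite_notMem x u hq]
  · intro u _ v _ h
    funext q
    have := congrFun h q
    simpa [overwrite] using this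
  · intro z hz
    simp only [Finset.mem_filter, Finset.mem_univ, true_and] at hz
    refine ⟨fun q => z q, Finset.mem_univ _, ?_⟩
    funext q
    by_cases h : q ∈ X
    · simp [overwrite, h]
    · simp [overwrite, h, hz q h]
  · intro u _
    rfl

lemma ActsOn.mul {A A' : Op n} {X : Finset (Fin n)} (h : ActsOn A X) (h' : ActsOn A' X) :
    ActsOn (A * A') X := by
  obtain ⟨B, hB⟩ := h
  obtain ⟨B', hB'⟩ := h'
  refine ⟨B * B', fun x y => ?_⟩
  have h1 : (A * A') x y = ∑ z, (if ∀ q, q ∉ X → x q = z q then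
      B (fun q => x q) (fun q => z q) * A' z y else 0) := by
    rw [Matrix.mul_apply]
    refine Finset.sum_congr rfl fun z _ => ?_
    rw [hB]
    split_ifs <;> simp
  have h2 : ∀ u : X → Fin 2, A' (overwrite X x u) y =
      if ∀ q, q ∉ X → x q = y q then B' u (fun q => y q) else 0 := by
    intro u
    have e1 : (∀ q, q ∉ X → overwrite X x u q = y q) ↔ ∀ q, q ∉ X → x q = y q :=
      forall₂_congr fun q hq => by rw [overwrite_notMem x u hq]
    have e2 : (fun q : X => overwrite X x u q) = u := by
      funext q; simp [overwrite]
    rw [hB', e2]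
    exact if_congr e1 rfl rfl
  rw [h1, sum_agree_eq_sum_overwrite X x fun z => B (fun q => x q) (fun q => z q) * A' z y]
  have e2 : ∀ u : X → Fin 2, (fun q : X => overwrite X x u q) = u := by
    intro u; funext q; simp [overwrite]
  simp only [h2, e2]
  split_ifs
  · rfl
  · simp

lemma ActsOn.commute_of_disjoint {A A' : Op n} {X Y : Finset (Fin n)} (h : ActsOn A X)
    (h' : ActsOn A' Y) (hXY : Disjoint X Y) : A * A' = A' * A := by
  obtain ⟨B, hB⟩ := h
  obtain ⟨B', hB'⟩ := h'
  have hX : ∀ q, q ∈ X → q ∉ Y := fun q h1 h2 => Finset.disjoint_left.mp hXY h1 h2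
  -- An entry of the product in a form that is symmetric in the two factors; commutation then
  -- follows by applying it in both orders.
  have key : ∀ (Z W : Finset (Fin n)) (C : Matrix (Z → Fin 2) (Z → Fin 2) ℂ)
      (C' : Matrix (W → Fin 2) (W → Fin 2) ℂ) (D D' : Op n),
      (∀ q, q ∈ Z → q ∉ W) →
      (∀ x y, D x y = if ∀ q, q ∉ Z → x q = y q then C (fun q => x q) (fun q => y q) else 0) →
      (∀ x y, D' x y = if ∀ q, q ∉ W → x q = y q then C' (fun q => x q) (fun q => y q) else 0) →
      ∀ x y, (D * D') x y = if ∀ q, q ∉ Z → q ∉ W → x q = y q then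
        C (fun q => x q) (fun q => y q) * C' (fun q => x q) (fun q => y q) else 0 := by
    intro Z W C C' D D' hZW hD hD' x y
    have hWZ : ∀ q, q ∈ W → q ∉ Z := fun q h1 h2 => hZW q h2 h1
    rw [Matrix.mul_apply]
    -- The only intermediate label that contributes: the first factor may change x only on Z, and
    -- the second must leave the entries there equal to those of y.
    set z0 : BasisLabel n := overwrite Z x fun q => y q with hz0
    rw [Finset.sum_eq_single z0]
    · rw [hD, hD']
      have c1 : ∀ q, q ∉ Z → x q = z0 q := fun q hq => by rw [hz0, overwrite_notMem _ _ hq]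
      have c2 : (fun q : Z => z0 q) = fun q : Z => y q := by
        funext q; simp [hz0, overwrite]
      have c3 : (fun q : W => z0 q) = fun q : W => x q := by
        funext q; rw [hz0, overwrite_notMem _ _ (hWZ q q.2)]
      have c4 : (∀ q, q ∉ W → z0 q = y q) ↔ ∀ q, q ∉ Z → q ∉ W → x q = y q := by
        constructor
        · intro h q hq hq'
          rw [← h q hq', hz0, overwrite_notMem _ _ hq]
        · intro h q hq
          by_cases hz : q ∈ Z
          · rw [hz0, overwrite_mem _ _ hz]
          · rw [hz0, overwrite_notMem _ _ hz, h q hz hq]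
      rw [if_pos c1, c2, c3]
      by_cases hc : ∀ q, q ∉ Z → q ∉ W → x q = y q
      · rw [if_pos hc, if_pos (c4.mpr hc)]
      · rw [if_neg hc, if_neg (fun h => hc (c4.mp h)), mul_zero]
    · intro z _ hz
      rw [hD, hD']
      by_cases h1 : ∀ q, q ∉ Z → x q = z q
      · by_cases h2 : ∀ q, q ∉ W → z q = y q
        · exfalso
          apply hz
          funext q
          by_cases hq : q ∈ Z
          · rw [hz0, overwrite_mem _ _ hq, h2 q (hZW q hq)]
          · rw [hz0, overwrite_notMem _ _ hq, h1 q hq]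
        · rw [if_neg h2, mul_zero]
      · rw [if_neg h1, zero_mul]
    · intro h
      exact absurd (Finset.mem_univ _) h
  ext x y
  rw [key X Y B B' A A' hX hB hB', key Y X B' B A' A (fun q h1 h2 => hX q h2 h1) hB' hB]
  refine if_congr ⟨fun h q h1 h2 => h q h2 h1, fun h q h1 h2 => h q h2 h1⟩ (mul_comm _ _) rfl

end ActsOn

end HVClassifier
end
noncomputable section
namespace HVClassifier
open Matrix
open scoped Matrix.Norms.L2Operator Nat

/-! ## Conjugation by exponentials as a series of nested commutators -/

section ExpConj

variable {𝔸 : Type*} [NormedRing 𝔸] [NormedAlgebra ℂ 𝔸] [CompleteSpace 𝔸]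

/-- The commutator with `X`, as a function. -/
def commutator (X Y : 𝔸) : 𝔸 := X * Y - Y * X

lemma exp_clm_apply (F : 𝔸 →L[ℂ] 𝔸) (A : 𝔸) :
    HasSum (fun k : ℕ => ((k ! : ℂ)⁻¹) • (F ^ k) A) (NormedSpace.exp F A) := by
  have h := NormedSpace.exp_series_hasSum_exp' (𝕂 := ℂ) F
  have h' := h.mapL (ContinuousLinearMap.apply ℂ 𝔸 A)
  simpa only [ContinuousLinearMap.apply_apply, _root_.smul_apply] using h'

/-- Left multiplication by X and right multiplication by -X commute, and their sum is the commutator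
with X. So the exponential of the commutator map is the product of the two exponentials, which is
the conjugation. -/
lemma hasSum_commutator_exp_conj (X A : 𝔸) :
    HasSum (fun k : ℕ => ((k ! : ℂ)⁻¹) • (commutator X)^[k] A)
      (NormedSpace.exp X * A * NormedSpace.exp (-X)) := by
  set L : 𝔸 →L[ℂ] 𝔸 := ContinuousLinearMap.mul ℂ 𝔸 X with hL
  set R : 𝔸 →L[ℂ] 𝔸 := (ContinuousLinearMap.mul ℂ 𝔸).flip (-X) with hR
  have hexp := NormedSpace.exp_series_hasSum_exp' (𝕂 := ℂ) X
  have hexp' := NormedSpace.exp_series_hasSum_exp' (𝕂 := ℂ) (-X)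
  have hLk : ∀ (k : ℕ) (B : 𝔸), (L ^ k) B = X ^ k * B := by
    intro k
    induction k with
    | zero => intro B; simp
    | succ k ih => intro B; rw [pow_succ, mul_apply_eq_comp, ih, hL]; simp [pow_succ, mul_assoc]
  have hRk : ∀ (k : ℕ) (B : 𝔸), (R ^ k) B = B * (-X) ^ k := by
    intro k
    induction k with
    | zero => intro B; simp
    | succ k ih =>
      intro B
      rw [pow_succ, mul_apply_eq_comp, ih, hR, ContinuousLinearMap.flip_apply,
        ContinuousLinearMap.mul_apply', pow_succ', mul_assoc]
  have eL : ∀ B, NormedSpace.exp L B = NormedSpace.exp X * B := fun B =>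
    (exp_clm_apply L B).unique <| by
      simpa only [hLk, smul_mul_assoc] using hexp.mul_right B
  have eR : ∀ B, NormedSpace.exp R B = B * NormedSpace.exp (-X) := fun B =>
    (exp_clm_apply R B).unique <| by
      simpa only [hRk, mul_smul_comm] using hexp'.mul_left B
  have hcomm : Commute L R := by
    ext B
    simp [hL, hR, mul_assoc]
  have hk : ∀ k : ℕ, ((L + R) ^ k) A = (commutator X)^[k] A := by
    intro k
    induction k with
    | zero => simp
    | succ k ih =>
      rw [pow_succ', mul_apply_eq_comp, ih, Function.iterate_succ_apply']
      simp [hL, hR, commutator, sub_eq_add_neg]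
  have h := exp_clm_apply (L + R) A
  let _ : NormedAlgebra ℚ (𝔸 →L[ℂ] 𝔸) := NormedAlgebra.restrictScalars ℚ ℂ (𝔸 →L[ℂ] 𝔸)
  rw [NormedSpace.exp_add_of_commute hcomm, mul_apply_eq_comp, eR, eL] at h
  simpa only [hk, mul_assoc] using h

end ExpConj

/-! ## Clusters of interaction terms and operators decomposed along them -/

namespace Problem

variable {n K : ℕ} {𝒳 : Type*} (P : Problem n K 𝒳)

/-- The qubit sets obtained from the support of the observable by attaching successively at most
`m` supports of interaction terms, each of which meets the set constructed before. -/
inductive Cluster : ℕ → Finset (Fin n) → Prop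
  | base (m : ℕ) : Cluster m P.obsSupp
  | attach {m : ℕ} {X : Finset (Fin n)} (k : Fin K) (j : Fin (P.ham k).numTerms) :
      Cluster m X → ((P.ham k).supp j ∩ X).Nonempty → Cluster (m + 1) (X ∪ (P.ham k).supp j)

/-- Operators that are sums of operators acting on clusters of level `m`, with a bound on the sum
of the norms. -/
inductive ClusterSum (m : ℕ) : Op n → ℝ → Prop
  | zero : ClusterSum m 0 0
  | single {A : Op n} {w : ℝ} {X : Finset (Fin n)} :
      P.Cluster m X → ActsOn A X → ‖A‖ ≤ w → ClusterSum m A w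
  | add {A B : Op n} {v w : ℝ} :
      ClusterSum m A v → ClusterSum m B w → ClusterSum m (A + B) (v + w)

variable {P}

lemma Cluster.mono {m m' : ℕ} {X : Finset (Fin n)} (h : P.Cluster m X) (hm : m ≤ m') :
    P.Cluster m' X := by
  induction h generalizing m' with
  | base => exact .base _
  | attach k j _ hj ih =>
    obtain ⟨r, rfl⟩ : ∃ r, m' = r + 1 := ⟨m' - 1, by omega⟩
    exact .attach k j (ih (by omega)) hj

lemma Cluster.card_le {Λ ℓ m : ℕ} {X : Finset (Fin n)} (hloc : ∀ k, (P.ham k).LocalityLE Λ)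
    (hobs : P.obsSupp.card ≤ ℓ) (h : P.Cluster m X) : X.card ≤ ℓ + m * Λ := by
  induction h with
  | base => exact hobs.trans (Nat.le_add_right _ _)
  | attach k j _ _ ih =>
    refine (Finset.card_union_le _ _).trans ?_
    have := hloc k j
    rw [add_mul, one_mul]
    omega

lemma ClusterSum.norm_le {m : ℕ} {A : Op n} {w : ℝ} (h : P.ClusterSum m A w) : ‖A‖ ≤ w := by
  induction h with
  | zero => simp
  | single _ _ h => exact h
  | add _ _ h1 h2 => exact (norm_add_le _ _).trans (add_le_add h1 h2)

lemma ClusterSum.mono {m m' : ℕ} {A : Op n} {w : ℝ} (h : P.ClusterSum m A w) (hm : m ≤ m') :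
    P.ClusterSum m' A w := by
  induction h with
  | zero => exact .zero
  | single h1 h2 h3 => exact .single (h1.mono hm) h2 h3
  | add _ _ h1 h2 => exact .add h1 h2

lemma ClusterSum.smul {m : ℕ} {A : Op n} {w : ℝ} (h : P.ClusterSum m A w) (c : ℂ) :
    P.ClusterSum m (c • A) (‖c‖ * w) := by
  induction h with
  | zero => simpa using ClusterSum.zero
  | single h1 h2 h3 =>
    refine .single h1 (h2.smul c) ?_
    rw [norm_smul]
    exact mul_le_mul_of_nonneg_left h3 (norm_nonneg c)
  | add _ _ h1 h2 => rw [smul_add, mul_add]; exact .add h1 h2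

lemma ClusterSum.sum {ι : Type*} {m : ℕ} {f : ι → Op n} {w : ι → ℝ} (s : Finset ι)
    (h : ∀ i ∈ s, P.ClusterSum m (f i) (w i)) : P.ClusterSum m (∑ i ∈ s, f i) (∑ i ∈ s, w i) := by
  classical
  induction s using Finset.induction_on with
  | empty => simpa using ClusterSum.zero
  | insert a s ha ih =>
    rw [Finset.sum_insert ha, Finset.sum_insert ha]
    exact .add (h a (by simp)) (ih fun i hi => h i (by simp [hi]))

/-- The surplus weight is carried by the zero operator on the base cluster. -/
lemma ClusterSum.weaken {m : ℕ} {A : Op n} {v w : ℝ} (h : P.ClusterSum m A v) (hvw : v ≤ w) :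
    P.ClusterSum m A w := by
  have h0 : P.ClusterSum m 0 (w - v) :=
    .single (.base m) (ActsOn.zero _) (by simpa using hvw)
  simpa using h.add h0

end Problem

/-! ## Interaction terms near a set of qubits -/

open Classical in
-- The terms containing a common qubit form a clique, so they are one term together with some of its
-- neighbours.
lemma LocalHamiltonian.card_terms_at_le {n d : ℕ} (H : LocalHamiltonian n) (hH : H.DegreeLE d)
    (q : Fin n) : (Finset.univ.filter fun j => q ∈ H.supp j).card ≤ d + 1 := by
  set S := Finset.univ.filter fun j => q ∈ H.supp j with hS
  rcases S.eq_empty_or_nonempty with h | ⟨j, hj⟩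
  · simp [h]
  · have h1 : (↑(S.erase j) : Set (Fin H.numTerms)) ⊆ H.interactionGraph.neighborSet j := by
      intro i hi
      simp only [Finset.coe_erase, Set.mem_sdiff, Finset.mem_coe, Set.mem_singleton_iff] at hi
      have hi1 : q ∈ H.supp i := by simpa [hS] using hi.1
      have hj1 : q ∈ H.supp j := by simpa [hS] using hj
      exact ⟨fun h => hi.2 h.symm, q, Finset.mem_inter.mpr ⟨hj1, hi1⟩⟩
    have h2 := (Set.ncard_le_ncard h1 (Set.toFinite _)).trans (hH j)
    rw [Set.ncard_coe_finset, Finset.card_erase_of_mem hj] at h2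
    omega

open Classical in
lemma LocalHamiltonian.card_terms_meeting_le {n d : ℕ} (H : LocalHamiltonian n)
    (hH : H.DegreeLE d) (X : Finset (Fin n)) :
    (Finset.univ.filter fun j => (H.supp j ∩ X).Nonempty).card ≤ X.card * (d + 1) := by
  have h : (Finset.univ.filter fun j => (H.supp j ∩ X).Nonempty) ⊆
      X.biUnion fun q => Finset.univ.filter fun j => q ∈ H.supp j := by
    intro j hj
    obtain ⟨q, hq⟩ := (Finset.mem_filter.mp hj).2
    rw [Finset.mem_inter] at hq
    exact Finset.mem_biUnion.mpr ⟨q, hq.2, by simpa using hq.1⟩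
  exact (Finset.card_le_card h).trans
    (Finset.card_biUnion_le_card_mul _ _ _ fun q _ => H.card_terms_at_le hH q)

/-! ## Approximation of the Heisenberg evolution by cluster sums -/

namespace Problem

variable {n K : ℕ} {𝒳 : Type*} {P : Problem n K 𝒳}

open Classical in
-- Terms disjoint from a cluster X commute with operators on it. At most |X|(d + 1) terms remain,
-- where |X| ≤ ℓ + mΛ, and each enlarges the cluster by one support and contributes weight at most
-- 2‖z‖w.
lemma ClusterSum.commutator_ham {Λ d ℓ m : ℕ} {A : Op n} {w : ℝ}
    (hloc : ∀ k, (P.ham k).LocalityLE Λ) (hdeg : ∀ k, (P.ham k).DegreeLE d)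
    (hobs : P.obsSupp.card ≤ ℓ) (k : Fin K) (z : ℂ) (h : P.ClusterSum m A w) :
    P.ClusterSum (m + 1) (commutator (z • (P.ham k).toOp) A)
      (2 * ‖z‖ * ((ℓ + m * Λ : ℕ) * (d + 1)) * w) := by
  induction h with
  | zero => simpa [commutator] using ClusterSum.zero
  | @single A w X hX hA hw =>
    have hw0 : 0 ≤ w := (norm_nonneg A).trans hw
    set H := P.ham k
    set S := Finset.univ.filter fun j => (H.supp j ∩ X).Nonempty with hS
    have e : commutator (z • H.toOp) A = ∑ j ∈ S,
        (z * H.coeff j) • (H.term j * A - A * H.term j) := by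
      have e1 : commutator (z • H.toOp) A = ∑ j, (z * H.coeff j) • (H.term j * A - A * H.term j) := by
        simp only [commutator, LocalHamiltonian.toOp, Finset.smul_sum, Finset.sum_mul,
          Finset.mul_sum, ← Finset.sum_sub_distrib, smul_sub, smul_smul, smul_mul_assoc,
          mul_smul_comm]
      rw [e1, hS, Finset.sum_filter]
      refine Finset.sum_congr rfl fun j _ => ?_
      split_ifs with hj
      · rfl
      · have hdis : Disjoint (H.supp j) X := by
          rw [Finset.disjoint_iff_inter_eq_empty]
          exact Finset.not_nonempty_iff_eq_empty.mp hj
        rw [(H.term_actsOn j).commute_of_disjoint hA hdis, sub_self, smul_zero]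
    rw [e]
    have hterm : ∀ j ∈ S, P.ClusterSum (m + 1) ((z * H.coeff j) • (H.term j * A - A * H.term j))
        (2 * ‖z‖ * w) := by
      intro j hj
      refine .single (.attach k j hX (Finset.mem_filter.mp hj).2) ?_ ?_
      · have h1 := (H.term_actsOn j).mono (Finset.subset_union_right (s₁ := X))
        have h2 := hA.mono (Finset.subset_union_left (s₂ := H.supp j))
        exact ((h1.mul h2).sub (h2.mul h1)).smul _
      · have hc : ‖(H.coeff j : ℂ)‖ ≤ 1 := by simpa using H.coeff_le j
        have ht : ‖H.term j‖ ≤ 1 := H.term_norm_le j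
        have h1 : ‖H.term j * A - A * H.term j‖ ≤ 2 * w := by
          refine (norm_sub_le _ _).trans ?_
          have a1 := norm_mul_le (H.term j) A
          have a2 := norm_mul_le A (H.term j)
          have a3 : ‖H.term j‖ * ‖A‖ ≤ 1 * w := mul_le_mul ht hw (norm_nonneg _) zero_le_one
          linarith [mul_comm ‖A‖ ‖H.term j‖]
        rw [norm_smul, norm_mul]
        calc ‖z‖ * ‖(H.coeff j : ℂ)‖ * ‖H.term j * A - A * H.term j‖
            ≤ ‖z‖ * 1 * (2 * w) := by gcongr
          _ = 2 * ‖z‖ * w := by ring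
    refine (ClusterSum.sum S hterm).weaken ?_
    rw [Finset.sum_const, nsmul_eq_mul]
    have hcard : (S.card : ℝ) ≤ (ℓ + m * Λ : ℕ) * (d + 1) := by
      have h1 := H.card_terms_meeting_le (hdeg k) X
      have h2 := hX.card_le hloc hobs
      exact_mod_cast h1.trans (Nat.mul_le_mul_right _ h2)
    calc (S.card : ℝ) * (2 * ‖z‖ * w) ≤ ((ℓ + m * Λ : ℕ) * (d + 1)) * (2 * ‖z‖ * w) := by gcongr
      _ = _ := by ring
  | add _ _ h1 h2 =>
    have e : ∀ X A B : Op n, commutator X (A + B) = commutator X A + commutator X B := by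
      intro X A B; simp only [commutator, mul_add, add_mul]; abel
    rw [e, mul_add]
    exact .add h1 h2

/-- At level m + r the cluster size is at most (ℓ + Λ)(m + 1 + r), so the branching factors multiply
to the rising factorial (m + 1)⋯(m + r). -/
lemma ClusterSum.iterate_commutator {Λ d ℓ m : ℕ} {A : Op n} {w : ℝ}
    (hloc : ∀ k, (P.ham k).LocalityLE Λ) (hdeg : ∀ k, (P.ham k).DegreeLE d)
    (hobs : P.obsSupp.card ≤ ℓ) (k : Fin K) (z : ℂ) (hw : 0 ≤ w) (h : P.ClusterSum m A w) (r : ℕ) :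
    P.ClusterSum (m + r) ((commutator (z • (P.ham k).toOp))^[r] A)
      ((2 * ‖z‖ * ((ℓ + Λ) * (d + 1))) ^ r * ((m + 1).ascFactorial r) * w) := by
  induction r with
  | zero => simpa using h
  | succ r ih =>
    rw [Function.iterate_succ_apply']
    refine (ih.commutator_ham hloc hdeg hobs k z).weaken ?_
    have h1 : ((ℓ + (m + r) * Λ : ℕ) : ℝ) ≤ (ℓ + Λ) * (m + 1 + r : ℕ) := by
      have : ℓ + (m + r) * Λ ≤ (ℓ + Λ) * (m + 1 + r) := by nlinarith
      exact_mod_cast this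
    rw [Nat.ascFactorial_succ, pow_succ]
    push_cast at h1 ⊢
    calc 2 * ‖z‖ * ((ℓ + (m + r) * Λ) * (d + 1)) *
          ((2 * ‖z‖ * ((ℓ + Λ) * (d + 1))) ^ r * ((m + 1).ascFactorial r) * w)
        ≤ 2 * ‖z‖ * (((ℓ + Λ) * (m + 1 + r)) * (d + 1)) *
          ((2 * ‖z‖ * ((ℓ + Λ) * (d + 1))) ^ r * ((m + 1).ascFactorial r) * w) := by gcongr
      _ = _ := by ring

/-- Short-time evolution of a cluster sum is close to a cluster sum of higher level. -/
lemma ClusterSum.exists_short_evolution {Λ d ℓ m : ℕ} {A : Op n} {w : ℝ}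
    (hloc : ∀ k, (P.ham k).LocalityLE Λ) (hdeg : ∀ k, (P.ham k).DegreeLE d)
    (hobs : P.obsSupp.card ≤ ℓ) (k : Fin K) (z : ℂ) (hw : 0 ≤ w)
    (hz : 2 * ‖z‖ * ((ℓ + Λ) * (d + 1)) ≤ 1 / 4) (h : P.ClusterSum m A w) (L : ℕ) :
    ∃ B, P.ClusterSum (m + L) B (2 ^ (m + 1) * w) ∧
      ‖NormedSpace.exp (z • (P.ham k).toOp) * A * NormedSpace.exp (-(z • (P.ham k).toOp)) - B‖ ≤
        2 ^ (m + 1) * w * (1 / 2) ^ L := by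
  set X := z • (P.ham k).toOp
  set f : ℕ → Op n := fun r => ((r ! : ℂ)⁻¹) • (commutator X)^[r] A with hf
  have hterm : ∀ r, P.ClusterSum (m + r) (f r) (2 ^ m * w * (1 / 2) ^ r) := by
    intro r
    refine ((h.iterate_commutator hloc hdeg hobs k z hw r).smul _).weaken ?_
    have hfac : (0 : ℝ) < (r ! : ℝ) := by exact_mod_cast r.factorial_pos
    -- Dividing the rising factorial by r! leaves this binomial coefficient. The smallness 1/4 of
    -- the step turns 2^(m + r) into 2^m times a geometric sequence with ratio 1/2.
    have hchoose : (((m + r).choose r : ℕ) : ℝ) ≤ 2 ^ (m + r) := by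
      exact_mod_cast Nat.choose_le_two_pow (m + r) r
    rw [Nat.ascFactorial_eq_factorial_mul_choose, norm_inv, Complex.norm_natCast]
    push_cast
    have hx0 : 0 ≤ 2 * ‖z‖ * ((ℓ + Λ : ℝ) * (d + 1)) := by positivity
    calc (r ! : ℝ)⁻¹ * ((2 * ‖z‖ * ((ℓ + Λ) * (d + 1))) ^ r * (r ! * ((m + r).choose r)) * w)
        = (2 * ‖z‖ * ((ℓ + Λ) * (d + 1))) ^ r * ((m + r).choose r) * w := by
          field_simp
      _ ≤ (1 / 4) ^ r * 2 ^ (m + r) * w := by gcongr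
      _ = 2 ^ m * w * (1 / 2) ^ r := by
          rw [pow_add, show (1 / 4 : ℝ) ^ r = (1 / 2) ^ r * (1 / 2) ^ r by
            rw [← mul_pow]; norm_num]
          have : (1 / 2 : ℝ) ^ r * 2 ^ r = 1 := by rw [← mul_pow]; norm_num
          linear_combination (2 ^ m * (1 / 2) ^ r * w) * this
  have hsum := hasSum_commutator_exp_conj X A
  refine ⟨∑ r ∈ Finset.range L, f r, ?_, ?_⟩
  · refine (ClusterSum.sum (Finset.range L) fun r hr =>
      (hterm r).mono (by have := Finset.mem_range.mp hr; omega)).weaken ?_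
    rw [← Finset.mul_sum]
    have hg : ∑ r ∈ Finset.range L, (1 / 2 : ℝ) ^ r ≤ 2 := sum_geometric_two_le L
    calc 2 ^ m * w * ∑ r ∈ Finset.range L, (1 / 2 : ℝ) ^ r ≤ 2 ^ m * w * 2 := by gcongr
      _ = 2 ^ (m + 1) * w := by ring
  · have := norm_sub_le_of_geometric_bound_of_hasSum (by norm_num : (1 / 2 : ℝ) < 1)
      (fun r => (hterm r).norm_le) hsum L
    rw [norm_sub_rev] at this
    refine this.trans (le_of_eq ?_)
    ring

end Problem

end HVClassifier
end
noncomputable section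
namespace HVClassifier
open Matrix
open scoped Matrix.Norms.L2Operator Nat

namespace Problem

variable {n K : ℕ} {𝒳 : Type*} {P : Problem n K 𝒳}

/-! ## Evolution for long times as a composition of short steps -/

/-- Successive conjugations of `A` by `exp (z H)` for the pairs `(H, z)` of a list. -/
def evolve (P : Problem n K 𝒳) : List (Fin K × ℂ) → Op n → Op n
  | [], A => A
  | (k, z) :: l, A => evolve P l
      (NormedSpace.exp (z • (P.ham k).toOp) * A * NormedSpace.exp (-(z • (P.ham k).toOp)))

lemma evolve_append (l l' : List (Fin K × ℂ)) (A : Op n) :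
    P.evolve (l ++ l') A = P.evolve l' (P.evolve l A) := by
  induction l generalizing A with
  | nil => rfl
  | cons s l ih => exact ih _

lemma toOp_isHermitian (H : LocalHamiltonian n) : H.toOp.IsHermitian := by
  unfold LocalHamiltonian.toOp Matrix.IsHermitian
  rw [conjTranspose_sum]
  refine Finset.sum_congr rfl fun j _ => ?_
  rw [conjTranspose_smul, (H.term_hermitian j).eq]
  simp

lemma imaginary_smul_toOp_mem_skewAdjoint (H : LocalHamiltonian n) {z : ℂ} (hz : star z = -z) :
    z • H.toOp ∈ skewAdjoint (Op n) := by
  rw [skewAdjoint.mem_iff, star_smul, hz, star_eq_conjTranspose, (toOp_isHermitian H).eq, neg_smul]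

lemma star_I_mul_ofReal (t : ℝ) : star (Complex.I * (t : ℂ)) = -(Complex.I * t) := by
  rw [Complex.star_def, map_mul, Complex.conj_I, Complex.conj_ofReal, neg_mul]

lemma norm_exp_conj (H : LocalHamiltonian n) {z : ℂ} (hz : star z = -z) (A : Op n) :
    ‖NormedSpace.exp (z • H.toOp) * A * NormedSpace.exp (-(z • H.toOp))‖ = ‖A‖ := by
  let _ : NormedAlgebra ℚ (Op n) := NormedAlgebra.restrictScalars ℚ ℂ (Op n)
  have h1 := NormedSpace.exp_mem_unitary_of_mem_skewAdjoint
    (imaginary_smul_toOp_mem_skewAdjoint H hz)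
  have h2 := NormedSpace.exp_mem_unitary_of_mem_skewAdjoint
    (neg_mem (imaginary_smul_toOp_mem_skewAdjoint H hz))
  rw [CStarRing.norm_mul_mem_unitary _ h2, CStarRing.norm_mem_unitary_mul _ h1]

lemma norm_evolve (l : List (Fin K × ℂ)) (hl : ∀ s ∈ l, star s.2 = -s.2) (A : Op n) :
    ‖P.evolve l A‖ = ‖A‖ := by
  induction l generalizing A with
  | nil => rfl
  | cons s l ih =>
    rw [← norm_exp_conj (P.ham s.1) (hl s (by simp)) A]
    exact ih (fun s hs => hl s (by simp [hs])) _

/-- The induction keeps level and logarithm of the weight equal to t = 4^i (Q + 1). One step raises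
the level to 3t + 1 + Q and the weight to 2^(2t + 1); both fit under 4t because Q + 1 ≤ t. The
errors of the steps simply add up. -/
lemma exists_clusterSum_evolve {Λ d ℓ : ℕ} (hloc : ∀ k, (P.ham k).LocalityLE Λ)
    (hdeg : ∀ k, (P.ham k).DegreeLE d) (hobs : P.obsSupp.card ≤ ℓ) (Q : ℕ)
    (l : List (Fin K × ℂ)) (hl : ∀ s ∈ l, star s.2 = -s.2)
    (hl' : ∀ s ∈ l, 2 * ‖s.2‖ * ((ℓ + Λ) * (d + 1)) ≤ 1 / 4) (i : ℕ) (A B : Op n)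
    (hB : P.ClusterSum (4 ^ i * (Q + 1)) B (2 ^ (4 ^ i * (Q + 1))))
    (hAB : ‖A - B‖ ≤ i * (1 / 2) ^ Q) :
    ∃ B', P.ClusterSum (4 ^ (i + l.length) * (Q + 1)) B' (2 ^ (4 ^ (i + l.length) * (Q + 1))) ∧
      ‖P.evolve l A - B'‖ ≤ (i + l.length : ℕ) * (1 / 2) ^ Q := by
  induction l generalizing i A B with
  | nil => exact ⟨B, hB, hAB⟩
  | cons s l ih =>
    obtain ⟨k, z⟩ := s
    have hz := hl (k, z) (by simp)
    have hz' := hl' (k, z) (by simp)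
    set t := 4 ^ i * (Q + 1) with ht
    have hQt : Q + 1 ≤ t := Nat.le_mul_of_pos_left _ (by positivity)
    have h4 : 4 ^ (i + 1) * (Q + 1) = 4 * t := by rw [ht, pow_succ]; ring
    -- The truncation order is chosen so that t + 1 + t halvings cancel the prefactor 2^(t + 1) ·
    -- 2^t of the tail, and Q further ones remain as the error.
    obtain ⟨B', hB', herr⟩ := hB.exists_short_evolution hloc hdeg hobs k z (by positivity) hz'
      (t + 1 + t + Q)
    set X := z • (P.ham k).toOp
    have e1 : P.ClusterSum (4 ^ (i + 1) * (Q + 1)) B' (2 ^ (4 ^ (i + 1) * (Q + 1))) := by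
      rw [h4]
      refine (hB'.mono (by omega)).weaken ?_
      rw [← pow_add]
      exact pow_le_pow_right₀ (by norm_num) (by omega)
    have e2 : ‖NormedSpace.exp X * A * NormedSpace.exp (-X) - B'‖ ≤
        ((i + 1 : ℕ) : ℝ) * (1 / 2) ^ Q := by
      -- The first summand is the inherited error, whose norm the unitary conjugation preserves; the
      -- second is the new truncation error.
      have a1 : NormedSpace.exp X * A * NormedSpace.exp (-X) - B' =
          NormedSpace.exp X * (A - B) * NormedSpace.exp (-X) +
            (NormedSpace.exp X * B * NormedSpace.exp (-X) - B') := by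
        rw [mul_sub, sub_mul]; abel
      have a2 : (2 : ℝ) ^ (t + 1) * 2 ^ t * (1 / 2) ^ (t + 1 + t + Q) = (1 / 2) ^ Q := by
        rw [pow_add (1 / 2 : ℝ), ← pow_add, ← mul_assoc, ← mul_pow]
        norm_num
      rw [a1]
      refine (norm_add_le _ _).trans ?_
      rw [norm_exp_conj _ hz]
      rw [a2] at herr
      push_cast
      linarith
    obtain ⟨B'', h1, h2⟩ := ih (fun s hs => hl s (by simp [hs])) (fun s hs => hl' s (by simp [hs]))
      (i + 1) _ B' e1 e2
    have hlen : i + 1 + l.length = i + ((k, z) :: l).length := by simp; omega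
    rw [hlen] at h1 h2
    exact ⟨B'', h1, h2⟩

/-! ## The ansatz as a composition of short steps -/

lemma evolve_replicate (k : Fin K) (z : ℂ) (r : ℕ) (A : Op n) :
    P.evolve (List.replicate r (k, z)) A =
      NormedSpace.exp (((r : ℂ) * z) • (P.ham k).toOp) * A *
        NormedSpace.exp (-(((r : ℂ) * z) • (P.ham k).toOp)) := by
  have e : ∀ X : Op n, ((r : ℂ) * z) • X = r • (z • X) := by
    intro X
    rw [← smul_smul, Nat.cast_smul_eq_nsmul]
  rw [e, ← smul_neg, Matrix.exp_nsmul, Matrix.exp_nsmul]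
  clear e
  induction r generalizing A with
  | zero => simp [evolve]
  | succ r ih =>
    rw [List.replicate_succ]
    show P.evolve (List.replicate r (k, z)) _ = _
    rw [ih, pow_succ, pow_succ']
    simp only [mul_assoc]

/-- The short steps into which the ansatz is decomposed. -/
def shortSteps (θ : Fin K → ℝ) (r : ℕ) (ks : List (Fin K)) : List (Fin K × ℂ) :=
  ks.flatMap fun k => List.replicate r (k, Complex.I * ((θ k / r : ℝ) : ℂ))

/-- The first factor of the ansatz stands leftmost in U and hence innermost in the conjugation U†AU.
The short steps are therefore taken in the order of the indices, with generator +iθH. -/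
lemma conj_ansatz_eq_evolve (θ : Fin K → ℝ) {r : ℕ} (hr : 0 < r) (A : Op n) :
    (ansatz P.ham θ)ᴴ * A * ansatz P.ham θ = P.evolve (shortSteps θ r (List.finRange K)) A := by
  unfold ansatz
  rw [List.ofFn_eq_map]
  generalize List.finRange K = ks
  induction ks generalizing A with
  | nil => simp [shortSteps, evolve]
  | cons k ks ih =>
    have h1 : shortSteps θ r (k :: ks) =
        List.replicate r (k, Complex.I * ((θ k / r : ℝ) : ℂ)) ++ shortSteps θ r ks := by
      simp [shortSteps]
    have hr' : (r : ℂ) ≠ 0 := by exact_mod_cast hr.ne'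
    have h2 : (r : ℂ) * (Complex.I * ((θ k / r : ℝ) : ℂ)) = Complex.I * θ k := by
      push_cast; field_simp
    have h3 : (NormedSpace.exp ((-Complex.I * (θ k : ℂ)) • (P.ham k).toOp))ᴴ =
        NormedSpace.exp ((Complex.I * θ k) • (P.ham k).toOp) := by
      rw [← Matrix.exp_conjTranspose, conjTranspose_smul, (toOp_isHermitian _).eq]
      simp
    rw [h1, evolve_append, evolve_replicate, h2, ← ih, List.map_cons, List.prod_cons,
      conjTranspose_mul, h3, ← neg_smul, neg_mul]
    simp only [mul_assoc]

lemma norm_conj_ansatz_obs_le (θ : Fin K → ℝ) :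
    ‖(ansatz P.ham θ)ᴴ * P.obs * ansatz P.ham θ‖ ≤ 1 := by
  -- One step per Hamiltonian is enough here: only unitarity is needed, not short times.
  rw [conj_ansatz_eq_evolve θ one_pos, norm_evolve]
  · exact P.obs_norm_le
  · intro s hs
    simp only [shortSteps, List.mem_flatMap, List.mem_replicate] at hs
    obtain ⟨k, _, _, rfl⟩ := hs
    exact star_I_mul_ofReal _

lemma abs_prediction_le (θ : Fin K → ℝ) (i : Fin P.size) : |P.prediction θ i| ≤ 1 :=
  (abs_expectation_le _ _).trans (norm_conj_ansatz_obs_le θ)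

/-- The evolved observable is exponentially close to a cluster sum of moderate level. -/
lemma exists_clusterSum_conj_ansatz {Λ d ℓ : ℕ} (hloc : ∀ k, (P.ham k).LocalityLE Λ)
    (hdeg : ∀ k, (P.ham k).DegreeLE d) (hobs : P.obsSupp.card ≤ ℓ) {T : ℝ} {r : ℕ} (hr : 0 < r)
    (hrT : 8 * T * ((ℓ + Λ) * (d + 1)) ≤ r) (Q : ℕ) (θ : Fin K → ℝ) (hθ : ∀ k, |θ k| ≤ T) :
    ∃ B w, P.ClusterSum (4 ^ (K * r) * (Q + 1)) B w ∧
      ‖(ansatz P.ham θ)ᴴ * P.obs * ansatz P.ham θ - B‖ ≤ (K * r : ℕ) * (1 / 2) ^ Q := by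
  have hr0 : (0 : ℝ) < r := by exact_mod_cast hr
  have hmem : ∀ s ∈ shortSteps θ r (List.finRange K),
      ∃ k, s = (k, Complex.I * ((θ k / r : ℝ) : ℂ)) := by
    intro s hs
    simp only [shortSteps, List.mem_flatMap, List.mem_replicate] at hs
    obtain ⟨k, _, _, rfl⟩ := hs
    exact ⟨k, rfl⟩
  have hlen : (shortSteps θ r (List.finRange K)).length = K * r := by
    simp [shortSteps, List.length_flatMap]
  -- The observable would already have level zero; level Q + 1 is what the induction over the steps
  -- starts from.
  have h0 : P.ClusterSum (4 ^ 0 * (Q + 1)) P.obs (2 ^ (4 ^ 0 * (Q + 1))) :=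
    .single (.base _) P.obs_actsOn <| P.obs_norm_le.trans (one_le_pow₀ (by norm_num))
  obtain ⟨B, h1, h2⟩ := exists_clusterSum_evolve hloc hdeg hobs Q
    (shortSteps θ r (List.finRange K))
    (fun s hs => by
      obtain ⟨k, rfl⟩ := hmem s hs
      exact star_I_mul_ofReal _)
    (fun s hs => by
      obtain ⟨k, rfl⟩ := hmem s hs
      have h3 : ‖Complex.I * ((θ k / r : ℝ) : ℂ)‖ ≤ T / r := by
        rw [norm_mul, Complex.norm_I, one_mul, Complex.norm_real, Real.norm_eq_abs, abs_div,
          abs_of_pos hr0]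
        gcongr
        exact hθ k
      calc 2 * ‖Complex.I * ((θ k / r : ℝ) : ℂ)‖ * ((ℓ + Λ) * (d + 1))
          ≤ 2 * (T / r) * ((ℓ + Λ) * (d + 1)) := by gcongr
        _ = (8 * T * ((ℓ + Λ) * (d + 1))) / r / 4 := by ring
        _ ≤ 1 / 4 := by
          have : (8 * T * ((ℓ + Λ) * (d + 1))) / r ≤ 1 := (div_le_one hr0).mpr hrT
          linarith)
    0 P.obs P.obs h0 (by simp)
  rw [zero_add, hlen] at h1 h2
  rw [← conj_ansatz_eq_evolve θ hr] at h2
  exact ⟨B, _, h1, h2⟩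

end Problem

end HVClassifier
end
noncomputable section
namespace HVClassifier
open Matrix
open scoped Matrix.Norms.L2Operator

/-! ## Pauli expansions -/

section Pauli

variable {n : ℕ}

lemma pauliString_congr {p p' : ℕ → ℕ} (h : ∀ q < n, p q = p' q) :
    pauliString n p = pauliString n p' := by
  ext x y
  exact Finset.prod_congr rfl fun q _ => by rw [h q q.2]

lemma pauliMatrix_mul_self (c : ℕ) : pauliMatrix c * pauliMatrix c = 1 := by
  match c with
  | 0 => simp [pauliMatrix]
  | 1 => ext i j; fin_cases i <;> fin_cases j <;> simp [pauliMatrix]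
  | 2 => ext i j; fin_cases i <;> fin_cases j <;> simp [pauliMatrix]
  | (_ + 3) => ext i j; fin_cases i <;> fin_cases j <;> simp [pauliMatrix]

lemma pauliMatrix_star (c : ℕ) (i j : Fin 2) :
    star (pauliMatrix c i j) = pauliMatrix c j i := by
  match c with
  | 0 => fin_cases i <;> fin_cases j <;> simp [pauliMatrix]
  | 1 => fin_cases i <;> fin_cases j <;> simp [pauliMatrix]
  | 2 => fin_cases i <;> fin_cases j <;> simp [pauliMatrix]
  | (_ + 3) => fin_cases i <;> fin_cases j <;> simp [pauliMatrix]

lemma pauliString_mul_self (p : ℕ → ℕ) : pauliString n p * pauliString n p = 1 := by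
  ext x y
  rw [Matrix.mul_apply]
  simp only [pauliString, ← Finset.prod_mul_distrib]
  -- The sum over intermediate labels factorizes over the qubits.
  have h := (Finset.prod_univ_sum (fun _ : Fin n => (Finset.univ : Finset (Fin 2)))
    fun q c => pauliMatrix (p q) (x q) c * pauliMatrix (p q) c (y q)).symm
  rw [Fintype.piFinset_univ] at h
  rw [h]
  simp only [← Matrix.mul_apply, pauliMatrix_mul_self, Matrix.one_apply]
  rw [Finset.prod_ite_zero]
  simp [funext_iff]

lemma pauliString_isHermitian (p : ℕ → ℕ) : (pauliString n p).IsHermitian := by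
  ext x y
  simp [pauliString, Matrix.conjTranspose_apply, star_prod, pauliMatrix_star]

/-- The C*-identity for a Hermitian operator with square one. -/
lemma norm_pauliString (p : ℕ → ℕ) : ‖pauliString n p‖ = 1 := by
  have h1 := l2_opNorm_conjTranspose_mul_self (pauliString n p)
  rw [(pauliString_isHermitian p).eq, pauliString_mul_self, CStarRing.norm_one] at h1
  nlinarith [norm_nonneg (pauliString n p)]

lemma abs_expectation_pauliString_le (p : ℕ → ℕ) (φ : PureState n) :
    |expectation (pauliString n p) φ| ≤ 1 :=
  (abs_expectation_le _ φ).trans (norm_pauliString p).le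

/-- The codes of a Pauli operator given by finitely many codes in `{0, 1, 2, 3}`. -/
def codes (p : Fin n → Fin 4) : ℕ → ℕ := fun q => if h : q < n then p ⟨q, h⟩ else 0

lemma codes_apply (p : Fin n → Fin 4) (q : Fin n) : codes p q = p q := by simp [codes]

lemma pauliString_codes (p : Fin n → Fin 4) (x y : BasisLabel n) :
    pauliString n (codes p) x y = ∏ q, pauliMatrix (p q) (x q) (y q) := by
  simp [pauliString, codes_apply]

/-- The coefficient of a Pauli operator in the expansion of `A`. -/
def pauliCoeff (A : Op n) (p : Fin n → Fin 4) : ℂ :=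
  (2 ^ n : ℂ)⁻¹ * Matrix.trace (pauliString n (codes p) * A)

/-- Completeness of the single-qubit Pauli matrices: the sum of σ ⊗ σ is twice the swap. Taking the
product over the qubits yields the Pauli expansion of every operator. -/
lemma sum_pauliMatrix (i j k l : Fin 2) :
    ∑ c : Fin 4, pauliMatrix c i j * pauliMatrix c k l = if i = l ∧ j = k then 2 else 0 := by
  simp only [Fin.sum_univ_four]
  fin_cases i <;> fin_cases j <;> fin_cases k <;> fin_cases l <;>
    simp [pauliMatrix] <;> norm_num

lemma sum_pauliString (x y z w : BasisLabel n) :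
    ∑ p : Fin n → Fin 4, pauliString n (codes p) x y * pauliString n (codes p) z w =
      if x = w ∧ y = z then 2 ^ n else 0 := by
  simp only [pauliString_codes, ← Finset.prod_mul_distrib]
  have h := (Finset.prod_univ_sum (fun _ : Fin n => (Finset.univ : Finset (Fin 4)))
    fun q c => pauliMatrix c (x q) (y q) * pauliMatrix c (z q) (w q)).symm
  rw [Fintype.piFinset_univ] at h
  rw [h]
  simp only [sum_pauliMatrix]
  rw [Finset.prod_ite_zero]
  simp [funext_iff, forall_and]

lemma sum_pauliCoeff_smul (A : Op n) :
    ∑ p : Fin n → Fin 4, pauliCoeff A p • pauliString n (codes p) = A := by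
  ext x y
  rw [Matrix.sum_apply]
  have h1 : ∀ p : Fin n → Fin 4, (pauliCoeff A p • pauliString n (codes p)) x y =
      ∑ z, ∑ w, (2 ^ n : ℂ)⁻¹ * A w z *
        (pauliString n (codes p) z w * pauliString n (codes p) x y) := by
    intro p
    rw [Matrix.smul_apply, pauliCoeff, Matrix.trace, smul_eq_mul, Finset.mul_sum, Finset.sum_mul]
    refine Finset.sum_congr rfl fun z _ => ?_
    rw [Matrix.diag_apply, Matrix.mul_apply, Finset.mul_sum, Finset.sum_mul]
    exact Finset.sum_congr rfl fun w _ => by ring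
  simp only [h1]
  rw [Finset.sum_comm]
  simp only [Finset.sum_comm (s := (Finset.univ : Finset (Fin n → Fin 4))), ← Finset.mul_sum,
    sum_pauliString]
  rw [Finset.sum_eq_single y]
  · rw [Finset.sum_eq_single x]
    · simp only [and_self, if_true]
      field_simp
    · intro w _ hw
      simp [hw]
    · simp
  · intro z _ hz
    refine Finset.sum_eq_zero fun w _ => ?_
    simp [hz]
  · simp

/-- The trace has 2^n diagonal entries, each bounded by the operator norm, and the normalization
removes this factor. -/
lemma norm_pauliCoeff_le (A : Op n) (p : Fin n → Fin 4) : ‖pauliCoeff A p‖ ≤ ‖A‖ := by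
  have h1 : ‖Matrix.trace (pauliString n (codes p) * A)‖ ≤ 2 ^ n * ‖A‖ := by
    calc ‖Matrix.trace (pauliString n (codes p) * A)‖
        ≤ ∑ x : BasisLabel n, ‖(pauliString n (codes p) * A) x x‖ := norm_sum_le _ _
      _ ≤ ∑ _x : BasisLabel n, ‖A‖ := by
          refine Finset.sum_le_sum fun x _ => (norm_entry_le _ x x).trans ?_
          refine (norm_mul_le _ _).trans ?_
          rw [norm_pauliString, one_mul]
      _ = 2 ^ n * ‖A‖ := by simp
  rw [pauliCoeff, norm_mul]
  have h2 : ‖((2 : ℂ) ^ n)⁻¹‖ = (2 ^ n : ℝ)⁻¹ := by simp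
  rw [h2, inv_mul_le_iff₀ (by positivity)]
  exact h1

/-- The basis label with one bit flipped. -/
def flipBit (q : Fin n) (x : BasisLabel n) : BasisLabel n := Function.update x q (1 - x q)

lemma flipBit_flipBit (q : Fin n) (x : BasisLabel n) : flipBit q (flipBit q x) = x := by
  simp [flipBit]

lemma pauliMatrix_flip {c : Fin 4} (hc : c ≠ 0) (i : Fin 2) :
    pauliMatrix c (1 - i) (1 - i) = -pauliMatrix c i i := by
  fin_cases c <;> fin_cases i <;> simp_all [pauliMatrix]

/-- Flipping bit q in both indices leaves the entries of A unchanged because q lies outside its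
support. On entries diagonal in q it reverses the sign of a non-identity Pauli matrix, and A
vanishes on the others. So the trace equals its own negative. -/
lemma pauliCoeff_eq_zero {A : Op n} {X : Finset (Fin n)} (hA : ActsOn A X) {p : Fin n → Fin 4}
    {q : Fin n} (hq : q ∉ X) (hp : p q ≠ 0) : pauliCoeff A p = 0 := by
  obtain ⟨B, hB⟩ := hA
  have hterm : ∀ x y, pauliString n (codes p) (flipBit q x) (flipBit q y) *
      A (flipBit q y) (flipBit q x) = -(pauliString n (codes p) x y * A y x) := by
    intro x y
    have hoff : ∀ (x : BasisLabel n) (q' : Fin n), q' ≠ q → flipBit q x q' = x q' :=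
      fun x q' h => Function.update_of_ne h _ _
    have hon : ∀ x : BasisLabel n, flipBit q x q = 1 - x q := fun x => Function.update_self _ _ _
    have hX : ∀ x : BasisLabel n, (fun q' : X => flipBit q x q') = fun q' : X => x q' := by
      intro x
      funext q'
      exact hoff x q' fun h => hq (h ▸ q'.2)
    have hiff : (∀ q', q' ∉ X → flipBit q y q' = flipBit q x q') ↔ ∀ q', q' ∉ X → y q' = x q' := by
      refine forall₂_congr fun q' _ => ?_
      by_cases h : q' = q
      · subst h; rw [hon, hon]; exact sub_right_inj
      · rw [hoff _ _ h, hoff _ _ h]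
    rw [hB, hB, hX, hX]
    by_cases h : ∀ q', q' ∉ X → y q' = x q'
    · rw [if_pos (hiff.mpr h), if_pos h]
      have hP : pauliString n (codes p) (flipBit q x) (flipBit q y) =
          -pauliString n (codes p) x y := by
        rw [pauliString_codes, pauliString_codes, ← Finset.mul_prod_erase _ _ (Finset.mem_univ q),
          ← Finset.mul_prod_erase _ (fun q => pauliMatrix (p q) (x q) (y q)) (Finset.mem_univ q),
          hon, hon, h q hq, pauliMatrix_flip hp, neg_mul]
        congr 2
        refine Finset.prod_congr rfl fun q' hq' => ?_
        have := Finset.ne_of_mem_erase hq'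
        rw [hoff _ _ this, hoff _ _ this]
      rw [hP, neg_mul]
    · rw [if_neg (fun h' => h (hiff.mp h')), if_neg h, mul_zero, mul_zero, neg_zero]
  let e : BasisLabel n ≃ BasisLabel n :=
    ⟨flipBit q, flipBit q, flipBit_flipBit q, flipBit_flipBit q⟩
  have htr : Matrix.trace (pauliString n (codes p) * A) =
      -Matrix.trace (pauliString n (codes p) * A) := by
    simp only [Matrix.trace, Matrix.diag_apply, Matrix.mul_apply]
    rw [← Finset.sum_neg_distrib, ← Equiv.sum_comp e]
    refine Finset.sum_congr rfl fun x _ => ?_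
    rw [← Finset.sum_neg_distrib, ← Equiv.sum_comp e]
    exact Finset.sum_congr rfl fun y _ => hterm x y
  rw [pauliCoeff, self_eq_neg.mp htr, mul_zero]

/-- Pauli expectations are real, so only real parts of coefficients count. This matters because A,
in the application a truncated series, is not assumed Hermitian. -/
lemma expectation_eq_sum_pauliCoeff (A : Op n) (φ : PureState n) :
    expectation A φ =
      ∑ p : Fin n → Fin 4, (pauliCoeff A p).re * expectation (pauliString n (codes p)) φ := by
  have him : ∀ p : ℕ → ℕ, (star φ.1 ⬝ᵥ (pauliString n p *ᵥ φ.1)).im = 0 := fun p =>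
    (pauliString_isHermitian p).im_star_dotProduct_mulVec_self φ.1
  conv_lhs => rw [← sum_pauliCoeff_smul A]
  rw [expectation, Matrix.sum_mulVec, dotProduct_sum, Complex.re_sum]
  refine Finset.sum_congr rfl fun p _ => ?_
  rw [smul_mulVec, dotProduct_smul, smul_eq_mul, Complex.mul_re, him, mul_zero, sub_zero]
  rfl

end Pauli

namespace Problem

variable {n K : ℕ} {𝒳 : Type*} {P : Problem n K 𝒳}

lemma ClusterSum.exists_cluster_of_pauliCoeff_ne_zero {m : ℕ} {A : Op n} {w : ℝ}
    (h : P.ClusterSum m A w) {p : Fin n → Fin 4} (hp : pauliCoeff A p ≠ 0) :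
    ∃ X, P.Cluster m X ∧ ∀ q, p q ≠ 0 → q ∈ X := by
  induction h with
  | zero => simp [pauliCoeff] at hp
  | @single A w X hX hA _ =>
    refine ⟨X, hX, fun q hq => ?_⟩
    by_contra hqX
    exact hp (pauliCoeff_eq_zero hA hqX hq)
  | @add A B _ _ _ _ h1 h2 =>
    have e : pauliCoeff (A + B) p = pauliCoeff A p + pauliCoeff B p := by
      simp [pauliCoeff, mul_add, Matrix.trace_add]
    by_cases hA : pauliCoeff A p = 0
    · refine h2 fun hB => hp ?_
      rw [e, hA, hB, add_zero]
    · exact h1 hA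

end Problem

end HVClassifier
end
noncomputable section
namespace HVClassifier
open Matrix
open scoped Matrix.Norms.L2Operator

namespace Problem

variable {n K : ℕ} {𝒳 : Type*} (P : Problem n K 𝒳)

/-! ## Walks along interaction terms -/

/-- A set of qubits as a set of natural numbers. -/
def qubitSet (X : Finset (Fin n)) : Finset ℕ := X.map Fin.valEmbedding

lemma val_mem_qubitSet {X : Finset (Fin n)} {q : Fin n} : (q : ℕ) ∈ qubitSet X ↔ q ∈ X := by
  simp only [qubitSet, Finset.mem_map, Fin.valEmbedding_apply]
  exact ⟨fun ⟨a, ha, h⟩ => Fin.ext h ▸ ha, fun h => ⟨q, h, rfl⟩⟩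

lemma lt_of_mem_qubitSet {X : Finset (Fin n)} {q : ℕ} (h : q ∈ qubitSet X) : q < n := by
  simp only [qubitSet, Finset.mem_map, Fin.valEmbedding_apply] at h
  obtain ⟨a, _, rfl⟩ := h
  exact a.2

/-- The supports of the interaction terms of one Hamiltonian. -/
def termSets (k : Fin K) : List (Finset ℕ) :=
  (List.finRange (P.ham k).numTerms).map fun j => qubitSet ((P.ham k).supp j)

/-- The support of the observable, enlarged by the starting point `n` of all walks, followed by the
supports of all interaction terms. -/
def edges : List (Finset ℕ) :=
  insert n (qubitSet P.obsSupp) :: (List.finRange K).flatMap P.termSets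

/-- Two positions are linked if they lie in a common edge. -/
def Linked (q q' : ℕ) : Prop := ∃ e ∈ P.edges, q ∈ e ∧ q' ∈ e

variable {P}

lemma isChain_linked_of_mem {e : Finset ℕ} (he : e ∈ P.edges) {l : List ℕ} (hl : ∀ q ∈ l, q ∈ e) :
    l.IsChain P.Linked := by
  induction l with
  | nil => exact .nil
  | cons a l ih =>
    cases l with
    | nil => exact .singleton _
    | cons b l =>
      exact .cons_cons ⟨e, he, hl a (by simp), hl b (by simp)⟩ (ih fun q hq => hl q (by simp [hq]))

lemma termSet_mem_edges (k : Fin K) (j : Fin (P.ham k).numTerms) :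
    qubitSet ((P.ham k).supp j) ∈ P.edges := by
  simp only [edges, termSets, List.mem_cons, List.mem_flatMap, List.mem_finRange, List.mem_map,
    true_and]
  exact Or.inr ⟨k, j, rfl⟩

/-- A newly attached support e shares a qubit q with the cluster. The walk is interrupted at a visit
to q by a detour through all of e and back to q, which adds |e| + 1 ≤ Λ + 1 positions. The walk
starts at the artificial position n, which lies only in the edge of the observable. -/
lemma Cluster.exists_walk {Λ ℓ m : ℕ} {X : Finset (Fin n)} (hloc : ∀ k, (P.ham k).LocalityLE Λ)
    (hobs : P.obsSupp.card ≤ ℓ) (h : P.Cluster m X) :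
    ∃ l : List ℕ, (n :: l).IsChain P.Linked ∧ (∀ q ∈ l, q < n) ∧ (∀ q : Fin n, q ∈ X → (q : ℕ) ∈ l) ∧
      l.length ≤ ℓ + m * (Λ + 1) := by
  induction h with
  | base m =>
    refine ⟨(qubitSet P.obsSupp).toList, ?_, ?_, ?_, ?_⟩
    · refine isChain_linked_of_mem (e := insert n (qubitSet P.obsSupp)) (by simp [edges]) ?_
      simp
    · intro q hq
      exact lt_of_mem_qubitSet (Finset.mem_toList.mp hq)
    · intro q hq
      exact Finset.mem_toList.mpr (val_mem_qubitSet.mpr hq)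
    · rw [Finset.length_toList, qubitSet, Finset.card_map]
      omega
  | @attach m X k j hX hj ih =>
    obtain ⟨l, hl, hlt, hlX, hlen⟩ := ih
    obtain ⟨q, hq⟩ := hj
    rw [Finset.mem_inter] at hq
    obtain ⟨l₁, l₂, rfl⟩ := List.append_of_mem (hlX q hq.2)
    set e := qubitSet ((P.ham k).supp j) with he
    have hqe : (q : ℕ) ∈ e := val_mem_qubitSet.mpr hq.1
    refine ⟨l₁ ++ (q : ℕ) :: (e.toList ++ (q : ℕ) :: l₂), ?_, ?_, ?_, ?_⟩
    · rw [← List.cons_append, List.isChain_split] at hl ⊢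
      refine ⟨hl.1, ?_⟩
      rw [← List.cons_append, List.isChain_split]
      refine ⟨isChain_linked_of_mem (termSet_mem_edges k j) ?_, hl.2⟩
      intro q' hq'
      simp only [List.cons_append, List.mem_cons, List.mem_append, Finset.mem_toList,
        List.not_mem_nil, or_false] at hq'
      rcases hq' with rfl | h | rfl
      · exact hqe
      · exact h
      · exact hqe
    · intro q' hq'
      simp only [List.mem_append, List.mem_cons, Finset.mem_toList] at hq' hlt
      rcases hq' with h | h | h | h | h
      · exact hlt q' (Or.inl h)
      · exact hlt q' (Or.inr (Or.inl h))
      · exact lt_of_mem_qubitSet h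
      · exact hlt q' (Or.inr (Or.inl h))
      · exact hlt q' (Or.inr (Or.inr h))
    · intro q' hq'
      simp only [List.mem_append, List.mem_cons, Finset.mem_toList] at hlX ⊢
      rcases Finset.mem_union.mp hq' with h | h
      · rcases hlX q' h with h | h | h
        · exact Or.inl h
        · exact Or.inr (Or.inl h)
        · exact Or.inr (Or.inr (Or.inr (Or.inr h)))
      · exact Or.inr (Or.inr (Or.inl (val_mem_qubitSet.mpr h)))
    · have h1 : e.card ≤ Λ := by rw [he, qubitSet, Finset.card_map]; exact hloc k j
      simp only [List.length_append, List.length_cons, Finset.length_toList] at hlen ⊢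
      rw [add_mul, one_mul]
      omega

end Problem

/-! ## Approximation of the predictions by few Pauli expectation values -/

/-- The predictions of all admissible parameters are combinations, with coefficients bounded by
`2`, of expectation values of Pauli operators supported on walks of logarithmic length. -/
theorem exists_pauli_approximation (K Λ d ℓ : ℕ) (T : ℝ) :
    ∃ a b : ℕ, ∀ (n : ℕ) (𝒳 : Type*) (P : Problem n K 𝒳),
      (∀ k, (P.ham k).LocalityLE Λ) → (∀ k, (P.ham k).DegreeLE d) → P.obsSupp.card ≤ ℓ →
      ∀ (θ : Fin K → ℝ), (∀ k, |θ k| ≤ T) → ∀ w : ℕ, ∃ c : (Fin n → Fin 4) → ℝ,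
        (∀ p, |c p| ≤ 2) ∧
        (∀ p, c p ≠ 0 → ∃ l : List ℕ, (n :: l).IsChain P.Linked ∧ (∀ q ∈ l, q < n) ∧
          (∀ q : Fin n, p q ≠ 0 → (q : ℕ) ∈ l) ∧ l.length ≤ a * w + b) ∧
        ∀ i, |P.prediction θ i - ∑ p, c p * expectation (pauliString n (codes p)) (P.state i)| ≤
          (1 / 2) ^ w / 12 := by
  -- Short steps of length T/r satisfy the smallness condition of the commutator series; the added 1
  -- makes r positive.
  set r : ℕ := ⌈8 * T * ((ℓ + Λ) * (d + 1))⌉₊ + 1 with hr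
  -- Extra halvings that absorb both the number K r of steps and the constant 12, by k ≤ 2^k.
  set q₀ : ℕ := 12 * (K * r) with hq₀
  refine ⟨4 ^ (K * r) * (Λ + 1), ℓ + 4 ^ (K * r) * (q₀ + 1) * (Λ + 1), ?_⟩
  intro n 𝒳 P hloc hdeg hobs θ hθ w
  have hrT : 8 * T * ((ℓ + Λ) * (d + 1)) ≤ r := by
    have := Nat.le_ceil (8 * T * ((ℓ + Λ : ℝ) * (d + 1)))
    rw [hr]; push_cast; linarith
  obtain ⟨B, v, hB, herr⟩ := Problem.exists_clusterSum_conj_ansatz hloc hdeg hobs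
    (r := r) (by omega) hrT (w + q₀) θ hθ
  have herr' : ((K * r : ℕ) : ℝ) * (1 / 2) ^ (w + q₀) ≤ (1 / 2) ^ w / 12 := by
    have h1 : (12 * (K * r : ℕ) : ℝ) ≤ 2 ^ q₀ := by
      exact_mod_cast (Nat.lt_two_pow_self (n := q₀)).le
    have h2 : (1 / 2 : ℝ) ^ q₀ * 2 ^ q₀ = 1 := by rw [← mul_pow]; norm_num
    have h3 : (0 : ℝ) < (1 / 2) ^ q₀ := by positivity
    have h4 : ((K * r : ℕ) : ℝ) * (1 / 2) ^ q₀ ≤ 1 / 12 := by nlinarith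
    have h5 : (0 : ℝ) < (1 / 2) ^ w := by positivity
    rw [pow_add]
    nlinarith
  have herr'' := herr.trans herr'
  -- The evolved observable has norm at most 1 and the approximation error is below 1.
  have hnorm : ‖B‖ ≤ 2 := by
    have h1 := Problem.norm_conj_ansatz_obs_le (P := P) θ
    have h2 : (1 / 2 : ℝ) ^ w ≤ 1 := pow_le_one₀ (by norm_num) (by norm_num)
    have h3 := norm_sub_norm_le B ((ansatz P.ham θ)ᴴ * P.obs * ansatz P.ham θ)
    rw [norm_sub_rev] at h3
    linarith
  refine ⟨fun p => (pauliCoeff B p).re, fun p => ?_, fun p hp => ?_, fun i => ?_⟩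
  · exact (Complex.abs_re_le_norm _).trans ((norm_pauliCoeff_le B p).trans hnorm)
  · have hp' : pauliCoeff B p ≠ 0 := fun h => hp (by simp [h])
    obtain ⟨X, hX, hpX⟩ := hB.exists_cluster_of_pauliCoeff_ne_zero hp'
    obtain ⟨l, h1, h2, h3, h4⟩ := hX.exists_walk hloc hobs
    exact ⟨l, h1, h2, fun q hq => h3 q (hpX q hq), h4.trans (le_of_eq (by ring))⟩
  · rw [← expectation_eq_sum_pauliCoeff, Problem.prediction, ← expectation_sub]
    exact (abs_expectation_le _ _).trans herr''

end HVClassifier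
end
noncomputable section
namespace HVClassifier

/-! ## Least absolute deviations by subgradient descent -/

section Regression

variable (N M : ℕ) (z : ℕ → ℕ → ℝ) (y : ℕ → ℝ) (s : ℝ)

/-- The deviation of the linear model `α` from the label of the data point `i`. -/
def residual (α : ℕ → ℝ) (i : ℕ) : ℝ := ∑ j ∈ Finset.range M, α j * z i j - y i

/-- The sum of the absolute deviations. -/
def absDev (α : ℕ → ℝ) : ℝ := ∑ i ∈ Finset.range N, |residual M z y α i|

/-- A subgradient of the sum of the absolute deviations. -/
def subgrad (α : ℕ → ℝ) (j : ℕ) : ℝ :=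
  ∑ i ∈ Finset.range N, if 0 ≤ residual M z y α i then z i j else -z i j

/-- The iterates of subgradient descent with step size `s`. -/
def descent : ℕ → ℕ → ℝ
  | 0 => fun _ => 0
  | t + 1 => fun j => descent t j - s * subgrad N M z y (descent t) j

/-- The average of the first `R` iterates. -/
def descentAverage (R : ℕ) (j : ℕ) : ℝ := (∑ t ∈ Finset.range R, descent N M z y s t j) / R

variable {N M z y s}

/-- The subgradient inequality, checked for each data point according to the sign of the residual.
-/
lemma absDev_sub_le (α β : ℕ → ℝ) :
    absDev N M z y α - absDev N M z y β ≤
      ∑ j ∈ Finset.range M, subgrad N M z y α j * (α j - β j) := by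
  simp only [absDev, subgrad, Finset.sum_mul]
  rw [Finset.sum_comm, ← Finset.sum_sub_distrib]
  refine Finset.sum_le_sum fun i _ => ?_
  have e : residual M z y α i - residual M z y β i =
      ∑ j ∈ Finset.range M, z i j * (α j - β j) := by
    simp only [residual]
    rw [sub_sub_sub_cancel_right, ← Finset.sum_sub_distrib]
    exact Finset.sum_congr rfl fun j _ => by ring
  split_ifs with h
  · rw [← e, abs_of_nonneg h]
    linarith [le_abs_self (residual M z y β i)]
  · have e' : ∑ j ∈ Finset.range M, -z i j * (α j - β j) =
        -(residual M z y α i - residual M z y β i) := by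
      rw [e, ← Finset.sum_neg_distrib]
      exact Finset.sum_congr rfl fun j _ => by ring
    rw [e', abs_of_neg (not_le.mp h)]
    linarith [neg_abs_le (residual M z y β i)]

lemma abs_subgrad_le (hz : ∀ i < N, ∀ j < M, |z i j| ≤ 1) (α : ℕ → ℝ) {j : ℕ} (hj : j < M) :
    |subgrad N M z y α j| ≤ N := by
  refine (Finset.abs_sum_le_sum_abs _ _).trans ?_
  calc _ ≤ ∑ _i ∈ Finset.range N, (1 : ℝ) := by
        refine Finset.sum_le_sum fun i hi => ?_
        have := hz i (Finset.mem_range.mp hi) j hj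
        split_ifs
        · exact this
        · rwa [abs_neg]
    _ = N := by simp

/-- Descent is not projected, so this growth bound is the only control on the fitted coefficients.
It later limits how much measurement noise they can amplify. -/
lemma abs_descent_le (hz : ∀ i < N, ∀ j < M, |z i j| ≤ 1) (hs : 0 ≤ s) (t : ℕ) {j : ℕ}
    (hj : j < M) : |descent N M z y s t j| ≤ s * N * t := by
  induction t with
  | zero => simp [descent]
  | succ t ih =>
    have h1 := abs_subgrad_le (y := y) hz (descent N M z y s t) hj
    have h2 : |s * subgrad N M z y (descent N M z y s t) j| ≤ s * N := by
      rw [abs_mul, abs_of_nonneg hs]; gcongr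
    calc |descent N M z y s (t + 1) j| ≤ |descent N M z y s t j| +
          |s * subgrad N M z y (descent N M z y s t) j| := abs_sub _ _
      _ ≤ s * N * t + s * N := add_le_add ih h2
      _ = s * N * (t + 1 : ℕ) := by push_cast; ring

lemma abs_descentAverage_le (hz : ∀ i < N, ∀ j < M, |z i j| ≤ 1) (hs : 0 ≤ s) {R : ℕ} (hR : 0 < R)
    {j : ℕ} (hj : j < M) : |descentAverage N M z y s R j| ≤ s * N * R := by
  have hR' : (0 : ℝ) < R := by exact_mod_cast hR
  rw [descentAverage, abs_div, abs_of_pos hR', div_le_iff₀ hR']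
  refine (Finset.abs_sum_le_sum_abs _ _).trans ?_
  calc _ ≤ ∑ _t ∈ Finset.range R, s * N * R := by
        refine Finset.sum_le_sum fun t ht => (abs_descent_le hz hs t hj).trans ?_
        have : (t : ℝ) ≤ R := by exact_mod_cast (Finset.mem_range.mp ht).le
        gcongr
    _ = _ := by rw [Finset.sum_const, Finset.card_range, nsmul_eq_mul]; ring

/-- The squared distance to β serves as a potential. Expanding the square of one step, the cross
term dominates the excess deviation and the quadratic term is at most s²MN²; the steps telescope
from the zero start. -/
lemma sum_absDev_descent_le (hz : ∀ i < N, ∀ j < M, |z i j| ≤ 1) (hs : 0 ≤ s) (β : ℕ → ℝ) (R : ℕ) :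
    2 * s * ∑ t ∈ Finset.range R, (absDev N M z y (descent N M z y s t) - absDev N M z y β) +
        ∑ j ∈ Finset.range M, (descent N M z y s R j - β j) ^ 2 ≤
      ∑ j ∈ Finset.range M, β j ^ 2 + R * (s ^ 2 * (M * N ^ 2)) := by
  induction R with
  | zero => simp [descent]
  | succ R ih =>
    set α := descent N M z y s R with hα
    have h1 := absDev_sub_le (N := N) (M := M) (z := z) (y := y) α β
    have h2 : ∑ j ∈ Finset.range M, (descent N M z y s (R + 1) j - β j) ^ 2 =
        ∑ j ∈ Finset.range M, (α j - β j) ^ 2 -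
          2 * s * ∑ j ∈ Finset.range M, subgrad N M z y α j * (α j - β j) +
          s ^ 2 * ∑ j ∈ Finset.range M, subgrad N M z y α j ^ 2 := by
      rw [Finset.mul_sum, Finset.mul_sum, ← Finset.sum_sub_distrib, ← Finset.sum_add_distrib]
      refine Finset.sum_congr rfl fun j _ => ?_
      simp only [descent, ← hα]
      ring
    have h3 : ∑ j ∈ Finset.range M, subgrad N M z y α j ^ 2 ≤ M * N ^ 2 := by
      calc _ ≤ ∑ _j ∈ Finset.range M, (N : ℝ) ^ 2 := by
            refine Finset.sum_le_sum fun j hj => ?_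
            rw [← sq_abs]
            have := abs_subgrad_le (y := y) hz α (Finset.mem_range.mp hj)
            gcongr
        _ = _ := by simp
    have h4 : s ^ 2 * ∑ j ∈ Finset.range M, subgrad N M z y α j ^ 2 ≤ s ^ 2 * (M * N ^ 2) := by
      gcongr
    have h5 : 2 * s * (absDev N M z y α - absDev N M z y β) ≤
        2 * s * ∑ j ∈ Finset.range M, subgrad N M z y α j * (α j - β j) := by gcongr
    rw [Finset.sum_range_succ, mul_add, h2]
    push_cast
    linarith

/-- Convexity: residuals are affine in the coefficients, so the residual of the average is the
average of the residuals. -/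
lemma absDev_descentAverage_le {R : ℕ} (hR : 0 < R) :
    absDev N M z y (descentAverage N M z y s R) ≤
      (∑ t ∈ Finset.range R, absDev N M z y (descent N M z y s t)) / R := by
  have hR' : (0 : ℝ) < R := by exact_mod_cast hR
  simp only [absDev]
  rw [Finset.sum_comm, Finset.sum_div]
  refine Finset.sum_le_sum fun i _ => ?_
  have e : residual M z y (descentAverage N M z y s R) i =
      (∑ t ∈ Finset.range R, residual M z y (descent N M z y s t) i) / R := by
    simp only [residual, descentAverage, Finset.sum_sub_distrib, Finset.sum_const,
      Finset.card_range, nsmul_eq_mul]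
    rw [sub_div, mul_div_cancel_left₀ _ hR'.ne', Finset.sum_comm, Finset.sum_div]
    congr 1
    refine Finset.sum_congr rfl fun j _ => ?_
    rw [← Finset.sum_mul]
    ring
  rw [e, abs_div, abs_of_pos hR']
  gcongr
  exact Finset.abs_sum_le_sum_abs _ _

/-- Subgradient descent with step size `κ / (M N)` reaches accuracy `κ` per data point. -/
lemma absDev_descentAverage_le_add (hz : ∀ i < N, ∀ j < M, |z i j| ≤ 1) (hN : 0 < N) (hM : 0 < M)
    {κ : ℝ} (hκ : 0 < κ) {R : ℕ} (hR : 4 * M ^ 2 / κ ^ 2 ≤ R) {β : ℕ → ℝ}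
    (hβ : ∀ j < M, |β j| ≤ 2) (hs : s = κ / M / N) :
    absDev N M z y (descentAverage N M z y s R) ≤ absDev N M z y β + κ * N := by
  have hN' : (0 : ℝ) < N := by exact_mod_cast hN
  have hM' : (0 : ℝ) < M := by exact_mod_cast hM
  have hR0 : (0 : ℝ) < R := lt_of_lt_of_le (by positivity) hR
  have hR1 : 0 < R := by exact_mod_cast hR0
  have hs0 : 0 < s := by rw [hs]; positivity
  refine (absDev_descentAverage_le hR1).trans ?_
  rw [div_le_iff₀ hR0]
  have h1 := sum_absDev_descent_le (N := N) (y := y) hz hs0.le β R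
  have h2 : 0 ≤ ∑ j ∈ Finset.range M, (descent N M z y s R j - β j) ^ 2 :=
    Finset.sum_nonneg fun _ _ => sq_nonneg _
  have h3 : ∑ j ∈ Finset.range M, β j ^ 2 ≤ 4 * M := by
    calc _ ≤ ∑ _j ∈ Finset.range M, (4 : ℝ) := by
          refine Finset.sum_le_sum fun j hj => ?_
          have := hβ j (Finset.mem_range.mp hj)
          rw [← sq_abs]
          nlinarith [abs_nonneg (β j)]
      _ = _ := by simp [mul_comm]
  rw [Finset.sum_sub_distrib, Finset.sum_const, Finset.card_range, nsmul_eq_mul] at h1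
  set A := ∑ t ∈ Finset.range R, absDev N M z y (descent N M z y s t)
  set Bv := absDev N M z y β
  have h4 : 2 * s * (A - R * Bv) ≤ 4 * M + R * (s ^ 2 * (M * N ^ 2)) := by linarith
  have hsM : s * (M * N) = κ := by rw [hs]; field_simp
  -- Initial distance and accumulated squared steps each contribute at most s κ N R, the first by
  -- the choice of R and the second by the choice of s. Dividing by 2s leaves κ N per iterate.
  have h5 : 4 * (M : ℝ) ≤ s * (κ * N * R) := by
    rw [div_le_iff₀ (by positivity)] at hR
    have : s * (κ * N * R) * M = κ ^ 2 * R := by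
      calc _ = (s * (M * N)) * κ * R := by ring
        _ = _ := by rw [hsM]; ring
    nlinarith
  have h6 : R * (s ^ 2 * (M * N ^ 2)) = s * (κ * N * R) := by
    calc _ = (s * (M * N)) * s * N * R := by ring
      _ = _ := by rw [hsM]; ring
  have h7 : s * (A - R * Bv) ≤ s * (κ * N * R) := by linarith
  have := le_of_mul_le_mul_left h7 hs0
  linarith

/-- The error of the model that is found from estimates `z` of the features `μ`. -/
lemma sum_abs_model_sub_le {μ : ℕ → ℕ → ℝ} (hz : ∀ i < N, ∀ j < M, |z i j| ≤ 1) (hN : 0 < N)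
    (hM : 0 < M) {κ : ℝ} (hκ : 0 < κ) {R : ℕ} (hR : 4 * M ^ 2 / κ ^ 2 ≤ R) {β : ℕ → ℝ}
    (hβ : ∀ j < M, |β j| ≤ 2) (hs : s = κ / M / N) {f : ℕ → ℝ}
    (hf : ∀ i < N, |f i - ∑ j ∈ Finset.range M, β j * μ i j| ≤ κ)
    (hnoise : (2 + κ / M * R) ^ 2 * M *
      ((∑ i ∈ Finset.range N, ∑ j ∈ Finset.range M, (z i j - μ i j) ^ 2) / N) ≤ κ ^ 2) :
    (∑ i ∈ Finset.range N, |∑ j ∈ Finset.range M, descentAverage N M z y s R j * μ i j - f i|) / N ≤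
      2 * ((∑ i ∈ Finset.range N, |f i - y i|) / N) + 3 * κ := by
  have hN' : (0 : ℝ) < N := by exact_mod_cast hN
  have hM' : (0 : ℝ) < M := by exact_mod_cast hM
  have hR0 : (0 : ℝ) < R := lt_of_lt_of_le (by positivity) hR
  have hR1 : 0 < R := by exact_mod_cast hR0
  have hs0 : 0 < s := by rw [hs]; positivity
  set α := descentAverage N M z y s R with hα
  set E := ∑ i ∈ Finset.range N, ∑ j ∈ Finset.range M, |z i j - μ i j| with hE
  have hsN : s * N * R = κ / M * R := by rw [hs]; field_simp
  have hαb : ∀ j < M, |α j| ≤ κ / M * R := fun j hj => by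
    rw [← hsN]; exact abs_descentAverage_le hz hs0.le hR1 hj
  -- Replacing measured by true features costs at most the coefficient bound times the total
  -- absolute error E. This is applied to β with bound 2 and to the fitted α with bound κR/M.
  have hdiff : ∀ (γ : ℕ → ℝ) (c : ℝ), (∀ j < M, |γ j| ≤ c) →
      ∑ i ∈ Finset.range N, |∑ j ∈ Finset.range M, γ j * z i j - ∑ j ∈ Finset.range M, γ j * μ i j| ≤
        c * E := by
    intro γ c hγ
    rw [hE, Finset.mul_sum]
    refine Finset.sum_le_sum fun i _ => ?_
    rw [← Finset.sum_sub_distrib, Finset.mul_sum]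
    refine (Finset.abs_sum_le_sum_abs _ _).trans (Finset.sum_le_sum fun j hj => ?_)
    rw [← mul_sub, abs_mul]
    exact mul_le_mul_of_nonneg_right (hγ j (Finset.mem_range.mp hj)) (abs_nonneg _)
  have hopt := absDev_descentAverage_le_add (y := y) hz hN hM hκ hR hβ hs
  have hβE := hdiff β 2 hβ
  have hαE := hdiff α _ hαb
  have hβdev : absDev N M z y β ≤ ∑ i ∈ Finset.range N, |f i - y i| + κ * N + 2 * E := by
    have : absDev N M z y β ≤ ∑ i ∈ Finset.range N, (|f i - y i| + κ +
        |∑ j ∈ Finset.range M, β j * z i j - ∑ j ∈ Finset.range M, β j * μ i j|) := by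
      refine Finset.sum_le_sum fun i hi => ?_
      have h1 := hf i (Finset.mem_range.mp hi)
      rw [abs_sub_comm] at h1
      have h2 : residual M z y β i = (f i - y i) + (∑ j ∈ Finset.range M, β j * μ i j - f i) +
          (∑ j ∈ Finset.range M, β j * z i j - ∑ j ∈ Finset.range M, β j * μ i j) := by
        simp only [residual]; ring
      rw [h2]
      refine (abs_add_three _ _ _).trans ?_
      gcongr
    refine this.trans ?_
    rw [Finset.sum_add_distrib, Finset.sum_add_distrib, Finset.sum_const, Finset.card_range,
      nsmul_eq_mul]
    linarith
  have hmain : ∑ i ∈ Finset.range N, |∑ j ∈ Finset.range M, α j * μ i j - f i| ≤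
      ∑ i ∈ Finset.range N, |f i - y i| + absDev N M z y α + κ / M * R * E := by
    refine le_trans ?_ (add_le_add_right hαE _)
    simp only [absDev]
    rw [← Finset.sum_add_distrib, ← Finset.sum_add_distrib]
    refine Finset.sum_le_sum fun i _ => ?_
    have h2 : ∑ j ∈ Finset.range M, α j * μ i j - f i = -(f i - y i) + residual M z y α i +
        -(∑ j ∈ Finset.range M, α j * z i j - ∑ j ∈ Finset.range M, α j * μ i j) := by
      simp only [residual]; ring
    rw [h2]
    refine (abs_add_three _ _ _).trans ?_
    rw [abs_neg, abs_neg]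
  -- Cauchy–Schwarz over the N M entries, since the noise is controlled through the squared error.
  have hEκ : (2 + κ / M * R) * E ≤ κ * N := by
    have h1 : E ^ 2 ≤ N * M * ∑ i ∈ Finset.range N, ∑ j ∈ Finset.range M, (z i j - μ i j) ^ 2 := by
      rw [hE, ← Finset.sum_product', ← Finset.sum_product']
      have := sq_sum_le_card_mul_sum_sq (s := Finset.range N ×ˢ Finset.range M)
        (f := fun p : ℕ × ℕ => |z p.1 p.2 - μ p.1 p.2|)
      simpa [sq_abs] using this
    have h2 : 0 ≤ 2 + κ / M * R := by positivity
    have h3 : 0 ≤ E := Finset.sum_nonneg fun _ _ => Finset.sum_nonneg fun _ _ => abs_nonneg _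
    refine abs_le_of_sq_le_sq' ?_ (by positivity) |>.2
    rw [← mul_div_assoc, div_le_iff₀ hN'] at hnoise
    calc ((2 + κ / M * R) * E) ^ 2 = (2 + κ / M * R) ^ 2 * E ^ 2 := by ring
      _ ≤ (2 + κ / M * R) ^ 2 * (N * M *
          ∑ i ∈ Finset.range N, ∑ j ∈ Finset.range M, (z i j - μ i j) ^ 2) := by gcongr
      _ = ((2 + κ / M * R) ^ 2 * M *
          ∑ i ∈ Finset.range N, ∑ j ∈ Finset.range M, (z i j - μ i j) ^ 2) * N := by ring
      _ ≤ κ ^ 2 * N * N := by gcongr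
      _ = (κ * N) ^ 2 := by ring
  rw [div_le_iff₀ hN']
  have e : (2 * ((∑ i ∈ Finset.range N, |f i - y i|) / N) + 3 * κ) * N =
      2 * (∑ i ∈ Finset.range N, |f i - y i|) + 3 * (κ * N) := by field_simp
  rw [e]
  -- The budget is κN for approximating f by β, κN for the optimization and κN for the noise in both
  -- coefficient vectors. The deviations of f from the labels enter once in the comparison with y
  -- and once in the competitor β.
  linarith

end Regression

end HVClassifier
end
noncomputable section
namespace HVClassifier

/-! ## Big-step semantics of programs without measurements -/

/-- Execution of a program without measurements from one memory to another, with the number of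
steps. -/
inductive BigStep : Program → Memory → ℕ → Memory → Prop
  | skip (m) : BigStep .skip m 1 m
  | setNat (a row col e) (m : Memory) : BigStep (.setNat a row col e) m 1
      ⟨store m.nat a (row.eval m) (col.eval m) (e.eval m), m.real⟩
  | setReal (a row col e) (m : Memory) : BigStep (.setReal a row col e) m 1
      ⟨m.nat, store m.real a (row.eval m) (col.eval m) (e.eval m)⟩
  | seq {p q m₀ m₁ m₂ s t} : BigStep p m₀ s m₁ → BigStep q m₁ t m₂ →
      BigStep (.seq p q) m₀ (s + t + 1) m₂
  | iteTrue {b p q m m' t} : b.Holds m → BigStep p m t m' → BigStep (.ite b p q) m (t + 1) m'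
  | iteFalse {b p q m m' t} : ¬ b.Holds m → BigStep q m t m' → BigStep (.ite b p q) m (t + 1) m'
  | loopFalse {b p m} : ¬ b.Holds m → BigStep (.loop b p) m 1 m
  | loopTrue {b p m₀ m₁ m₂ s t} : b.Holds m₀ → BigStep p m₀ s m₁ → BigStep (.loop b p) m₁ t m₂ →
      BigStep (.loop b p) m₀ (s + t + 1) m₂

/-- The natural array `a` occurs as a target in the program. -/
def Program.WritesNat (a : ℕ) : Program → Prop
  | .setNat a' _ _ _ => a = a'
  | .seq p q => p.WritesNat a ∨ q.WritesNat a
  | .ite _ p q => p.WritesNat a ∨ q.WritesNat a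
  | .loop _ p => p.WritesNat a
  | _ => False

/-- The real array `a` occurs as a target in the program. -/
def Program.WritesReal (a : ℕ) : Program → Prop
  | .setReal a' _ _ _ => a = a'
  | .seq p q => p.WritesReal a ∨ q.WritesReal a
  | .ite _ p q => p.WritesReal a ∨ q.WritesReal a
  | .loop _ p => p.WritesReal a
  | .measure _ _ _ a' _ _ => a = a'
  | _ => False

lemma store_of_ne {α : Type} (m : ℕ → ℕ → ℕ → α) {a a' : ℕ} (r c : ℕ) (v : α) (h : a' ≠ a) :
    store m a r c v a' = m a' := by
  funext r' c'
  simp [store, h]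

lemma store_self {α : Type} (m : ℕ → ℕ → ℕ → α) (a r c : ℕ) (v : α) :
    store m a r c v a = fun r' c' => if r' = r ∧ c' = c then v else m a r' c' := by
  funext r' c'
  simp [store]

lemma BigStep.nat_eq {p : Program} {m m' : Memory} {t : ℕ} (h : BigStep p m t m') {a : ℕ}
    (ha : ¬ p.WritesNat a) : m'.nat a = m.nat a := by
  induction h with
  | skip => rfl
  | setNat => exact store_of_ne _ _ _ _ ha
  | setReal => rfl
  | seq _ _ h1 h2 => rw [h2 fun h => ha (Or.inr h), h1 fun h => ha (Or.inl h)]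
  | iteTrue _ _ h1 => exact h1 fun h => ha (Or.inl h)
  | iteFalse _ _ h1 => exact h1 fun h => ha (Or.inr h)
  | loopFalse => rfl
  | loopTrue _ _ _ h1 h2 => rw [h2 ha, h1 ha]

lemma BigStep.real_eq {p : Program} {m m' : Memory} {t : ℕ} (h : BigStep p m t m') {a : ℕ}
    (ha : ¬ p.WritesReal a) : m'.real a = m.real a := by
  induction h with
  | skip => rfl
  | setNat => rfl
  | setReal => exact store_of_ne _ _ _ _ ha
  | seq _ _ h1 h2 => rw [h2 fun h => ha (Or.inr h), h1 fun h => ha (Or.inl h)]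
  | iteTrue _ _ h1 => exact h1 fun h => ha (Or.inl h)
  | iteFalse _ _ h1 => exact h1 fun h => ha (Or.inr h)
  | loopFalse => rfl
  | loopTrue _ _ _ h1 h2 => rw [h2 ha, h1 ha]

/-- `m'` agrees with `m` on all arrays that are not targets of `p`. -/
structure Framed (p : Program) (m m' : Memory) : Prop where
  nat : ∀ a, ¬ p.WritesNat a → m'.nat a = m.nat a
  real : ∀ a, ¬ p.WritesReal a → m'.real a = m.real a

lemma Framed.trans {p : Program} {m m' m'' : Memory} (h : Framed p m m') (h' : Framed p m' m'') :
    Framed p m m'' :=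
  ⟨fun a ha => (h'.nat a ha).trans (h.nat a ha), fun a ha => (h'.real a ha).trans (h.real a ha)⟩

/-- The program ends after at most `T` steps, without measurements, in a memory with property
`Q`. -/
def Terminates (p : Program) (T : ℕ) (m : Memory) (Q : Memory → Prop) : Prop :=
  ∃ t ≤ T, ∃ m', BigStep p m t m' ∧ Q m'

namespace Terminates

variable {p q : Program} {T T' : ℕ} {m : Memory} {Q Q' : Memory → Prop}

lemma mono (h : Terminates p T m Q) (hT : T ≤ T') (hQ : ∀ m', Q m' → Q' m') :
    Terminates p T' m Q' := by
  obtain ⟨t, ht, m', hb, hm'⟩ := h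
  exact ⟨t, ht.trans hT, m', hb, hQ m' hm'⟩

lemma imp (h : Terminates p T m Q) (hQ : ∀ m', Q m' → Q' m') : Terminates p T m Q' :=
  h.mono le_rfl hQ

lemma frame (h : Terminates p T m Q) : Terminates p T m fun m' => Q m' ∧ Framed p m m' := by
  obtain ⟨t, ht, m', hb, hm'⟩ := h
  exact ⟨t, ht, m', hb, hm', fun _ => hb.nat_eq, fun _ => hb.real_eq⟩

lemma skip (h : Q m) : Terminates .skip 1 m Q := ⟨1, le_rfl, m, .skip m, h⟩

lemma setNat {a : ℕ} {row col e : NatExpr}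
    (h : Q ⟨store m.nat a (row.eval m) (col.eval m) (e.eval m), m.real⟩) :
    Terminates (.setNat a row col e) 1 m Q := ⟨1, le_rfl, _, .setNat .., h⟩

lemma setReal {a : ℕ} {row col : NatExpr} {e : RealExpr}
    (h : Q ⟨m.nat, store m.real a (row.eval m) (col.eval m) (e.eval m)⟩) :
    Terminates (.setReal a row col e) 1 m Q := ⟨1, le_rfl, _, .setReal .., h⟩

lemma seq (h : Terminates p T m fun m' => Terminates q T' m' Q) :
    Terminates (.seq p q) (T + T' + 1) m Q := by
  obtain ⟨s, hs, m₁, h1, t, ht, m₂, h2, h3⟩ := h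
  exact ⟨s + t + 1, by omega, m₂, .seq h1 h2, h3⟩

lemma seq_of_le {S : ℕ} (h : Terminates p T m fun m' => Terminates q T' m' Q)
    (hS : T + T' + 1 ≤ S) : Terminates (.seq p q) S m Q := h.seq.mono hS fun _ h => h

lemma ite {b : Test} (h1 : b.Holds m → Terminates p T m Q)
    (h2 : ¬ b.Holds m → Terminates q T m Q) : Terminates (.ite b p q) (T + 1) m Q := by
  by_cases hb : b.Holds m
  · obtain ⟨t, ht, m', h, hQ⟩ := h1 hb
    exact ⟨t + 1, by omega, m', .iteTrue hb h, hQ⟩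
  · obtain ⟨t, ht, m', h, hQ⟩ := h2 hb
    exact ⟨t + 1, by omega, m', .iteFalse hb h, hQ⟩

/-- A loop whose invariant has a counter that ends at most at `N`. -/
lemma loop {b : Test} (I : ℕ → Memory → Prop) (N : ℕ) {i : ℕ} (h0 : I i m) (hi : i ≤ N)
    (hstep : ∀ j m', i ≤ j → I j m' → b.Holds m' →
      j < N ∧ Terminates p T m' fun m'' => I (j + 1) m'')
    (hend : ∀ j m', j ≤ N → I j m' → ¬ b.Holds m' → Q m') :
    Terminates (.loop b p) ((N - i) * (T + 1) + 1) m Q := by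
  obtain ⟨r, hr⟩ : ∃ r, N - i = r := ⟨_, rfl⟩
  induction r generalizing i m with
  | zero =>
    by_cases hb : b.Holds m
    · have := (hstep i m le_rfl h0 hb).1; omega
    · exact ⟨1, by omega, m, .loopFalse hb, hend i m hi h0 hb⟩
  | succ r ih =>
    by_cases hb : b.Holds m
    · obtain ⟨hiN, t, ht, m₁, h1, hI⟩ := hstep i m le_rfl h0 hb
      obtain ⟨t', ht', m₂, h2, hQ⟩ := ih hI (by omega)
        (fun j m' hj => hstep j m' (by omega)) (by omega)
      refine ⟨t + t' + 1, ?_, m₂, .loopTrue hb h1 h2, hQ⟩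
      have e : N - (i + 1) = r := by omega
      rw [hr, add_mul]
      rw [e] at ht'
      omega
    · exact ⟨1, by omega, m, .loopFalse hb, hend i m hi h0 hb⟩

end Terminates

/-! ## Variables and bounded loops -/

/-- The variable that is stored in the entry `(0, 0)` of a natural array. -/
def natVar (a : ℕ) : NatExpr := .cell a (.lit 0) (.lit 0)

/-- The variable that is stored in the entry `(0, 0)` of a real array. -/
def realVar (a : ℕ) : RealExpr := .cell a (.lit 0) (.lit 0)

/-- Assignment to a natural variable. -/
def Program.assign (a : ℕ) (e : NatExpr) : Program := .setNat a (.lit 0) (.lit 0) e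

/-- Assignment to a real variable. -/
def Program.assignReal (a : ℕ) (e : RealExpr) : Program := .setReal a (.lit 0) (.lit 0) e

/-- Repeat the body for `v = 0, 1, …` below a bound. -/
def Program.forTo (v : ℕ) (bound : NatExpr) (body : Program) : Program :=
  .seq (Program.assign v (.lit 0)) (.loop (.natLE (.add (natVar v) (.lit 1)) bound)
    (.seq body (Program.assign v (.add (natVar v) (.lit 1)))))

/-- The memory with a changed natural variable. -/
def Memory.withVar (m : Memory) (v x : ℕ) : Memory := ⟨store m.nat v 0 0 x, m.real⟩

lemma Memory.withVar_nat_of_ne (m : Memory) {v a : ℕ} (x : ℕ) (h : a ≠ v) :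
    (m.withVar v x).nat a = m.nat a := store_of_ne _ _ _ _ h

lemma Memory.withVar_nat_self (m : Memory) (v x : ℕ) : (m.withVar v x).nat v 0 0 = x := by
  simp [Memory.withVar, store]

lemma Memory.withVar_real (m : Memory) (v x : ℕ) : (m.withVar v x).real = m.real := rfl

lemma Terminates.assign {Q : Memory → Prop} {m : Memory} {a : ℕ} {e : NatExpr}
    (h : Q (m.withVar a (e.eval m))) : Terminates (Program.assign a e) 1 m Q := .setNat h

/-- The invariant must ignore the counter because it has to survive its reset and its increments;
the counter value is supplied separately to the body. Each round costs three extra steps: the test,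
the sequencing and the increment. -/
lemma Terminates.forTo {v : ℕ} {bound : NatExpr} {body : Program} {T N : ℕ} {m : Memory}
    {Q : Memory → Prop} (I : ℕ → Memory → Prop) (hv : ¬ body.WritesNat v)
    (hI : ∀ i x m', I i m' → I i (m'.withVar v x))
    (hbound : ∀ i m', Framed (Program.forTo v bound body) m m' → I i m' → bound.eval m' = N)
    (h0 : I 0 m)
    (hbody : ∀ i m', i < N → m'.nat v 0 0 = i → Framed (Program.forTo v bound body) m m' → I i m' →
      Terminates body T m' (I (i + 1)))
    (hQ : ∀ m', Framed (Program.forTo v bound body) m m' → I N m' → Q m') :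
    Terminates (Program.forTo v bound body) (N * (T + 3) + 3) m Q := by
  have hfr : ∀ m x, Framed (Program.forTo v bound body) m (m.withVar v x) := fun m x =>
    ⟨fun a ha => m.withVar_nat_of_ne x fun h => ha (Or.inl h), fun _ _ => rfl⟩
  have hfr' : ∀ m' m'', Framed body m' m'' → Framed (Program.forTo v bound body) m' m'' := fun m' m'' h =>
    ⟨fun a ha => h.nat a fun hw => ha (Or.inr (Or.inl hw)),
      fun a ha => h.real a fun hw => ha (Or.inr (Or.inl hw))⟩
  have key := Terminates.loop (p := .seq body (Program.assign v (.add (natVar v) (.lit 1))))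
    (b := .natLE (.add (natVar v) (.lit 1)) bound) (T := T + 1 + 1) (m := m.withVar v 0) (Q := Q)
    (fun i m' => I i m' ∧ m'.nat v 0 0 = i ∧ i ≤ N ∧ Framed (Program.forTo v bound body) m m')
    N (i := 0) ⟨hI _ _ _ h0, m.withVar_nat_self v 0, Nat.zero_le N, hfr m 0⟩ (Nat.zero_le N) ?_ ?_
  · refine (Terminates.seq (T := 1) (.assign (Q := fun m' => Terminates _ _ m' Q) key)).mono
      ?_ fun _ h => h
    rw [Nat.sub_zero]
    ring_nf
    omega
  · rintro i m' _ ⟨h1, h2, h3, h4⟩ hb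
    have hb' : m'.nat v 0 0 + 1 ≤ bound.eval m' := hb
    rw [hbound i m' h4 h1, h2] at hb'
    refine ⟨hb', .seq ((hbody i m' hb' h2 h4 h1).frame.imp ?_)⟩
    rintro m'' ⟨h5, h6⟩
    have h7 : m''.nat v 0 0 = i := by rw [h6.nat v hv, h2]
    refine .assign ?_
    have e : (NatExpr.add (natVar v) (.lit 1)).eval m'' = i + 1 := by
      show m''.nat v 0 0 + 1 = i + 1
      rw [h7]
    rw [e]
    exact ⟨hI _ _ _ h5, Memory.withVar_nat_self _ _ _, hb',
      h4.trans ((hfr' _ _ h6).trans (hfr _ _))⟩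
  · rintro i m' _ ⟨h1, h2, h3, h4⟩ hb
    have hb' : ¬ m'.nat v 0 0 + 1 ≤ bound.eval m' := hb
    rw [hbound i m' h4 h1, h2] at hb'
    have : i = N := by omega
    subst this
    exact hQ m' h4 h1

/-! ## Expected costs at bounded stopping times -/

section Cost

variable {n N : ℕ} (Φ : Fin N → PureState n)

/-- The expectation of a function with values in `[0, ∞]`. -/
def expect {α : Type*} (μ : PMF α) (f : α → ENNReal) : ENNReal := ∑' a, μ a * f a

lemma expect_pure {α : Type*} (a : α) (f : α → ENNReal) : expect (PMF.pure a) f = f a := by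
  rw [expect, tsum_eq_single a]
  · simp
  · intro b hb; simp [hb]

lemma expect_bind {α β : Type*} (μ : PMF α) (κ : α → PMF β) (f : β → ENNReal) :
    expect (μ.bind κ) f = expect μ fun a => expect (κ a) f := by
  simp only [expect, PMF.bind_apply, ← ENNReal.tsum_mul_right, ← ENNReal.tsum_mul_left]
  rw [ENNReal.tsum_comm]
  exact tsum_congr fun a => tsum_congr fun b => by rw [mul_assoc]

lemma expect_map {α β : Type*} (μ : PMF α) (g : α → β) (f : β → ENNReal) :
    expect (μ.map g) f = expect μ (f ∘ g) := by
  rw [PMF.map, expect_bind]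
  congr 1
  funext a
  exact expect_pure _ _

lemma expect_mono {α : Type*} (μ : PMF α) {f g : α → ENNReal} (h : ∀ a, f a ≤ g a) :
    expect μ f ≤ expect μ g := ENNReal.tsum_le_tsum fun a => mul_le_mul_right (h a) _

/-- The least expected value of `F` when the computation is observed at one of the first `t + 1`
times, which may be chosen depending on the past. -/
def optimalCost (F : Config → ENNReal) : ℕ → Config → ENNReal
  | 0, c => F c
  | t + 1, c => min (F c) (expect (step Φ c) (optimalCost F t))

variable {Φ} {F : Config → ENNReal}

lemma optimalCost_succ_le (t : ℕ) (c : Config) :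
    optimalCost Φ F (t + 1) c ≤ optimalCost Φ F t c := by
  induction t generalizing c with
  | zero => exact min_le_left _ _
  | succ t ih => exact min_le_min_left _ (expect_mono _ ih)

lemma optimalCost_antitone (c : Config) : Antitone fun t => optimalCost Φ F t c :=
  antitone_nat_of_succ_le fun t => optimalCost_succ_le t c

lemma optimalCost_of_step_eq_pure {c c' : Config} (h : step Φ c = PMF.pure c') (t : ℕ) :
    optimalCost Φ F (t + 1) c ≤ optimalCost Φ F t c' := by
  refine (min_le_right _ _).trans ?_
  rw [h, expect_pure]

/-- A deterministic stretch only consumes time: observation may be postponed until it is over. -/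
lemma BigStep.optimalCost_le {p : Program} {m m' : Memory} {t : ℕ} (h : BigStep p m t m')
    (k : List Program) (s : ℕ) :
    optimalCost Φ F (t + s) ⟨p :: k, m⟩ ≤ optimalCost Φ F s ⟨k, m'⟩ := by
  induction h generalizing k s with
  | skip => rw [add_comm]; exact optimalCost_of_step_eq_pure rfl s
  | setNat => rw [add_comm]; exact optimalCost_of_step_eq_pure rfl s
  | setReal => rw [add_comm]; exact optimalCost_of_step_eq_pure rfl s
  | @seq p q m₀ m₁ m₂ t₁ t₂ _ _ h1 h2 =>
    rw [show t₁ + t₂ + 1 + s = t₁ + (t₂ + s) + 1 by omega]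
    exact (optimalCost_of_step_eq_pure rfl _).trans ((h1 _ _).trans (h2 _ _))
  | @iteTrue b p q m m' t hb _ h1 =>
    rw [show t + 1 + s = t + s + 1 by omega]
    refine (optimalCost_of_step_eq_pure (c' := ⟨p :: k, m⟩) ?_ _).trans (h1 _ _)
    simp [step, hb]
  | @iteFalse b p q m m' t hb _ h1 =>
    rw [show t + 1 + s = t + s + 1 by omega]
    refine (optimalCost_of_step_eq_pure (c' := ⟨q :: k, m⟩) ?_ _).trans (h1 _ _)
    simp [step, hb]
  | @loopFalse b p m hb =>
    rw [add_comm]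
    refine optimalCost_of_step_eq_pure ?_ _
    simp [step, hb]
  | @loopTrue b p m₀ m₁ m₂ t₁ t₂ hb _ _ h1 h2 =>
    rw [show t₁ + t₂ + 1 + s = t₁ + (t₂ + s) + 1 by omega]
    refine (optimalCost_of_step_eq_pure (c' := ⟨p :: .loop b p :: k, m₀⟩) ?_ _).trans
      ((h1 _ _).trans (h2 _ _))
    simp [step, hb]

lemma optimalCost_replicate_skip (r : ℕ) (k : List Program) (m : Memory) (s : ℕ) :
    optimalCost Φ F (r + s) ⟨List.replicate r .skip ++ k, m⟩ ≤ optimalCost Φ F s ⟨k, m⟩ := by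
  induction r with
  | zero => simp
  | succ r ih =>
    rw [show r + 1 + s = r + s + 1 by omega]
    exact (optimalCost_of_step_eq_pure rfl _).trans ih

lemma run_of_halted {c : Config} (h : c.Halted) (t : ℕ) : run Φ t c = PMF.pure c := by
  induction t with
  | zero => rfl
  | succ t ih =>
    obtain ⟨k, m⟩ := c
    obtain rfl : k = [] := h
    rw [run, step, PMF.pure_bind, ih]

/-- Stopping early brings no advantage over observing at time t: stopping is useful only where F is
finite, and there the computation has halted and stays put. -/
lemma expect_run_le (hF : ∀ c, F c ≠ ⊤ → c.Halted) (t : ℕ) (c : Config) :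
    expect (run Φ t c) F ≤ optimalCost Φ F t c := by
  induction t generalizing c with
  | zero => exact (expect_pure _ _).le
  | succ t ih =>
    refine le_min ?_ ?_
    · by_cases h : F c = ⊤
      · rw [h]; exact le_top
      · rw [run_of_halted (hF c h), expect_pure]
    · rw [run, expect_bind]
      exact expect_mono _ ih

lemma mem_support_ne_top {α : Type*} {μ : PMF α} {f : α → ENNReal} (h : expect μ f ≠ ⊤) {a : α}
    (ha : a ∈ μ.support) : f a ≠ ⊤ := by
  intro hf
  refine h (top_le_iff.mp ?_)
  refine le_trans ?_ (ENNReal.le_tsum a)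
  rw [hf, ENNReal.mul_top ((PMF.mem_support_iff _ _).mp ha)]

/-- A pre-expectation `A` and a post-expectation `B` of a program that takes at most `T` steps. -/
def Hoare (Φ : Fin N → PureState n) (A : Memory → ENNReal) (p : Program) (T : ℕ)
    (B : Memory → ENNReal) : Prop :=
  ∀ (F : Config → ENNReal) (k : List Program) (s : ℕ),
    (∀ m, optimalCost Φ F s ⟨k, m⟩ ≤ B m) → ∀ m, optimalCost Φ F (T + s) ⟨p :: k, m⟩ ≤ A m

lemma Hoare.mono {A A' B B' : Memory → ENNReal} {p : Program} {T T' : ℕ} (h : Hoare Φ A p T B)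
    (hA : ∀ m, A m ≤ A' m) (hB : ∀ m, B' m ≤ B m) (hT : T ≤ T') : Hoare Φ A' p T' B' :=
  fun F k s hk m => (optimalCost_antitone _ (Nat.add_le_add_right hT s)).trans
    ((h F k s (fun m => (hk m).trans (hB m)) m).trans (hA m))

/-- A pre-expectation ⊤ acts as a false precondition: nothing has to be shown for such memories. -/
lemma Hoare.of_terminates {A B : Memory → ENNReal} {p : Program} {T : ℕ}
    (h : ∀ m, A m ≠ ⊤ → Terminates p T m fun m' => B m' ≤ A m) : Hoare Φ A p T B := by
  intro F k s hk m
  by_cases hm : A m = ⊤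
  · rw [hm]; exact le_top
  · obtain ⟨t, ht, m', hb, hB⟩ := h m hm
    exact (optimalCost_antitone _ (Nat.add_le_add_right ht s)).trans
      ((hb.optimalCost_le k s).trans ((hk m').trans hB))

lemma Hoare.seq {A B C : Memory → ENNReal} {p q : Program} {S T : ℕ} (h : Hoare Φ A p S B)
    (h' : Hoare Φ B q T C) : Hoare Φ A (.seq p q) (S + T + 1) C := by
  intro F k s hk m
  rw [show S + T + 1 + s = S + (T + s) + 1 by omega]
  exact (optimalCost_of_step_eq_pure rfl _).trans (h F _ _ (h' F k s hk) m)

lemma Hoare.setReal {B : Memory → ENNReal} {a : ℕ} {row col : NatExpr} {e : RealExpr} :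
    Hoare Φ (fun m => B ⟨m.nat, store m.real a (row.eval m) (col.eval m) (e.eval m)⟩)
      (.setReal a row col e) 1 B :=
  Hoare.of_terminates fun _ _ => .setReal le_rfl

lemma Hoare.measure {A B : Memory → ENNReal} {i r row col : NatExpr} {a Q : ℕ}
    (h : ∀ m, A m ≠ ⊤ → ∃ hi : i.eval m < N,
      expect (born (pauliString n (m.nat Q (r.eval m))) (Φ ⟨i.eval m, hi⟩)) (fun o =>
        B ⟨m.nat, store m.real a (row.eval m) (col.eval m) (if o then 1 else -1)⟩) ≤ A m) :
    Hoare Φ A (.measure i Q r a row col) (n + 1) B := by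
  intro F k s hk m
  by_cases hm : A m = ⊤
  · rw [hm]; exact le_top
  · obtain ⟨hi, hA⟩ := h m hm
    rw [show n + 1 + s = n + s + 1 by omega]
    refine (min_le_right _ _).trans (le_trans ?_ hA)
    rw [step, dif_pos hi, expect_map]
    exact expect_mono _ fun o => (optimalCost_replicate_skip n k _ s).trans (hk _)

/-- The bounded loop rule for bodies that measure. The values ⊤ off the prescribed counter value
make the body responsible for leaving the counter alone. -/
lemma Hoare.forTo {v : ℕ} {bound : NatExpr} {body : Program} {T R : ℕ}
    {A B : Memory → ENNReal} (I : ℕ → Memory → ENNReal)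
    (hI : ∀ i x m, I i (m.withVar v x) ≤ I i m)
    (hbound : ∀ i m, I i m ≠ ⊤ → bound.eval m = R)
    (hbody : ∀ i < R, Hoare Φ (fun m => if m.nat v 0 0 = i then I i m else ⊤) body T
      (fun m => if m.nat v 0 0 = i then I (i + 1) m else ⊤))
    (hA : ∀ m, I 0 m ≤ A m) (hB : ∀ m, B m ≤ I R m) :
    Hoare Φ A (Program.forTo v bound body) (R * (T + 3) + 3) B := by
  have hloop : ∀ r i, R - i = r → i ≤ R → Hoare Φ (fun m => if m.nat v 0 0 = i then I i m else ⊤)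
      (.loop (.natLE (.add (natVar v) (.lit 1)) bound)
        (.seq body (Program.assign v (.add (natVar v) (.lit 1))))) (r * (T + 3) + 1) B := by
    intro r
    induction r with
    | zero =>
      intro i hr hi
      obtain rfl : i = R := by omega
      refine Hoare.of_terminates fun m hm => ?_
      have hv : m.nat v 0 0 = i := by by_contra h; simp [h] at hm
      simp only [hv, if_true] at hm ⊢
      refine ⟨1, by omega, m, .loopFalse ?_, hB m⟩
      show ¬ m.nat v 0 0 + 1 ≤ bound.eval m
      rw [hbound i m hm, hv]
      omega
    | succ r ih =>
      intro i hr hi F k s hk m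
      by_cases hm : (if m.nat v 0 0 = i then I i m else ⊤) = ⊤
      · exact le_top.trans hm.ge
      have hv : m.nat v 0 0 = i := by by_contra h; simp [h] at hm
      have hm' : I i m ≠ ⊤ := by simpa [hv] using hm
      have hb : (Test.natLE (.add (natVar v) (.lit 1)) bound).Holds m := by
        show m.nat v 0 0 + 1 ≤ bound.eval m
        rw [hbound i m hm', hv]
        omega
      rw [show (r + 1) * (T + 3) + 1 + s = (T + (1 + (r * (T + 3) + 1 + s)) + 1) + 1 by ring]
      refine (optimalCost_of_step_eq_pure (c' := ⟨.seq body (Program.assign v (.add (natVar v) (.lit 1))) ::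
        .loop (.natLE (.add (natVar v) (.lit 1)) bound)
        (.seq body (Program.assign v (.add (natVar v) (.lit 1)))) :: k, m⟩) ?_ _).trans ?_
      · simp [step, hb]
      refine (optimalCost_of_step_eq_pure rfl _).trans ?_
      refine hbody i (by omega) F _ _ (fun m₁ => ?_) m
      by_cases hv₁ : m₁.nat v 0 0 = i
      · have hset : BigStep (Program.assign v (.add (natVar v) (.lit 1))) m₁ 1 (m₁.withVar v (i + 1)) := by
          have := BigStep.setNat v (.lit 0) (.lit 0) (.add (natVar v) (.lit 1)) m₁
          have e : (NatExpr.add (natVar v) (.lit 1)).eval m₁ = i + 1 := by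
            show m₁.nat v 0 0 + 1 = i + 1
            rw [hv₁]
          rw [e] at this
          exact this
        refine (hset.optimalCost_le _ _).trans ?_
        refine (ih (i + 1) (by omega) (by omega) F k s hk _).trans ?_
        simpa [hv₁, Memory.withVar_nat_self] using hI (i + 1) (i + 1) m₁
      · simp [hv₁]
  have h0 : Hoare Φ A (Program.assign v (.lit 0)) 1 (fun m => if m.nat v 0 0 = 0 then I 0 m else ⊤) := by
    refine Hoare.of_terminates fun m _ => .assign ?_
    have e : (NatExpr.lit 0).eval m = 0 := rfl
    rw [e, if_pos (Memory.withVar_nat_self _ _ _)]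
    exact (hI 0 0 m).trans (hA m)
  refine (h0.seq (hloop R 0 (by omega) (Nat.zero_le R))).mono (fun _ => le_rfl) (fun _ => le_rfl) ?_
  omega

end Cost

end HVClassifier
end
noncomputable section
namespace HVClassifier

/-! ## Enumeration of the Pauli operators along walks -/

section Children

/-- The Pauli strings with a position that arise by one step along an edge and the choice of the
code at the new position. -/
def children (E : List (Finset ℕ)) (n : ℕ) (x : (ℕ → ℕ) × ℕ) : List ((ℕ → ℕ) × ℕ) :=
  E.flatMap fun e => if x.2 ∈ e then
    (List.range n).flatMap fun q => if q ∈ e then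
      (List.range 4).map fun c => (Function.update x.1 q c, q) else [] else []

/-- A list of Pauli strings with positions, extended by all children. -/
def extend (E : List (Finset ℕ)) (n : ℕ) (L : List ((ℕ → ℕ) × ℕ)) : List ((ℕ → ℕ) × ℕ) :=
  L ++ L.flatMap (children E n)

lemma mem_children {E : List (Finset ℕ)} {n : ℕ} {x : (ℕ → ℕ) × ℕ} {e : Finset ℕ} (he : e ∈ E)
    (hx : x.2 ∈ e) {q c : ℕ} (hq : q ∈ e) (hqn : q < n) (hc : c < 4) :
    (Function.update x.1 q c, q) ∈ children E n x := by
  refine List.mem_flatMap.mpr ⟨e, he, ?_⟩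
  rw [if_pos hx]
  refine List.mem_flatMap.mpr ⟨q, List.mem_range.mpr hqn, ?_⟩
  rw [if_pos hq]
  exact List.mem_map.mpr ⟨c, List.mem_range.mpr hc, rfl⟩

/-- Each round of extension can follow the walk by one position and write the prescribed code there.
A revisited position receives the same code again, and surplus rounds are harmless because old
strings are kept. -/
lemma exists_mem_iterate_extend {E : List (Finset ℕ)} {n : ℕ} (s : ℕ → ℕ) (hs : ∀ q, s q < 4)
    (l : List ℕ) (hl : ∀ q ∈ l, q < n) {L : List ((ℕ → ℕ) × ℕ)} {x : (ℕ → ℕ) × ℕ} (hx : x ∈ L)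
    (hchain : (x.2 :: l).IsChain fun q q' => ∃ e ∈ E, q ∈ e ∧ q' ∈ e) {w : ℕ} (hw : l.length ≤ w) :
    ∃ x' ∈ (extend E n)^[w] L, ∀ q, x'.1 q = if q ∈ l then s q else x.1 q := by
  induction l generalizing L x w with
  | nil =>
    refine ⟨x, ?_, by simp⟩
    clear hw
    induction w generalizing L with
    | zero => exact hx
    | succ w ih => exact ih (List.mem_append_left _ hx)
  | cons a l ih =>
    obtain ⟨w, rfl⟩ : ∃ r, w = r + 1 := ⟨w - 1, by simp at hw; omega⟩
    rw [List.isChain_cons_cons] at hchain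
    obtain ⟨⟨e, he, h1, h2⟩, hch⟩ := hchain
    have hmem : (Function.update x.1 a (s a), a) ∈ extend E n L :=
      List.mem_append_right _ (List.mem_flatMap.mpr
        ⟨x, hx, mem_children he h1 h2 (hl a (by simp)) (hs a)⟩)
    obtain ⟨x', hx', h⟩ := ih (fun q hq => hl q (by simp [hq])) hmem hch (w := w)
      (by simpa using hw)
    refine ⟨x', hx', fun q => ?_⟩
    rw [h q]
    by_cases hq : q ∈ l
    · simp [hq]
    · by_cases hqa : q = a
      · subst hqa; simp [hq]
      · simp [hq, hqa]

/-- Only edges containing the current position contribute, and each of them offers at most b new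
positions with four codes. -/
lemma length_children_le {E : List (Finset ℕ)} {n b c : ℕ} (hE : ∀ e ∈ E, e.card ≤ b)
    {x : (ℕ → ℕ) × ℕ} (hc : E.countP (x.2 ∈ ·) ≤ c) : (children E n x).length ≤ c * (4 * b) := by
  refine le_trans ?_ (Nat.mul_le_mul_right _ hc)
  clear hc
  induction E with
  | nil => simp [children]
  | cons e E ih =>
    have ih' := ih fun e he => hE e (by simp [he])
    have hcard : ((List.range n).flatMap fun q => if q ∈ e then
        (List.range 4).map fun c => (Function.update x.1 q c, q) else []).length ≤ 4 * b := by
      have h1 : ∀ l : List ℕ, (l.flatMap fun q => if q ∈ e then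
          (List.range 4).map fun c => (Function.update x.1 q c, q) else []).length =
          4 * (l.filter (· ∈ e)).length := by
        intro l
        induction l with
        | nil => simp
        | cons a l ih =>
          rw [List.flatMap_cons, List.length_append, ih, List.filter_cons]
          by_cases ha : a ∈ e
          · simp [ha]; ring
          · simp [ha]
      rw [h1]
      refine Nat.mul_le_mul_left _ (le_trans ?_ (hE e (by simp)))
      have hnd : ((List.range n).filter (· ∈ e)).Nodup := List.nodup_range.filter _
      rw [← List.toFinset_card_of_nodup hnd]
      refine Finset.card_le_card fun q hq => ?_
      simpa using (List.mem_filter.mp (List.mem_toFinset.mp hq)).2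
    rw [children, List.flatMap_cons, List.length_append, List.countP_cons]
    change _ + (children E n x).length ≤ _
    by_cases hx : x.2 ∈ e
    · simp only [hx, if_true, decide_true]
      rw [add_mul, one_mul, add_comm]
      exact add_le_add ih' hcard
    · simpa [hx] using ih'

lemma length_iterate_extend_le {E : List (Finset ℕ)} {n B : ℕ}
    (hB : ∀ x, (children E n x).length ≤ B) (L : List ((ℕ → ℕ) × ℕ)) (w : ℕ) :
    ((extend E n)^[w] L).length ≤ L.length * (B + 1) ^ w := by
  induction w generalizing L with
  | zero => simp
  | succ w ih =>
    rw [Function.iterate_succ_apply, pow_succ']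
    refine (ih _).trans ?_
    rw [← mul_assoc]
    refine Nat.mul_le_mul_right _ ?_
    rw [extend, List.length_append, mul_add, mul_one, add_comm]
    refine Nat.add_le_add_right ?_ _
    induction L with
    | nil => simp
    | cons x L ih =>
      rw [List.flatMap_cons, List.length_append, List.length_cons, add_mul, one_mul, add_comm]
      exact add_le_add ih (hB x)

end Children

/-! ### Counting bounds for the edges. -/

namespace Problem

variable {n K : ℕ} {𝒳 : Type*} {P : Problem n K 𝒳}

lemma card_le_of_mem_edges {Λ ℓ : ℕ} (hloc : ∀ k, (P.ham k).LocalityLE Λ)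
    (hobs : P.obsSupp.card ≤ ℓ) : ∀ e ∈ P.edges, e.card ≤ ℓ + Λ + 1 := by
  intro e he
  simp only [edges, List.mem_cons, List.mem_flatMap, List.mem_finRange, true_and, termSets,
    List.mem_map] at he
  rcases he with rfl | ⟨k, j, rfl⟩
  · refine (Finset.card_insert_le _ _).trans ?_
    rw [qubitSet, Finset.card_map]
    omega
  · rw [qubitSet, Finset.card_map]
    have := hloc k j
    omega

lemma countP_termSets_le {d : ℕ} (hdeg : ∀ k, (P.ham k).DegreeLE d) (k : Fin K) (q : ℕ) :
    (P.termSets k).countP (q ∈ ·) ≤ d + 1 := by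
  classical
  by_cases hq : q < n
  · refine le_trans (le_of_eq ?_) ((P.ham k).card_terms_at_le (hdeg k) ⟨q, hq⟩)
    rw [termSets, List.countP_map, List.countP_eq_length_filter, Finset.card, Finset.filter_val,
      Fin.univ_def]
    simp only [Multiset.filter_coe, Multiset.coe_card]
    congr 2
    funext j
    simp only [Function.comp_apply]
    congr 1
    exact propext (val_mem_qubitSet (q := (⟨q, hq⟩ : Fin n)))
  · have : (P.termSets k).countP (q ∈ ·) = 0 := by
      rw [List.countP_eq_zero]
      intro e he
      simp only [termSets, List.mem_map, List.mem_finRange, true_and] at he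
      obtain ⟨j, rfl⟩ := he
      simpa using fun h => hq (lt_of_mem_qubitSet h)
    omega

lemma countP_edges_le {d : ℕ} (hdeg : ∀ k, (P.ham k).DegreeLE d) (q : ℕ) :
    P.edges.countP (q ∈ ·) ≤ K * (d + 1) + 1 := by
  rw [edges, List.countP_cons, List.countP_flatMap]
  refine add_le_add ?_ (by split_ifs <;> simp)
  have h : ∀ l : List (Fin K), (l.map fun k => (P.termSets k).countP (q ∈ ·)).sum ≤
      l.length * (d + 1) := by
    intro l
    induction l with
    | nil => simp
    | cons k l ih =>
      rw [List.map_cons, List.sum_cons, List.length_cons, add_mul, one_mul, add_comm]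
      exact add_le_add ih (countP_termSets_le hdeg k q)
  have h' := h (List.finRange K)
  rw [List.length_finRange] at h'
  exact h'

/-- Supports are nonempty, so every term meets the set of all qubits. -/
lemma numTerms_le {d : ℕ} (hdeg : ∀ k, (P.ham k).DegreeLE d) (k : Fin K) :
    (P.ham k).numTerms ≤ n * (d + 1) := by
  classical
  have h := (P.ham k).card_terms_meeting_le (hdeg k) Finset.univ
  simpa [(P.ham k).supp_nonempty] using h

lemma length_edges_le {d : ℕ} (hdeg : ∀ k, (P.ham k).DegreeLE d) :
    P.edges.length ≤ K * (n * (d + 1)) + 1 := by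
  rw [edges, List.length_cons, List.length_flatMap]
  refine Nat.add_le_add_right ?_ _
  have h : ∀ l : List (Fin K), (l.map fun k => (P.termSets k).length).sum ≤
      l.length * (n * (d + 1)) := by
    intro l
    induction l with
    | nil => simp
    | cons k l ih =>
      rw [List.map_cons, List.sum_cons, List.length_cons, add_mul, one_mul, add_comm]
      refine add_le_add ih ?_
      simpa [termSets] using numTerms_le hdeg k
  simpa using h (List.finRange K)

end Problem

/-! ## Simplification rules for program texts -/

section SimpRules

variable (m : Memory) (e f : NatExpr) (x y : RealExpr) (p q : Program) (a a' : ℕ)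

@[simp] lemma NatExpr.eval_lit (c : ℕ) : (NatExpr.lit c).eval m = c := rfl
@[simp] lemma NatExpr.eval_cell : (NatExpr.cell a e f).eval m = m.nat a (e.eval m) (f.eval m) := rfl
@[simp] lemma NatExpr.eval_add : (NatExpr.add e f).eval m = e.eval m + f.eval m := rfl
@[simp] lemma NatExpr.eval_natVar : (natVar a).eval m = m.nat a 0 0 := rfl
@[simp] lemma RealExpr.eval_lit (c : ℚ) : (RealExpr.lit c).eval m = c := rfl
@[simp] lemma RealExpr.eval_cell :
    (RealExpr.cell a e f).eval m = m.real a (e.eval m) (f.eval m) := rfl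
@[simp] lemma RealExpr.eval_ofNat : (RealExpr.ofNat e).eval m = (e.eval m : ℝ) := rfl
@[simp] lemma RealExpr.eval_add : (RealExpr.add x y).eval m = x.eval m + y.eval m := rfl
@[simp] lemma RealExpr.eval_sub : (RealExpr.sub x y).eval m = x.eval m - y.eval m := rfl
@[simp] lemma RealExpr.eval_mul : (RealExpr.mul x y).eval m = x.eval m * y.eval m := rfl
@[simp] lemma RealExpr.eval_div : (RealExpr.div x y).eval m = x.eval m / y.eval m := rfl
@[simp] lemma RealExpr.eval_realVar : (realVar a).eval m = m.real a 0 0 := rfl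
@[simp] lemma Test.holds_natLE : (Test.natLE e f).Holds m ↔ e.eval m ≤ f.eval m := Iff.rfl
@[simp] lemma Test.holds_realLE : (Test.realLE x y).Holds m ↔ x.eval m ≤ y.eval m := Iff.rfl
@[simp] lemma Test.holds_neg (b : Test) : (Test.neg b).Holds m ↔ ¬ b.Holds m := Iff.rfl

@[simp] lemma Program.writesNat_skip : ¬ Program.skip.WritesNat a := id
@[simp] lemma Program.writesNat_setNat (g : NatExpr) :
    (Program.setNat a' e f g).WritesNat a ↔ a = a' := Iff.rfl
@[simp] lemma Program.writesNat_setReal : ¬ (Program.setReal a' e f x).WritesNat a := id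
@[simp] lemma Program.writesNat_seq :
    (Program.seq p q).WritesNat a ↔ p.WritesNat a ∨ q.WritesNat a := Iff.rfl
@[simp] lemma Program.writesNat_ite (b : Test) :
    (Program.ite b p q).WritesNat a ↔ p.WritesNat a ∨ q.WritesNat a := Iff.rfl
@[simp] lemma Program.writesNat_loop (b : Test) :
    (Program.loop b p).WritesNat a ↔ p.WritesNat a := Iff.rfl
@[simp] lemma Program.writesNat_assign : (Program.assign a' e).WritesNat a ↔ a = a' := Iff.rfl
@[simp] lemma Program.writesNat_assignReal : ¬ (Program.assignReal a' x).WritesNat a := id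
@[simp] lemma Program.writesNat_forTo :
    (Program.forTo a' e p).WritesNat a ↔ a = a' ∨ p.WritesNat a := by
  simp [Program.forTo, or_comm]
@[simp] lemma Program.writesReal_skip : ¬ Program.skip.WritesReal a := id
@[simp] lemma Program.writesReal_setNat (g : NatExpr) :
    ¬ (Program.setNat a' e f g).WritesReal a := id
@[simp] lemma Program.writesReal_setReal :
    (Program.setReal a' e f x).WritesReal a ↔ a = a' := Iff.rfl
@[simp] lemma Program.writesReal_seq :
    (Program.seq p q).WritesReal a ↔ p.WritesReal a ∨ q.WritesReal a := Iff.rfl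
@[simp] lemma Program.writesReal_ite (b : Test) :
    (Program.ite b p q).WritesReal a ↔ p.WritesReal a ∨ q.WritesReal a := Iff.rfl
@[simp] lemma Program.writesReal_loop (b : Test) :
    (Program.loop b p).WritesReal a ↔ p.WritesReal a := Iff.rfl
@[simp] lemma Program.writesReal_assign : ¬ (Program.assign a' e).WritesReal a := id
@[simp] lemma Program.writesReal_assignReal :
    (Program.assignReal a' x).WritesReal a ↔ a = a' := Iff.rfl
@[simp] lemma Program.writesReal_forTo :
    (Program.forTo a' e p).WritesReal a ↔ p.WritesReal a := by
  simp [Program.forTo]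

end SimpRules

/-! ## The program for the enumeration

The natural arrays `K + 3, …` hold: the number of qubits (`3`), the number of data points (`4`), the
number of edges (`5`), the edges (`6`), the number of rounds (`7`), the number of Pauli operators
(`8`), their positions (`9`); the Pauli operators themselves are in array `1`. -/

/-- Append the Pauli string `K + 12` with the code `K + 15` at the qubit `K + 14`. -/
def pushChild (K : ℕ) : Program :=
  .seq (.forTo (K + 16) (natVar (K + 3))
    (.setNat 1 (natVar (K + 8)) (natVar (K + 16)) (.cell 1 (natVar (K + 12)) (natVar (K + 16)))))
  (.seq (.setNat 1 (natVar (K + 8)) (natVar (K + 14)) (natVar (K + 15)))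
  (.seq (.setNat (K + 9) (.lit 0) (natVar (K + 8)) (natVar (K + 14)))
    (.assign (K + 8) (.add (natVar (K + 8)) (.lit 1)))))

/-- Append the children of the Pauli string `K + 12` at the qubit `K + 14`. -/
def pushCodes (K : ℕ) : Program := .forTo (K + 15) (.lit 4) (pushChild K)

/-- Append the children of the Pauli string `K + 12` along the edge `K + 13`. -/
def pushEdge (K : ℕ) : Program :=
  .ite (.natLE (.lit 1) (.cell (K + 6) (natVar (K + 13)) (.cell (K + 9) (.lit 0) (natVar (K + 12)))))
    (.forTo (K + 14) (natVar (K + 3))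
      (.ite (.natLE (.lit 1) (.cell (K + 6) (natVar (K + 13)) (natVar (K + 14))))
        (pushCodes K) .skip)) .skip

/-- Append all children of all Pauli strings. -/
def pushRound (K : ℕ) : Program :=
  .seq (.assign (K + 10) (natVar (K + 8)))
    (.forTo (K + 12) (natVar (K + 10)) (.forTo (K + 13) (natVar (K + 5)) (pushEdge K)))

/-- The enumeration. -/
def enumerate (K : ℕ) : Program := .forTo (K + 11) (natVar (K + 7)) (pushRound K)

/-- The memory holds the list `L` of Pauli strings with positions. -/
structure StoresList (K n : ℕ) (L : List ((ℕ → ℕ) × ℕ)) (m : Memory) : Prop where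
  count : m.nat (K + 8) 0 0 = L.length
  pos : ∀ i x, L[i]? = some x → m.nat (K + 9) 0 i = x.2
  string : ∀ i x, L[i]? = some x → ∀ q < n, m.nat 1 i q = x.1 q

/-- The memory holds the number of qubits and the list `E` of edges. -/
structure StoresEdges (K n : ℕ) (E : List (Finset ℕ)) (m : Memory) : Prop where
  qubits : m.nat (K + 3) 0 0 = n
  count : m.nat (K + 5) 0 0 = E.length
  -- Columns run up to n inclusive, since n is the starting position of the walks.
  edge : ∀ r e, E[r]? = some e → ∀ q ≤ n, m.nat (K + 6) r q = if q ∈ e then 1 else 0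

section Enumerate

variable {K n : ℕ} {E : List (Finset ℕ)} {L : List ((ℕ → ℕ) × ℕ)} {m m' : Memory}

lemma StoresList.congr (h : StoresList K n L m) (h1 : m'.nat (K + 8) = m.nat (K + 8))
    (h2 : m'.nat (K + 9) = m.nat (K + 9)) (h3 : m'.nat 1 = m.nat 1) : StoresList K n L m' :=
  ⟨by rw [h1, h.count], by rw [h2]; exact h.pos, by rw [h3]; exact h.string⟩

lemma StoresList.withVar (h : StoresList K n L m) {v x : ℕ} (h1 : K + 8 ≠ v) (h2 : K + 9 ≠ v)
    (h3 : 1 ≠ v) : StoresList K n L (m.withVar v x) :=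
  h.congr (m.withVar_nat_of_ne x h1) (m.withVar_nat_of_ne x h2) (m.withVar_nat_of_ne x h3)

lemma StoresEdges.congr (h : StoresEdges K n E m) (h1 : m'.nat (K + 3) = m.nat (K + 3))
    (h2 : m'.nat (K + 5) = m.nat (K + 5)) (h3 : m'.nat (K + 6) = m.nat (K + 6)) :
    StoresEdges K n E m' :=
  ⟨by rw [h1, h.qubits], by rw [h2, h.count], by rw [h3]; exact h.edge⟩

lemma StoresEdges.framed {p : Program} (h : StoresEdges K n E m) (hf : Framed p m m')
    (h1 : ¬ p.WritesNat (K + 3)) (h2 : ¬ p.WritesNat (K + 5)) (h3 : ¬ p.WritesNat (K + 6)) :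
    StoresEdges K n E m' := h.congr (hf.nat _ h1) (hf.nat _ h2) (hf.nat _ h3)

lemma terminates_pushChild {i q c : ℕ} {x : (ℕ → ℕ) × ℕ} (hL : StoresList K n L m)
    (hx : L[i]? = some x) (hn : m.nat (K + 3) 0 0 = n) (hi : m.nat (K + 12) 0 0 = i)
    (hq : m.nat (K + 14) 0 0 = q) (hc : m.nat (K + 15) 0 0 = c) :
    Terminates (pushChild K) (n * 4 + 9) m
      (StoresList K n (L ++ [(Function.update x.1 q c, q)])) := by
  have hiL : i < L.length := (List.getElem?_eq_some_iff.mp hx).1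
  refine (Terminates.seq (T := n * (1 + 3) + 3) (T' := 5) ?_).mono (by omega) fun _ h => h
  -- The new row has index `L.length`; its columns below `col` are already copied from row i. The
  -- source row is not overwritten because i < `L.length`.
  refine Terminates.forTo (N := n) (fun col m' => m'.nat 1 = fun r c' =>
    if r = L.length ∧ c' < col then m.nat 1 i c' else m.nat 1 r c') (by simp) ?_ ?_ ?_ ?_ ?_
  · intro i x m' h
    rw [m'.withVar_nat_of_ne x (by omega), h]
  · intro i m' hf _
    simp [hf.nat (K + 3) (by simp), hn]
  · simp
  · intro col m' hcol hv hf hI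
    refine .setNat ?_
    simp only [NatExpr.eval_natVar, NatExpr.eval_cell, hf.nat (K + 8) (by simp),
      hf.nat (K + 12) (by simp), hv, hL.count, hi, store_self, hI]
    funext r c'
    have : i ≠ L.length := hiL.ne
    by_cases h1 : r = L.length
    · by_cases h2 : c' = col
      · simp [h1, h2, this]
      · have : c' < col ↔ c' < col + 1 := by omega
        simp [h1, h2, this]
    · simp [h1]
  · intro m' hf hI
    refine (Terminates.seq (T := 1) (T' := 3) (.setNat (.seq (T := 1) (T' := 1)
      (.setNat (.assign ?_))))).mono (by omega) fun _ h => h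
    have e8 := hf.nat (K + 8) (by simp)
    have e9 := hf.nat (K + 9) (by simp)
    have e14 := hf.nat (K + 14) (by simp)
    have e15 := hf.nat (K + 15) (by simp)
    have n1 : (1 : ℕ) ≠ K + 8 := by omega
    have n2 : (1 : ℕ) ≠ K + 9 := by omega
    have n3 : (K + 8 : ℕ) ≠ 1 := by omega
    have n4 : (K + 9 : ℕ) ≠ 1 := by omega
    have n5 : (K + 14 : ℕ) ≠ 1 := by omega
    have n6 : (K + 15 : ℕ) ≠ 1 := by omega
    refine ⟨?_, ?_, ?_⟩
    · simp [Memory.withVar, store, e8, hL.count]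
    · intro j y hy
      simp only [Memory.withVar, NatExpr.eval_natVar, NatExpr.eval_lit, NatExpr.eval_add]
      rw [store_of_ne _ _ _ _ (by simp), store_self]
      simp only [store_of_ne _ _ _ _ n3, store_of_ne _ _ _ _ n4, store_of_ne _ _ _ _ n5, e8, e9,
        e14, hL.count, hq, true_and]
      rw [List.getElem?_append] at hy
      by_cases h1 : j < L.length
      · rw [if_pos h1] at hy
        rw [if_neg h1.ne]
        exact hL.pos j y hy
      · rw [if_neg h1] at hy
        by_cases h2 : j = L.length
        · have hy' : y = (Function.update x.1 q c, q) := by simpa [h2] using hy.symm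
          rw [if_pos h2, hy']
        · have : j - L.length ≠ 0 := by omega
          simp [this] at hy
    · intro j y hy q' hq'
      simp only [Memory.withVar, NatExpr.eval_natVar, NatExpr.eval_lit, NatExpr.eval_add]
      rw [store_of_ne _ _ _ _ n1, store_of_ne _ _ _ _ n2, store_self]
      simp only [e8, e14, e15, hL.count, hq, hc, hI]
      rw [List.getElem?_append] at hy
      by_cases h1 : j < L.length
      · rw [if_pos h1] at hy
        have : j ≠ L.length := h1.ne
        simp only [this, false_and, if_false]
        exact hL.string j y hy q' hq'
      · rw [if_neg h1] at hy
        by_cases h2 : j = L.length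
        · have hy' : y = (Function.update x.1 q c, q) := by simpa [h2] using hy.symm
          rw [hy']
          by_cases h3 : q' = q
          · simp [h2, h3]
          · simp [h2, h3, hq', hL.string i x hx q' hq']
        · have : j - L.length ≠ 0 := by omega
          simp [this] at hy

lemma terminates_pushCodes {i q : ℕ} {x : (ℕ → ℕ) × ℕ} (hL : StoresList K n L m)
    (hx : L[i]? = some x) (hn : m.nat (K + 3) 0 0 = n) (hi : m.nat (K + 12) 0 0 = i)
    (hq : m.nat (K + 14) 0 0 = q) :
    Terminates (pushCodes K) (n * 16 + 51) m
      (StoresList K n (L ++ (List.range 4).map fun c => (Function.update x.1 q c, q))) := by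
  have hiL : i < L.length := (List.getElem?_eq_some_iff.mp hx).1
  refine (Terminates.forTo (N := 4) (T := n * 4 + 9) (fun c => StoresList K n
    (L ++ (List.range c).map fun c => (Function.update x.1 q c, q))) (by simp [pushChild])
    ?_ ?_ ?_ ?_ ?_).mono (by omega) fun _ h => h
  · intro i x m' h
    exact h.withVar (by omega) (by omega) (by omega)
  · intro i m' _ _
    simp
  · simpa using hL
  · intro c m' hc hv hf hI
    rw [List.range_succ, List.map_append, ← List.append_assoc]
    refine terminates_pushChild hI (by rw [List.getElem?_append_left hiL, hx]) ?_ ?_ ?_ hv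
    · rw [hf.nat _ (by simp [pushChild]), hn]
    · rw [hf.nat _ (by simp [pushChild]), hi]
    · rw [hf.nat _ (by simp [pushChild]), hq]
  · exact fun m' _ h => h

lemma terminates_pushEdge {i r : ℕ} {x : (ℕ → ℕ) × ℕ} {e : Finset ℕ} (hE : StoresEdges K n E m)
    (hL : StoresList K n L m) (hx : L[i]? = some x) (hxn : x.2 ≤ n)
    (hi : m.nat (K + 12) 0 0 = i) (he : E[r]? = some e) (hr : m.nat (K + 13) 0 0 = r) :
    Terminates (pushEdge K) (n * (n * 16 + 55) + 4) m
      (StoresList K n (L ++ if x.2 ∈ e then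
        (List.range n).flatMap fun q => if q ∈ e then
          (List.range 4).map fun c => (Function.update x.1 q c, q) else [] else [])) := by
  have hiL : i < L.length := (List.getElem?_eq_some_iff.mp hx).1
  have htest : m.nat (K + 6) r (m.nat (K + 9) 0 i) = if x.2 ∈ e then 1 else 0 := by
    rw [hL.pos i x hx]
    exact hE.edge r e he x.2 hxn
  refine (Terminates.ite (T := n * (n * 16 + 51 + 1 + 3) + 3) ?_ ?_).mono (by ring_nf; omega)
    fun _ h => h
  · intro hb
    have hxe : x.2 ∈ e := by
      by_contra h
      simp [hr, hi, htest, h] at hb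
    rw [if_pos hxe]
    refine Terminates.forTo (fun q => StoresList K n (L ++ (List.range q).flatMap fun q =>
      if q ∈ e then (List.range 4).map fun c => (Function.update x.1 q c, q) else []))
      (by simp [pushChild, pushCodes]) ?_ ?_ ?_ ?_ ?_
    · intro i x m' h
      exact h.withVar (by omega) (by omega) (by omega)
    · intro i m' hf _
      simp [hf.nat (K + 3) (by simp [pushChild, pushCodes]), hE.qubits]
    · simpa using hL
    · intro q m' hq hv hf hI
      have e6 := hf.nat (K + 6) (by simp [pushChild, pushCodes])
      have e13 := hf.nat (K + 13) (by simp [pushChild, pushCodes])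
      have htest' : m'.nat (K + 6) r q = if q ∈ e then 1 else 0 := by
        rw [e6]; exact hE.edge r e he q hq.le
      rw [List.range_succ (n := q), List.flatMap_append, ← List.append_assoc, List.flatMap_singleton]
      refine .ite (fun hb' => ?_) fun hb' => ?_
      · have hqe : q ∈ e := by
          by_contra h
          simp [e13, hr, hv, htest', h] at hb'
        rw [if_pos hqe]
        refine terminates_pushCodes hI (by rw [List.getElem?_append_left hiL, hx]) ?_ ?_ hv
        · rw [hf.nat _ (by simp [pushChild, pushCodes]), hE.qubits]
        · rw [hf.nat _ (by simp [pushChild, pushCodes]), hi]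
      · have hqe : q ∉ e := by
          intro h
          simp [e13, hr, hv, htest', h] at hb'
        rw [if_neg hqe, List.append_nil]
        exact (Terminates.skip hI).mono (by omega) fun _ h => h
    · exact fun m' _ h => h
  · intro hb
    have hxe : x.2 ∉ e := by
      intro h
      simp [hr, hi, htest, h] at hb
    rw [if_neg hxe, List.append_nil]
    exact (Terminates.skip hL).mono (by omega) fun _ h => h

/-- The length at the beginning of the round is saved in `K + 10`, so strings appended during the
round are not themselves expanded. -/
lemma terminates_pushRound (hE : StoresEdges K n E m) (hL : StoresList K n L m)
    (hLn : ∀ x ∈ L, x.2 ≤ n) :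
    Terminates (pushRound K) (L.length * (E.length * (n * (n * 16 + 55) + 7) + 6) + 5) m
      (StoresList K n (extend E n L)) := by
  refine (Terminates.seq (T := 1) (T' := L.length * (E.length * (n * (n * 16 + 55) + 4 + 3) + 3 + 3)
    + 3) (.assign ?_)).mono (by ring_nf; omega) fun _ h => h
  have hE1 : StoresEdges K n E (m.withVar (K + 10) ((natVar (K + 8)).eval m)) :=
    hE.congr (m.withVar_nat_of_ne _ (by omega)) (m.withVar_nat_of_ne _ (by omega))
      (m.withVar_nat_of_ne _ (by omega))
  have hL1 : StoresList K n L (m.withVar (K + 10) ((natVar (K + 8)).eval m)) :=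
    hL.withVar (by omega) (by omega) (by omega)
  have hold : (m.withVar (K + 10) ((natVar (K + 8)).eval m)).nat (K + 10) 0 0 = L.length := by
    rw [Memory.withVar_nat_self, NatExpr.eval_natVar, hL.count]
  revert hE1 hL1 hold
  generalize m.withVar (K + 10) ((natVar (K + 8)).eval m) = m₁
  intro hE1 hL1 hold
  refine Terminates.forTo (fun i => StoresList K n (L ++ (L.take i).flatMap (children E n)))
    (by simp [pushChild, pushCodes, pushEdge]) ?_ ?_ ?_ ?_ ?_
  · intro i x m' h
    exact h.withVar (by omega) (by omega) (by omega)
  · intro i m' hf _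
    simp [hf.nat (K + 10) (by simp [pushChild, pushCodes, pushEdge]), hold]
  · simpa using hL1
  · intro i m' hi hv hf hI
    have hE2 := hE1.framed hf (by simp [pushChild, pushCodes, pushEdge])
      (by simp [pushChild, pushCodes, pushEdge]) (by simp [pushChild, pushCodes, pushEdge])
    obtain ⟨x, hx⟩ : ∃ x, L[i]? = some x := ⟨L[i], List.getElem?_eq_getElem hi⟩
    have hxn : x.2 ≤ n := hLn x (List.mem_of_getElem? hx)
    rw [List.take_add_one, hx, List.flatMap_append, ← List.append_assoc]
    set L' := L ++ (L.take i).flatMap (children E n) with hL'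
    -- Appending never moves the strings of the old list.
    have hx' : ∀ L'' : List ((ℕ → ℕ) × ℕ), (L' ++ L'')[i]? = some x := by
      intro L''
      rw [hL', List.append_assoc, List.getElem?_append_left hi, hx]
    have hch : ∀ s, s ≤ E.length → (E.take s).flatMap (fun e => if x.2 ∈ e then
        (List.range n).flatMap fun q => if q ∈ e then
          (List.range 4).map fun c => (Function.update x.1 q c, q) else [] else []) =
        children (E.take s) n x := fun _ _ => rfl
    refine Terminates.forTo (N := E.length) (fun r => StoresList K n (L' ++ children (E.take r) n x))
      (by simp [pushChild, pushCodes, pushEdge]) ?_ ?_ ?_ ?_ ?_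
    · intro i x m' h
      exact h.withVar (by omega) (by omega) (by omega)
    · intro r m'' hf' _
      simp [hf'.nat (K + 5) (by simp [pushChild, pushCodes, pushEdge]), hE2.count]
    · simpa [children] using hI
    · intro r m'' hr hv' hf' hI'
      obtain ⟨e, he⟩ : ∃ e, E[r]? = some e := ⟨E[r], List.getElem?_eq_getElem hr⟩
      have hstep : children (E.take (r + 1)) n x = children (E.take r) n x ++
          if x.2 ∈ e then (List.range n).flatMap fun q => if q ∈ e then
            (List.range 4).map fun c => (Function.update x.1 q c, q) else [] else [] := by
        simp only [children]
        rw [List.take_add_one, he, List.flatMap_append]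
        simp
      rw [hstep, ← List.append_assoc]
      refine terminates_pushEdge (i := i) (r := r) ?_ hI' (hx' _) hxn ?_ he hv'
      · exact hE2.framed hf' (by simp [pushChild, pushCodes, pushEdge])
          (by simp [pushChild, pushCodes, pushEdge]) (by simp [pushChild, pushCodes, pushEdge])
      · rw [hf'.nat _ (by simp [pushChild, pushCodes, pushEdge]), hv]
    · intro m'' _ h
      simpa using h
  · intro m' _ h
    simpa [extend] using h

lemma snd_le_of_mem_extend (hLn : ∀ x ∈ L, x.2 ≤ n) : ∀ x ∈ extend E n L, x.2 ≤ n := by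
  intro x hx
  rcases List.mem_append.mp hx with h | h
  · exact hLn x h
  · obtain ⟨y, _, hy⟩ := List.mem_flatMap.mp h
    obtain ⟨e, _, he⟩ := List.mem_flatMap.mp hy
    split_ifs at he
    · obtain ⟨q, hq, hqe⟩ := List.mem_flatMap.mp he
      split_ifs at hqe
      · obtain ⟨c, _, rfl⟩ := List.mem_map.mp hqe
        exact (List.mem_range.mp hq).le
      · simp at hqe
    · simp at he

lemma terminates_enumerate {W B : ℕ} (hE : StoresEdges K n E m) (hL : StoresList K n L m)
    (hLn : ∀ x ∈ L, x.2 ≤ n) (hW : m.nat (K + 7) 0 0 = W)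
    (hB : ∀ w ≤ W, ((extend E n)^[w] L).length ≤ B) :
    Terminates (enumerate K) (W * (B * (E.length * (n * (n * 16 + 55) + 7) + 6) + 8) + 3) m
      (StoresList K n ((extend E n)^[W] L)) := by
  have hn : ∀ w, ∀ x ∈ (extend E n)^[w] L, x.2 ≤ n := by
    intro w
    induction w with
    | zero => exact hLn
    | succ w ih => rw [Function.iterate_succ_apply']; exact snd_le_of_mem_extend ih
  refine (Terminates.forTo (T := B * (E.length * (n * (n * 16 + 55) + 7) + 6) + 5)
    (fun w => StoresList K n ((extend E n)^[w] L))
    (by simp [pushChild, pushCodes, pushEdge, pushRound]) ?_ ?_ hL ?_ fun _ _ h => h).mono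
    (by ring_nf; omega) fun _ h => h
  · intro i x m' h
    exact h.withVar (by omega) (by omega) (by omega)
  · intro i m' hf _
    simp [hf.nat (K + 7) (by simp [pushChild, pushCodes, pushEdge, pushRound]), hW]
  · intro w m' hw hv hf hI
    have hE2 := hE.framed hf (by simp [pushChild, pushCodes, pushEdge, pushRound])
      (by simp [pushChild, pushCodes, pushEdge, pushRound])
      (by simp [pushChild, pushCodes, pushEdge, pushRound])
    rw [Function.iterate_succ_apply']
    refine (terminates_pushRound hE2 hI (hn w)).mono ?_ fun _ h => h
    have := hB w hw.le
    gcongr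

end Enumerate

end HVClassifier
end
noncomputable section
namespace HVClassifier

/-! ## Preparation of the edges -/

/-- Append the supports of the terms of the Hamiltonian `k` to the edges. -/
def mergeTerms (K k : ℕ) : Program :=
  .forTo (K + 13) (.cell 2 (.lit 0) (.lit k))
    (.seq (.forTo (K + 14) (.add (natVar (K + 3)) (.lit 1))
      (.setNat (K + 6) (natVar (K + 5)) (natVar (K + 14))
        (.cell (k + 3) (natVar (K + 13)) (natVar (K + 14)))))
      (.assign (K + 5) (.add (natVar (K + 5)) (.lit 1))))

/-- Append the supports of the terms of the first Hamiltonians to the edges. -/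
def mergeHams (K : ℕ) : ℕ → Program
  | 0 => .skip
  | k + 1 => .seq (mergeHams K k) (mergeTerms K k)

/-- Store all edges. -/
def mergeEdges (K : ℕ) : Program :=
  .seq (.forTo (K + 14) (natVar (K + 3))
    (.setNat (K + 6) (.lit 0) (natVar (K + 14)) (.cell 1 (.lit 0) (natVar (K + 14)))))
  (.seq (.setNat (K + 6) (.lit 0) (natVar (K + 3)) (.lit 1))
  (.seq (.assign (K + 5) (.lit 1)) (mergeHams K K)))

/-- The text of `mergeHams` is built by recursion, because array names are constants of a program
and the loop over the Hamiltonians has to be unrolled. Its write targets are therefore found by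
induction. -/
lemma writesNat_mergeHams {K k a : ℕ} (h : (mergeHams K k).WritesNat a) :
    a = K + 5 ∨ a = K + 6 ∨ a = K + 13 ∨ a = K + 14 := by
  induction k with
  | zero => exact h.elim
  | succ k ih =>
    rcases h with h | h
    · exact ih h
    · simp only [mergeTerms, Program.writesNat_forTo, Program.writesNat_seq,
        Program.writesNat_setNat, Program.writesNat_assign] at h
      tauto

lemma not_writesReal_mergeHams (K k a : ℕ) : ¬ (mergeHams K k).WritesReal a := by
  induction k with
  | zero => exact id
  | succ k ih => simp [mergeHams, mergeTerms, ih]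

section Merge

variable {n K : ℕ} {𝒳 : Type*} {P : Problem n K 𝒳} {ε : ℝ} {m m' : Memory}
  {E : List (Finset ℕ)}

lemma storesEdges_append {e : Finset ℕ} (h : StoresEdges K n E m)
    (h3 : m'.nat (K + 3) = m.nat (K + 3)) (h5 : m'.nat (K + 5) 0 0 = E.length + 1)
    (h6 : ∀ r q, q ≤ n → m'.nat (K + 6) r q =
      if r = E.length then (if q ∈ e then 1 else 0) else m.nat (K + 6) r q) :
    StoresEdges K n (E ++ [e]) m' := by
  refine ⟨by rw [h3, h.qubits], by simp [h5], fun r e' he' q hq => ?_⟩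
  rw [h6 r q hq]
  rw [List.getElem?_append] at he'
  by_cases h1 : r < E.length
  · rw [if_pos h1] at he'
    rw [if_neg h1.ne]
    exact h.edge r e' he' q hq
  · rw [if_neg h1] at he'
    by_cases h2 : r = E.length
    · have : e' = e := by simpa [h2] using he'.symm
      rw [if_pos h2, this]
    · have : r - E.length ≠ 0 := by omega
      simp [this] at he'

/-- The hypothesis `hin` keeps the input arrays intact; the working arrays written here begin at `K
+ 3`, beyond the arrays of all K Hamiltonians. -/
lemma terminates_mergeTerms (k : Fin K) (hE : StoresEdges K n E m)
    (hin : ∀ a, 1 ≤ a → a < K + 3 → m.nat a = (inputMemory P ε).nat a) :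
    Terminates (mergeTerms K k) ((P.ham k).numTerms * (n * 4 + 12) + 3) m
      (StoresEdges K n (E ++ P.termSets k)) := by
  have hk := k.2
  refine (Terminates.forTo (N := (P.ham k).numTerms) (T := n * 4 + 9)
    (fun j => StoresEdges K n (E ++ (P.termSets k).take j)) (by simp) ?_ ?_ ?_ ?_ ?_).mono le_rfl
    fun _ h => h
  · intro j x m' h
    exact h.congr (m'.withVar_nat_of_ne _ (by omega)) (m'.withVar_nat_of_ne _ (by omega))
      (m'.withVar_nat_of_ne _ (by omega))
  · intro j m' hf _
    have h2 := hf.nat 2 (by simp)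
    simp [h2, hin 2 (by omega) (by omega), inputMemory]
  · simpa using hE
  · intro j m' hj hv hf hI
    set e := Problem.qubitSet ((P.ham k).supp ⟨j, hj⟩) with he
    have hlen : (P.termSets k).length = (P.ham k).numTerms := by simp [Problem.termSets]
    have hget : (P.termSets k)[j]? = some e := by
      rw [List.getElem?_eq_getElem (by omega)]
      simp [Problem.termSets, he]
    rw [List.take_add_one, hget, ← List.append_assoc]
    set E' := E ++ (P.termSets k).take j with hE'
    have hrow : ∀ q, m.nat (k + 3) j q = if q ∈ e then 1 else 0 := by
      intro q
      rw [hin _ (by omega) (by omega)]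
      simp only [inputMemory]
      refine if_congr ?_ rfl rfl
      constructor
      · rintro ⟨_, _, hq, h⟩
        exact Problem.val_mem_qubitSet.mpr h
      · intro h
        have hq := Problem.lt_of_mem_qubitSet h
        exact ⟨k.2, hj, hq, Problem.val_mem_qubitSet.mp h⟩
    refine (Terminates.seq (T := (n + 1) * (1 + 3) + 3) (T' := 1) ?_).mono (by ring_nf; omega)
      fun _ h => h
    -- The extra column n is copied as well. The input contains zero there, in accordance with the
    -- fact that no term contains the starting position.
    refine Terminates.forTo (N := n + 1) (fun q m'' => m''.nat (K + 6) = fun r c =>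
      if r = E'.length ∧ c < q then (if c ∈ e then 1 else 0) else m'.nat (K + 6) r c)
      (by simp) ?_ ?_ ?_ ?_ ?_
    · intro i x m'' h
      rw [m''.withVar_nat_of_ne x (by omega), h]
    · intro i m'' hf' _
      simp [hf'.nat (K + 3) (by simp), hI.qubits]
    · simp
    · intro q m'' hq hv' hf' hI'
      refine .setNat ?_
      have e5 := hf'.nat (K + 5) (by simp)
      have e13 := hf'.nat (K + 13) (by simp)
      have ek := (hf'.nat (k + 3) (by simp; omega)).trans (hf.nat (k + 3) (by simp; omega))
      simp only [NatExpr.eval_natVar, NatExpr.eval_cell, e5, e13, ek, hv, hv', hI.count,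
        store_self, hrow, hI']
      funext r c
      by_cases h1 : r = E'.length
      · by_cases h2 : c = q
        · simp [h1, h2]
        · have : c < q ↔ c < q + 1 := by omega
          simp [h1, h2, this]
      · simp [h1]
    · intro m'' hf' hI'
      refine .assign ?_
      have e5 := hf'.nat (K + 5) (by simp)
      refine storesEdges_append hI ?_ ?_ ?_
      · rw [Memory.withVar_nat_of_ne _ _ (by omega), hf'.nat _ (by simp)]
      · rw [Memory.withVar_nat_self]
        simp [e5, hI.count]
      · intro r q hq
        rw [Memory.withVar_nat_of_ne _ _ (by omega), hI']
        have : q < n + 1 := by omega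
        simp [this]
  · intro m' _ h
    have hlen : (P.termSets k).length = (P.ham k).numTerms := by simp [Problem.termSets]
    rwa [← hlen, List.take_length] at h

lemma terminates_mergeHams {B : ℕ} (hB : ∀ k, (P.ham k).numTerms ≤ B) (hE : StoresEdges K n E m)
    (hin : ∀ a, 1 ≤ a → a < K + 3 → m.nat a = (inputMemory P ε).nat a) (k : ℕ) (hk : k ≤ K) :
    Terminates (mergeHams K k) (k * (B * (n * 4 + 12) + 4) + 1) m
      (StoresEdges K n (E ++ ((List.finRange K).take k).flatMap P.termSets)) := by
  induction k with
  | zero => exact (Terminates.skip (by simpa using hE)).mono (by omega) fun _ h => h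
  | succ k ih =>
    refine (Terminates.seq ((ih (by omega)).frame.imp ?_)).mono
      (T := k * (B * (n * 4 + 12) + 4) + 1 + (B * (n * 4 + 12) + 3) + 1) (by ring_nf; omega)
      fun _ h => h
    rintro m' ⟨hI, hf⟩
    have hget : (List.finRange K)[k]? = some ⟨k, hk⟩ := by
      rw [List.getElem?_eq_getElem (by simpa using hk)]
      simp
    rw [List.take_add_one, hget, List.flatMap_append, ← List.append_assoc]
    have := terminates_mergeTerms (P := P) (ε := ε) ⟨k, hk⟩ hI ?_
    · refine this.mono ?_ fun _ h => by simpa using h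
      have := hB ⟨k, hk⟩
      gcongr
    · intro a h1 h2
      rw [hf.nat a fun h => by have := writesNat_mergeHams h; omega]
      exact hin a h1 h2

lemma terminates_mergeEdges {B : ℕ} (hB : ∀ k, (P.ham k).numTerms ≤ B)
    (hn : m.nat (K + 3) 0 0 = n)
    (hin : ∀ a, 1 ≤ a → a < K + 3 → m.nat a = (inputMemory P ε).nat a) :
    Terminates (mergeEdges K) (n * 4 + K * (B * (n * 4 + 12) + 4) + 9) m
      (StoresEdges K n P.edges) := by
  refine (Terminates.seq (T := n * (1 + 3) + 3) (T' := K * (B * (n * 4 + 12) + 4) + 5) ?_).mono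
    (by ring_nf; omega) fun _ h => h
  refine Terminates.forTo (N := n) (fun q m' => ∀ c < q, m'.nat (K + 6) 0 c =
    (inputMemory P ε).nat 1 0 c) (by simp) ?_ ?_ ?_ ?_ ?_
  · intro i x m' h
    rw [m'.withVar_nat_of_ne x (by omega)]
    exact h
  · intro i m' hf _
    simp [hf.nat (K + 3) (by simp), hn]
  · simp
  · intro q m' hq hv hf hI
    refine .setNat ?_
    have e1 := hf.nat 1 (by simp)
    intro c hc
    simp only [NatExpr.eval_natVar, NatExpr.eval_cell, NatExpr.eval_lit, hv, e1, store_self,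
      hin 1 (by omega) (by omega), true_and]
    by_cases h : c = q
    · simp [h]
    · rw [if_neg h]; exact hI c (by omega)
  · intro m₁ hf₁ hI₁
    have e3 := hf₁.nat (K + 3) (by simp)
    have hin₁ : ∀ a, 1 ≤ a → a < K + 3 → m₁.nat a = (inputMemory P ε).nat a := fun a h1 h2 => by
      rw [hf₁.nat a (by simp; omega), hin a h1 h2]
    refine Terminates.seq_of_le (T := 1) (T' := K * (B * (n * 4 + 12) + 4) + 3) (.setNat
      (Terminates.seq_of_le (T := 1) (T' := K * (B * (n * 4 + 12) + 4) + 1) (.assign ?_)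
        (by omega))) (by omega)
    -- Row 0 now holds the observable together with the entry 1 in column n, which is the first
    -- edge.
    · have := terminates_mergeHams (P := P) (ε := ε) (E := [insert n (Problem.qubitSet P.obsSupp)]) hB
        (m := (⟨store m₁.nat (K + 6) ((NatExpr.lit 0).eval m₁) ((natVar (K + 3)).eval m₁)
          ((NatExpr.lit 1).eval m₁), m₁.real⟩ : Memory).withVar (K + 5) 1) ?_ ?_ K le_rfl
      · refine this.mono le_rfl fun _ h => ?_
        rw [List.take_of_length_le (by simp)] at h
        exact h
      · refine ⟨?_, ?_, ?_⟩
        · rw [Memory.withVar_nat_of_ne _ _ (by omega)]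
          simp only [store_of_ne _ _ _ _ (show K + 3 ≠ K + 6 by omega), e3, hn]
        · rw [Memory.withVar_nat_self]; rfl
        · intro r e he q hq
          have hr : r = 0 := by
            by_contra h
            simp [h] at he
          have he' : e = insert n (Problem.qubitSet P.obsSupp) := by simpa [hr] using he.symm
          rw [Memory.withVar_nat_of_ne _ _ (by omega)]
          simp only [store_self, NatExpr.eval_lit, NatExpr.eval_natVar, e3, hn, hr, he', true_and]
          by_cases hqn : q = n
          · simp [hqn]
          · have hq' : q < n := by omega
            rw [if_neg hqn, hI₁ q hq']
            simp only [inputMemory]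
            refine if_congr ?_ rfl rfl
            rw [Finset.mem_insert]
            constructor
            · rintro ⟨h1, h2⟩
              exact Or.inr (Problem.val_mem_qubitSet.mpr h2)
            · rintro (h | h)
              · exact absurd h hqn
              · exact ⟨hq', Problem.val_mem_qubitSet.mp h⟩
      · intro a h1 h2
        rw [Memory.withVar_nat_of_ne _ _ (by omega)]
        exact (store_of_ne _ _ _ _ (by omega)).trans (hin₁ a h1 h2)

end Merge

/-! ## Logarithms and roundings -/

/-- Store `a w + b` in the variable `K + 7`, where `2 ^ w` is at least the number of qubits over
the accuracy. -/
def computeRounds (K a b : ℕ) : Program :=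
  .seq (.assignReal 3 (.lit 1)) (.seq (.assign (K + 7) (.lit b))
    (.loop (.neg (.realLE (.div (.ofNat (natVar (K + 3))) (realVar 2)) (realVar 3)))
      (.seq (.assignReal 3 (.add (realVar 3) (realVar 3)))
        (.assign (K + 7) (.add (natVar (K + 7)) (.lit a))))))

/-- Repeated doubling replaces the logarithm. The upper bound on 2^w keeps everything exponential in
w polynomial in n/ε; initially it holds because n/ε ≥ 2, and afterwards because doubling continues
only below n/ε. -/
lemma terminates_computeRounds {K a b n : ℕ} {ε : ℝ} {m : Memory} (hn : m.nat (K + 3) 0 0 = n)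
    (hε : m.real 2 0 0 = ε) (hx : 2 ≤ n / ε) :
    Terminates (computeRounds K a b) (⌈n / ε⌉₊ * 4 + 5) m fun m' =>
      ∃ w : ℕ, m'.nat (K + 7) 0 0 = a * w + b ∧ n / ε ≤ 2 ^ w ∧ (2 : ℝ) ^ w ≤ 2 * (n / ε) := by
  refine Terminates.seq_of_le (T := 1) (T' := ⌈n / ε⌉₊ * 4 + 3) (.setReal (Terminates.seq_of_le
    (T := 1) (T' := ⌈n / ε⌉₊ * 4 + 1) (.assign ?_) (by omega))) (by omega)
  refine (Terminates.loop (T := 3) (i := 0) (fun j m' => m'.nat (K + 7) 0 0 = a * j + b ∧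
    m'.real 3 0 0 = 2 ^ j ∧ (2 : ℝ) ^ j ≤ 2 * (n / ε) ∧ m'.nat (K + 3) 0 0 = n ∧ m'.real 2 0 0 = ε)
    ⌈n / ε⌉₊ ?_ (Nat.zero_le _) ?_ ?_).mono (by omega) fun _ h => h
  · refine ⟨?_, ?_, ?_, ?_, ?_⟩
    · simp [Memory.withVar_nat_self]
    · simp [Memory.withVar_real, store]
    · simp; linarith
    · rw [Memory.withVar_nat_of_ne _ _ (by omega)]; exact hn
    · simpa [Memory.withVar_real, store] using hε
  · rintro j m' _ ⟨h1, h2, h3, h4, h5⟩ hb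
    have hb' : (2 : ℝ) ^ j < n / ε := by simpa [h2, h4, h5] using hb
    -- By j < 2^j, a crude bound on the number of rounds suffices.
    have hj : j < ⌈n / ε⌉₊ := by
      rw [Nat.lt_ceil]
      exact lt_of_lt_of_le (by exact_mod_cast Nat.lt_two_pow_self) hb'.le
    refine ⟨hj, Terminates.seq (T := 1) (T' := 1) (.setReal (.assign ⟨?_, ?_, ?_, ?_, ?_⟩))⟩
    · rw [Memory.withVar_nat_self]
      simp [h1]; ring
    · simp [Memory.withVar_real, store, h2, pow_succ]; ring
    · rw [pow_succ]; linarith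
    · rw [Memory.withVar_nat_of_ne _ _ (by omega)]; exact h4
    · simpa [Memory.withVar_real, store] using h5
  · rintro j m' _ ⟨h1, h2, h3, h4, h5⟩ hb
    have hb' : n / ε ≤ (2 : ℝ) ^ j := by simpa [h2, h4, h5] using hb
    exact ⟨j, h1, hb', h3⟩

/-- Store the least natural number that is not below a real number. -/
def ceilInto (v : ℕ) (e : RealExpr) : Program :=
  .seq (.assign v (.lit 0)) (.loop (.neg (.realLE e (.ofNat (natVar v))))
    (.assign v (.add (natVar v) (.lit 1))))

/-- The ceiling is found by counting upwards, as there is no instruction that rounds reals. Hence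
`he` asks that the expression not depend on the counter, and the cost is linear in the value. -/
lemma terminates_ceilInto {v : ℕ} {e : RealExpr} {m : Memory} {B : ℝ}
    (he : ∀ x, e.eval (m.withVar v x) = B) {Q : Memory → Prop} (hQ : Q (m.withVar v ⌈B⌉₊)) :
    Terminates (ceilInto v e) (⌈B⌉₊ * 2 + 3) m Q := by
  have hww : ∀ x y, (m.withVar v x).withVar v y = m.withVar v y := by
    intro x y
    simp only [Memory.withVar, Memory.mk.injEq, and_true]
    funext a r c
    simp only [store]
    split_ifs <;> rfl
  refine (Terminates.seq (T := 1) (T' := ⌈B⌉₊ * 2 + 1) (.assign ?_)).mono (by omega) fun _ h => h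
  refine (Terminates.loop (T := 1) (i := 0) (fun j m' => m' = m.withVar v j ∧ j ≤ ⌈B⌉₊) ⌈B⌉₊
    ⟨rfl, Nat.zero_le _⟩ (Nat.zero_le _) ?_ ?_).mono (by omega) fun _ h => h
  · rintro j m' _ ⟨rfl, h⟩ hb
    have hb' : (j : ℝ) < B := by simpa [he, Memory.withVar_nat_self] using hb
    have hj : j < ⌈B⌉₊ := Nat.lt_ceil.mpr hb'
    refine ⟨hj, .assign ⟨?_, hj⟩⟩
    rw [hww]
    simp [Memory.withVar_nat_self]
  · rintro j m' _ ⟨rfl, h⟩ hb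
    have hb' : B ≤ (j : ℝ) := by simpa [he, Memory.withVar_nat_self] using hb
    have : j = ⌈B⌉₊ := le_antisymm h (Nat.ceil_le.mpr hb')
    rwa [this]

/-! ## The initial list of Pauli strings -/

/-- Store the list that consists of the identity at the position outside of the qubits. -/
def initList (K : ℕ) : Program :=
  .seq (.forTo (K + 14) (natVar (K + 3)) (.setNat 1 (.lit 0) (natVar (K + 14)) (.lit 0)))
  (.seq (.assign (K + 9) (natVar (K + 3))) (.assign (K + 8) (.lit 1)))

lemma terminates_initList {K n : ℕ} {m : Memory} (hn : m.nat (K + 3) 0 0 = n) :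
    Terminates (initList K) (n * 4 + 7) m (StoresList K n [(fun _ => 0, n)]) := by
  refine (Terminates.seq (T := n * (1 + 3) + 3) (T' := 3) ?_).mono (by omega) fun _ h => h
  refine Terminates.forTo (N := n) (fun q m' => ∀ c < q, m'.nat 1 0 c = 0) (by simp) ?_ ?_ ?_ ?_ ?_
  · intro i x m' h
    rw [m'.withVar_nat_of_ne x (by omega)]
    exact h
  · intro i m' hf _
    simp [hf.nat (K + 3) (by simp), hn]
  · simp
  · intro q m' hq hv hf hI
    refine .setNat fun c hc => ?_
    simp only [NatExpr.eval_natVar, NatExpr.eval_lit, hv, store_self, true_and]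
    by_cases h : c = q
    · simp [h]
    · rw [if_neg h]; exact hI c (by omega)
  · intro m₁ hf hI
    refine Terminates.seq (T := 1) (T' := 1) (.assign (.assign ⟨?_, ?_, ?_⟩))
    · rw [Memory.withVar_nat_self]; rfl
    · intro i x hx
      have hi : i = 0 := by by_contra h; simp [h] at hx
      have hx' : x = (fun _ => 0, n) := by simpa [hi] using hx.symm
      rw [Memory.withVar_nat_of_ne _ _ (by omega), hi, Memory.withVar_nat_self, hx']
      simp [hf.nat (K + 3) (by simp), hn]
    · intro i x hx q hq
      have hi : i = 0 := by by_contra h; simp [h] at hx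
      have hx' : x = (fun _ => 0, n) := by simpa [hi] using hx.symm
      rw [Memory.withVar_nat_of_ne _ _ (by omega), Memory.withVar_nat_of_ne _ _ (by omega), hi, hx']
      exact hI q hq

end HVClassifier
end
noncomputable section
namespace HVClassifier

/-! ## Estimation of the Pauli expectation values -/

/-- The clipping in `coin` is inactive because Pauli expectations lie in [-1, 1]. -/
lemma expect_born {n : ℕ} (p : ℕ → ℕ) (φ : PureState n) (f : Bool → ENNReal) :
    expect (born (pauliString n p) φ) f =
      ENNReal.ofReal ((1 + expectation (pauliString n p) φ) / 2) * f true +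
        ENNReal.ofReal ((1 - expectation (pauliString n p) φ) / 2) * f false := by
  have h := abs_le.mp (abs_expectation_pauliString_le p φ)
  have h1 : ∀ e : ℝ, -1 ≤ e → e ≤ 1 → max 0 (min 1 ((1 + e) / 2)) = (1 + e) / 2 := by
    intro e h1 h2
    rw [min_eq_right (by linarith), max_eq_right (by linarith)]
  rw [expect, tsum_fintype, Fintype.sum_bool]
  simp only [born, coin, PMF.ofFintype_apply, cond_true, cond_false, h1 _ h.1 h.2]
  congr 3
  ring

open Classical in
/-- The value `v` under the condition `c`, and `∞` otherwise. -/
def guarded (c : Prop) (v : ℝ) : ENNReal := if c then ENNReal.ofReal v else ⊤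

lemma guarded_of {c : Prop} (h : c) (v : ℝ) : guarded c v = ENNReal.ofReal v := if_pos h

lemma of_guarded_ne_top {c : Prop} {v : ℝ} (h : guarded c v ≠ ⊤) : c := by
  by_contra hc
  exact h (if_neg hc)

lemma guarded_le {c c' : Prop} {v v' : ℝ} (h : c → c' ∧ v' ≤ v) : guarded c' v' ≤ guarded c v := by
  by_cases hc : c
  · rw [guarded_of hc, guarded_of (h hc).1]
    exact ENNReal.ofReal_le_ofReal (h hc).2
  · rw [guarded, guarded, if_neg hc]
    exact le_top

/-- Measure the Pauli operator `K + 20` on the state `K + 19` and add the outcome to an entry of the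
real array `5`. -/
def measureOnce (K : ℕ) : Program :=
  .seq (.measure (natVar (K + 19)) 1 (natVar (K + 20)) 6 (.lit 0) (.lit 0))
    (.setReal 5 (natVar (K + 19)) (natVar (K + 20))
      (.add (.cell 5 (natVar (K + 19)) (natVar (K + 20))) (realVar 6)))

/-- Sum the outcomes of repeated measurements. -/
def measureEntry (K : ℕ) : Program :=
  .seq (.setReal 5 (natVar (K + 19)) (natVar (K + 20)) (.lit 0))
    (.forTo (K + 21) (natVar (K + 17)) (measureOnce K))

/-- Measure all Pauli operators of the list on all states. -/
def measureAll (K : ℕ) : Program :=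
  .forTo (K + 19) (natVar (K + 4)) (.forTo (K + 20) (natVar (K + 8)) (measureEntry K))

/-- The memory `m` agrees with `m₀` up to the arrays that are used for the measurements. -/
structure MeasureFrame (K : ℕ) (m₀ m : Memory) : Prop where
  nat : ∀ a, a ≠ K + 19 → a ≠ K + 20 → a ≠ K + 21 → m.nat a = m₀.nat a
  real : ∀ a, a ≠ 5 → a ≠ 6 → m.real a = m₀.real a

section Measure

variable {n N K : ℕ} {Φ : Fin N → PureState n} {m₀ : Memory} {M S : ℕ}

/-- The expectation value of the `j`-th Pauli operator in the state `i`. -/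
def pauliMean (Φ : Fin N → PureState n) (m₀ : Memory) (i j : ℕ) : ℝ :=
  if h : i < N then expectation (pauliString n (m₀.nat 1 j)) (Φ ⟨i, h⟩) else 0

/-- The sum of the squared errors of the estimates over a set of entries. -/
def sqError (Φ : Fin N → PureState n) (m₀ : Memory) (S : ℕ) (s : Finset (ℕ × ℕ)) (m : Memory) : ℝ :=
  ∑ p ∈ s, (m.real 5 p.1 p.2 / S - pauliMean Φ m₀ p.1 p.2) ^ 2

/-- The frame condition, the values of the counters and the bounds of the estimates. -/
structure MeasureInv (K : ℕ) (m₀ : Memory) (S : ℕ) (s : Finset (ℕ × ℕ)) (m : Memory) : Prop where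
  frame : MeasureFrame K m₀ m
  bound : ∀ p ∈ s, |m.real 5 p.1 p.2| ≤ S

lemma sqError_nonneg (s : Finset (ℕ × ℕ)) (m : Memory) : 0 ≤ sqError Φ m₀ S s m :=
  Finset.sum_nonneg fun _ _ => sq_nonneg _

lemma sqError_congr {s : Finset (ℕ × ℕ)} {m m' : Memory}
    (h : ∀ p ∈ s, m'.real 5 p.1 p.2 = m.real 5 p.1 p.2) :
    sqError Φ m₀ S s m' = sqError Φ m₀ S s m :=
  Finset.sum_congr rfl fun p hp => by rw [h p hp]

lemma MeasureFrame.withVar {m : Memory} (h : MeasureFrame K m₀ m) {v x : ℕ}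
    (hv : v = K + 19 ∨ v = K + 20 ∨ v = K + 21) : MeasureFrame K m₀ (m.withVar v x) :=
  ⟨fun a h1 h2 h3 => by rw [m.withVar_nat_of_ne x (by omega), h.nat a h1 h2 h3], h.real⟩

lemma MeasureInv.withVar {m : Memory} {s : Finset (ℕ × ℕ)} (h : MeasureInv K m₀ S s m) {v x : ℕ}
    (hv : v = K + 19 ∨ v = K + 20 ∨ v = K + 21) : MeasureInv K m₀ S s (m.withVar v x) :=
  ⟨h.frame.withVar hv, h.bound⟩

lemma store_real_five_of_ne (m : ℕ → ℕ → ℕ → ℝ) {i j : ℕ} (v : ℝ) {p : ℕ × ℕ} (h : p ≠ (i, j)) :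
    store m 5 i j v 5 p.1 p.2 = m 5 p.1 p.2 := by
  have : ¬ (p.1 = i ∧ p.2 = j) := fun h' => h (Prod.ext h'.1 h'.2)
  simp [store, this]

/-- If μ is the mean of one ±1 outcome, one more measurement raises the expectation of (sum - rμ)²
by 1 - μ² ≤ 1. The decrease of S - r by one pays for it. The constant c carries the budget of
entries still to be measured. -/
lemma hoare_measureOnce {i j r : ℕ} (hi : i < N) {s : Finset (ℕ × ℕ)} (hs : (i, j) ∉ s) {c : ℝ}
    (hc : 0 ≤ c) (hrS : r < S) :
    Hoare Φ (fun m => guarded (MeasureInv K m₀ S s m ∧ m.nat (K + 19) 0 0 = i ∧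
        m.nat (K + 20) 0 0 = j ∧ m.nat (K + 21) 0 0 = r ∧ |m.real 5 i j| ≤ r)
        (sqError Φ m₀ S s m + c + ((m.real 5 i j - r * pauliMean Φ m₀ i j) ^ 2 + (S - r)) / S ^ 2))
      (measureOnce K) (n + 3)
      (fun m => guarded (MeasureInv K m₀ S s m ∧ m.nat (K + 19) 0 0 = i ∧
        m.nat (K + 20) 0 0 = j ∧ m.nat (K + 21) 0 0 = r ∧ |m.real 5 i j| ≤ (r + 1 : ℕ))
        (sqError Φ m₀ S s m + c +
          ((m.real 5 i j - (r + 1 : ℕ) * pauliMean Φ m₀ i j) ^ 2 + (S - (r + 1 : ℕ))) / S ^ 2)) := by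
  refine (Hoare.seq (S := n + 1) (T := 1) (Hoare.measure ?_) Hoare.setReal).mono (fun _ => le_rfl)
    (fun _ => le_rfl) le_rfl
  intro m hm
  obtain ⟨hinv, h19, h20, h21, hacc⟩ := of_guarded_ne_top hm
  have hi' : (natVar (K + 19)).eval m < N := by simpa [h19] using hi
  refine ⟨hi', ?_⟩
  have hstr : m.nat 1 = m₀.nat 1 := hinv.frame.nat 1 (by omega) (by omega) (by omega)
  have hmean : expectation (pauliString n (m.nat 1 ((natVar (K + 20)).eval m)))
      (Φ ⟨(natVar (K + 19)).eval m, hi'⟩) = pauliMean Φ m₀ i j := by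
    simp only [pauliMean, dif_pos hi, NatExpr.eval_natVar, h19, h20, hstr]
  rw [expect_born, hmean]
  set e := pauliMean Φ m₀ i j with he
  have hebound : |e| ≤ 1 := by
    rw [← hmean]; exact abs_expectation_pauliString_le _ _
  obtain ⟨he1, he2⟩ := abs_le.mp hebound
  set a := m.real 5 i j with ha
  have hS : (0 : ℝ) < S := by exact_mod_cast (Nat.zero_le r).trans_lt hrS
  have key : ∀ o : ℝ, |o| = 1 →
      (fun m => guarded (MeasureInv K m₀ S s m ∧ m.nat (K + 19) 0 0 = i ∧
        m.nat (K + 20) 0 0 = j ∧ m.nat (K + 21) 0 0 = r ∧ |m.real 5 i j| ≤ (r + 1 : ℕ))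
        (sqError Φ m₀ S s m + c +
          ((m.real 5 i j - (r + 1 : ℕ) * e) ^ 2 + (S - (r + 1 : ℕ))) / S ^ 2))
        (⟨m.nat, store (store m.real 6 0 0 o) 5 i j (a + o)⟩ : Memory) =
      ENNReal.ofReal (sqError Φ m₀ S s m + c +
          ((a + o - (r + 1 : ℕ) * e) ^ 2 + (S - (r + 1 : ℕ))) / S ^ 2) := by
    intro o ho
    have hself : store (store m.real 6 0 0 o) 5 i j (a + o) 5 i j = a + o := by simp [store]
    have hother : ∀ p ∈ s, store (store m.real 6 0 0 o) 5 i j (a + o) 5 p.1 p.2 =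
        m.real 5 p.1 p.2 := by
      intro p hp
      rw [store_real_five_of_ne _ _ fun h => hs (h ▸ hp), store_of_ne _ _ _ _ (by omega)]
    have hsq : sqError Φ m₀ S s (⟨m.nat, store (store m.real 6 0 0 o) 5 i j (a + o)⟩ : Memory) =
        sqError Φ m₀ S s m := sqError_congr hother
    refine (guarded_of (c := _ ∧ _) ⟨⟨⟨hinv.frame.nat, fun b h1 h2 => ?_⟩, fun p hp => ?_⟩,
      h19, h20, h21, ?_⟩ _).trans ?_
    · rw [hsq]
      show ENNReal.ofReal (_ + c + ((store (store m.real 6 0 0 o) 5 i j (a + o) 5 i j - _) ^ 2 + _) /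
        _) = _
      rw [hself]
    · rw [← hinv.frame.real b h1 h2]
      exact (store_of_ne _ _ _ _ h1).trans (store_of_ne _ _ _ _ h2)
    · show |store (store m.real 6 0 0 o) 5 i j (a + o) 5 p.1 p.2| ≤ S
      rw [hother p hp]; exact hinv.bound p hp
    · show |store (store m.real 6 0 0 o) 5 i j (a + o) 5 i j| ≤ _
      rw [hself]
      refine (abs_add_le _ _).trans ?_
      push_cast
      linarith
  have heval : ∀ o : ℝ, (RealExpr.add (.cell 5 (natVar (K + 19)) (natVar (K + 20)))
      (realVar 6)).eval (⟨m.nat, store m.real 6 0 0 o⟩ : Memory) = a + o := by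
    intro o
    simp [h19, h20, store, ha]
  have k1 := key 1 (by simp)
  have k2 := key (-1) (by simp)
  simp only [NatExpr.eval_lit, NatExpr.eval_natVar, if_true, Bool.false_eq_true, if_false, heval, h19,
    h20] at k1 k2 ⊢
  rw [k1, k2, guarded_of ⟨hinv, trivial, trivial, h21, hacc⟩]
  have hrS' : ((r + 1 : ℕ) : ℝ) ≤ S := by exact_mod_cast hrS
  have hD := sqError_nonneg (Φ := Φ) (m₀ := m₀) (S := S) s m
  have hS' : (0 : ℝ) ≤ S - (r + 1 : ℕ) := by linarith
  rw [← ENNReal.ofReal_mul (by linarith), ← ENNReal.ofReal_mul (by linarith),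
    ← ENNReal.ofReal_add (mul_nonneg (by linarith) (by positivity))
      (mul_nonneg (by linarith) (by positivity))]
  refine ENNReal.ofReal_le_ofReal ?_
  set D := sqError Φ m₀ S s m
  have hfin : ((S : ℝ) ^ 2)⁻¹ * ((a - r * e) ^ 2 + (S - r) - e ^ 2) ≤
      ((S : ℝ) ^ 2)⁻¹ * ((a - r * e) ^ 2 + (S - r)) := by
    gcongr
    linarith [sq_nonneg e]
  push_cast
  -- Averaging over the two outcomes removes the cross term and leaves the variance 1 - e².
  have : (1 + e) / 2 * (D + c + ((a + 1 - (r + 1) * e) ^ 2 + (S - (r + 1))) / S ^ 2) +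
      (1 - e) / 2 * (D + c + ((a + -1 - (r + 1) * e) ^ 2 + (S - (r + 1))) / S ^ 2) =
      D + c + ((S : ℝ) ^ 2)⁻¹ * ((a - r * e) ^ 2 + (S - r) - e ^ 2) := by
    rw [div_eq_mul_inv (_ + _) ((S : ℝ) ^ 2), div_eq_mul_inv (_ + _) ((S : ℝ) ^ 2)]
    ring
  rw [this, div_eq_inv_mul ((a - r * e) ^ 2 + (S - r))]
  linarith

/-- At r = 0 the potential is S/S² = 1/S, and at r = S it is the squared error of the empirical
mean. The bound on the sum by S makes every estimate lie in [-1, 1]. -/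
lemma hoare_measureEntry {i j : ℕ} (hi : i < N) {s : Finset (ℕ × ℕ)} (hs : (i, j) ∉ s) {c : ℝ}
    (hc : 0 ≤ c) (hS : 0 < S) (h17 : m₀.nat (K + 17) 0 0 = S) :
    Hoare Φ (fun m => guarded (MeasureInv K m₀ S s m ∧ m.nat (K + 19) 0 0 = i ∧
        m.nat (K + 20) 0 0 = j) (sqError Φ m₀ S s m + c + 1 / S))
      (measureEntry K) (S * (n + 6) + 5)
      (fun m => guarded (MeasureInv K m₀ S (insert (i, j) s) m ∧ m.nat (K + 19) 0 0 = i ∧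
        m.nat (K + 20) 0 0 = j) (sqError Φ m₀ S (insert (i, j) s) m + c)) := by
  have hS' : (0 : ℝ) < S := by exact_mod_cast hS
  set I : ℕ → Memory → ENNReal := fun r m => guarded (MeasureInv K m₀ S s m ∧
    m.nat (K + 19) 0 0 = i ∧ m.nat (K + 20) 0 0 = j ∧ |m.real 5 i j| ≤ r)
    (sqError Φ m₀ S s m + c + ((m.real 5 i j - r * pauliMean Φ m₀ i j) ^ 2 + (S - r)) / S ^ 2)
    with hI
  refine (Hoare.seq (S := 1) (T := S * (n + 3 + 3) + 3) (B := I 0) ?_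
    (Hoare.forTo (R := S) I ?_ ?_ ?_ (fun _ => le_rfl) ?_)).mono (fun _ => le_rfl)
    (fun _ => le_rfl) (by ring_nf; omega)
  · refine Hoare.of_terminates fun m hm => .setReal ?_
    obtain ⟨hinv, h19, h20⟩ := of_guarded_ne_top hm
    refine guarded_le fun _ => ?_
    simp only [NatExpr.eval_natVar, h19, h20, RealExpr.eval_lit]
    have hself : store m.real 5 i j ((0 : ℚ) : ℝ) 5 i j = 0 := by simp [store]
    have hother : ∀ p ∈ s, store m.real 5 i j ((0 : ℚ) : ℝ) 5 p.1 p.2 = m.real 5 p.1 p.2 :=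
      fun p hp => store_real_five_of_ne _ _ fun h => hs (h ▸ hp)
    refine ⟨⟨⟨⟨hinv.frame.nat, fun b h1 h2 => ?_⟩, fun p hp => ?_⟩, trivial, trivial, ?_⟩, ?_⟩
    · rw [← hinv.frame.real b h1 h2]
      exact store_of_ne _ _ _ _ h1
    · show |store m.real 5 i j ((0 : ℚ) : ℝ) 5 p.1 p.2| ≤ S
      rw [hother p hp]; exact hinv.bound p hp
    · rw [hself]; simp
    · rw [hself, sqError_congr (m := m) (m' := ⟨m.nat, _⟩) hother]
      refine le_of_eq ?_
      congr 1
      push_cast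
      field_simp
      ring
  · intro r x m
    refine guarded_le ?_
    rintro ⟨h1, h2, h3, h4⟩
    refine ⟨⟨h1.withVar (by omega), ?_, ?_, h4⟩, le_rfl⟩
    · rw [m.withVar_nat_of_ne x (by omega)]; exact h2
    · rw [m.withVar_nat_of_ne x (by omega)]; exact h3
  · intro r m hm
    obtain ⟨h1, _⟩ := of_guarded_ne_top hm
    rw [NatExpr.eval_natVar, h1.frame.nat _ (by omega) (by omega) (by omega), h17]
  · intro r hr
    refine (hoare_measureOnce (Φ := Φ) (K := K) (m₀ := m₀) hi hs hc hr).mono (fun m => ?_)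
      (fun m => ?_) le_rfl
    · by_cases hv : m.nat (K + 21) 0 0 = r
      · rw [if_pos hv]
        exact guarded_le fun ⟨h1, h2, h3, h4⟩ => ⟨⟨h1, h2, h3, hv, h4⟩, le_rfl⟩
      · rw [if_neg hv]; exact le_top
    · by_cases hv : m.nat (K + 21) 0 0 = r
      · rw [if_pos hv]
        exact guarded_le fun ⟨h1, h2, h3, _, h4⟩ => ⟨⟨h1, h2, h3, h4⟩, le_rfl⟩
      · rw [if_neg hv, guarded, if_neg fun h => hv h.2.2.2.1]
  · intro m
    refine guarded_le ?_
    rintro ⟨h1, h2, h3, h4⟩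
    refine ⟨⟨⟨h1.frame, fun p hp => ?_⟩, h2, h3⟩, le_of_eq ?_⟩
    · rcases Finset.mem_insert.mp hp with rfl | hp
      · exact h4
      · exact h1.bound p hp
    · rw [sqError, Finset.sum_insert hs, sqError]
      field_simp
      ring

/-- Each of the N M entries has variance at most 1/S. No independence argument is needed, since the
budget 1/S of each entry is spent when that entry is measured. -/
lemma hoare_measureAll {M : ℕ} (hS : 0 < S) (h17 : m₀.nat (K + 17) 0 0 = S)
    (h4 : m₀.nat (K + 4) 0 0 = N) (h8 : m₀.nat (K + 8) 0 0 = M) :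
    Hoare Φ (fun m => guarded (m = m₀) (N * M / S)) (measureAll K)
      (N * (M * (S * (n + 6) + 8) + 6) + 3)
      (fun m => guarded (MeasureInv K m₀ S (Finset.range N ×ˢ Finset.range M) m)
        (sqError Φ m₀ S (Finset.range N ×ˢ Finset.range M) m)) := by
  have hS' : (0 : ℝ) < S := by exact_mod_cast hS
  -- The entries finished when entry (i, j) is about to be measured.
  set s : ℕ → ℕ → Finset (ℕ × ℕ) := fun i j =>
    Finset.range i ×ˢ Finset.range M ∪ {i} ×ˢ Finset.range j with hs
  have hs0 : ∀ i, s i 0 = Finset.range i ×ˢ Finset.range M := by intro i; simp [hs]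
  have hsM : ∀ i, s i M = Finset.range (i + 1) ×ˢ Finset.range M := by
    intro i
    ext ⟨a, b⟩
    simp only [hs, Finset.mem_union, Finset.mem_product, Finset.mem_range, Finset.mem_singleton]
    constructor
    · rintro (⟨h1, h2⟩ | ⟨h1, h2⟩)
      · exact ⟨by omega, h2⟩
      · exact ⟨by omega, h2⟩
    · rintro ⟨h1, h2⟩
      by_cases h : a = i
      · exact Or.inr ⟨h, h2⟩
      · exact Or.inl ⟨by omega, h2⟩
  have hsucc : ∀ i j, s i (j + 1) = insert (i, j) (s i j) := by
    intro i j
    ext ⟨a, b⟩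
    simp only [hs, Finset.mem_union, Finset.mem_product, Finset.mem_range, Finset.mem_singleton,
      Finset.mem_insert, Prod.mk.injEq]
    constructor
    · rintro (h | ⟨h1, h2⟩)
      · exact Or.inr (Or.inl h)
      · by_cases h : b = j
        · exact Or.inl ⟨h1, h⟩
        · exact Or.inr (Or.inr ⟨h1, by omega⟩)
    · rintro (⟨h1, h2⟩ | h | ⟨h1, h2⟩)
      · exact Or.inr ⟨h1, by omega⟩
      · exact Or.inl h
      · exact Or.inr ⟨h1, by omega⟩
  have hnot : ∀ i j, (i, j) ∉ s i j := by intro i j; simp [hs]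
  set I : ℕ → Memory → ENNReal := fun i m => guarded (MeasureInv K m₀ S (s i 0) m)
    (sqError Φ m₀ S (s i 0) m + (N - i) * M / S) with hI
  refine (Hoare.forTo (R := N) (T := M * (S * (n + 6) + 5 + 3) + 3) I ?_ ?_ ?_ ?_ ?_).mono
    (fun _ => le_rfl) (fun _ => le_rfl) le_rfl
  · intro i x m
    exact guarded_le fun h => ⟨h.withVar (by omega), le_rfl⟩
  · intro i m hm
    have h1 := of_guarded_ne_top hm
    rw [NatExpr.eval_natVar, h1.frame.nat _ (by omega) (by omega) (by omega), h4]
  · intro i hi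
    have hiN : (0 : ℝ) ≤ N - (i + 1 : ℕ) := by
      rw [sub_nonneg]; exact_mod_cast hi
    set J : ℕ → Memory → ENNReal := fun j m =>
      guarded (MeasureInv K m₀ S (s i j) m ∧ m.nat (K + 19) 0 0 = i)
      (sqError Φ m₀ S (s i j) m + ((N - (i + 1 : ℕ)) * M + (M - j)) / S) with hJ
    refine Hoare.forTo (R := M) (T := S * (n + 6) + 5) J ?_ ?_ ?_ ?_ ?_
    · intro j x m
      refine guarded_le fun ⟨h1, h2⟩ => ⟨⟨h1.withVar (by omega), ?_⟩, le_rfl⟩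
      rw [m.withVar_nat_of_ne x (by omega)]; exact h2
    · intro j m hm
      obtain ⟨h1, _⟩ := of_guarded_ne_top hm
      rw [NatExpr.eval_natVar, h1.frame.nat _ (by omega) (by omega) (by omega), h8]
    · intro j hj
      have hjM : (0 : ℝ) ≤ M - (j + 1 : ℕ) := by
        rw [sub_nonneg]; exact_mod_cast hj
      refine (hoare_measureEntry (Φ := Φ) (K := K) (m₀ := m₀) hi (hnot i j)
        (c := ((N - (i + 1 : ℕ)) * M + (M - (j + 1 : ℕ))) / S) (by positivity) hS h17).mono
        (fun m => ?_) (fun m => ?_) le_rfl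
      · by_cases hv : m.nat (K + 20) 0 0 = j
        · rw [if_pos hv]
          refine guarded_le fun ⟨h1, h2⟩ => ⟨⟨h1, h2, hv⟩, le_of_eq ?_⟩
          push_cast
          field_simp
          ring
        · rw [if_neg hv]; exact le_top
      · by_cases hv : m.nat (K + 20) 0 0 = j
        · rw [if_pos hv]
          simp only [hJ, hsucc]
          exact guarded_le fun ⟨h1, h2, _⟩ => ⟨⟨h1, h2⟩, le_rfl⟩
        · rw [if_neg hv, guarded, if_neg fun h => hv h.2.2]
    · intro m
      by_cases hv : m.nat (K + 19) 0 0 = i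
      · rw [if_pos hv]
        refine guarded_le fun h1 => ⟨⟨h1, hv⟩, le_of_eq ?_⟩
        push_cast
        field_simp
        ring
      · rw [if_neg hv]; exact le_top
    · intro m
      by_cases hv : m.nat (K + 19) 0 0 = i
      · rw [if_pos hv]
        simp only [hI, hs0, ← hsM]
        refine guarded_le fun ⟨h1, _⟩ => ⟨h1, le_of_eq ?_⟩
        rw [sub_self, add_zero]
      · rw [if_neg hv]
        simp only [hJ, guarded]
        rw [if_neg fun h => hv h.2]
  · intro m
    simp only [hI, hs0]
    refine guarded_le ?_
    rintro rfl
    refine ⟨⟨⟨fun _ _ _ _ => rfl, fun _ _ _ => rfl⟩, by simp⟩, le_of_eq ?_⟩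
    simp [sqError]
  · intro m
    simp only [hI, hs0]
    exact guarded_le fun h => ⟨h, by simp⟩

end Measure

end HVClassifier
end
noncomputable section
namespace HVClassifier

/-! ## The program for subgradient descent

The real arrays hold: the sums of the outcomes (`5`), the iterate (`7`), the sum of the iterates
(`8`), the subgradient (`9`), a residual (`10`), the step size (`11`). -/

/-- Assign to the first entries of the row `0` of the real array `a`. -/
def mapRow (K a : ℕ) (e : RealExpr) : Program :=
  .forTo (K + 20) (natVar (K + 8)) (.setReal a (.lit 0) (natVar (K + 20)) e)

/-- The estimate of an expectation value. -/
def estimate (K : ℕ) : RealExpr :=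
  .div (.cell 5 (natVar (K + 19)) (natVar (K + 20))) (.ofNat (natVar (K + 17)))

/-- The current entry of the row `0` of a real array. -/
def entry (K a : ℕ) : RealExpr := .cell a (.lit 0) (natVar (K + 20))

/-- Compute the residual of the data point `K + 19`. -/
def computeResidual (K : ℕ) : Program :=
  .seq (.assignReal 10 (.sub (.lit 0) (.cell 1 (.lit 0) (natVar (K + 19)))))
    (.forTo (K + 20) (natVar (K + 8))
      (.assignReal 10 (.add (realVar 10) (.mul (entry K 7) (estimate K)))))

/-- Add the contribution of the data point `K + 19` to the subgradient. -/
def addSubgrad (K : ℕ) : Program :=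
  .seq (computeResidual K) (.ite (.realLE (.lit 0) (realVar 10))
    (mapRow K 9 (.add (entry K 9) (estimate K))) (mapRow K 9 (.sub (entry K 9) (estimate K))))

/-- One step of subgradient descent. -/
def descentStep (K : ℕ) : Program :=
  .seq (mapRow K 9 (.lit 0)) (.seq (.forTo (K + 19) (natVar (K + 4)) (addSubgrad K))
    (.seq (mapRow K 8 (.add (entry K 8) (entry K 7)))
      (mapRow K 7 (.sub (entry K 7) (.mul (realVar 11) (entry K 9))))))

/-- Subgradient descent and the output of the averaged iterate. -/
def descend (K : ℕ) : Program :=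
  .seq (.assignReal 11 (.div (.div (realVar 4) (.ofNat (natVar (K + 8)))) (.ofNat (natVar (K + 4)))))
  (.seq (mapRow K 7 (.lit 0)) (.seq (mapRow K 8 (.lit 0))
  (.seq (.forTo (K + 22) (natVar (K + 18)) (descentStep K))
  (.seq (mapRow K 0 (.div (entry K 8) (.ofNat (natVar (K + 18)))))
    (.assign 0 (natVar (K + 8)))))))

/-- The data for the regression that are held in the memory. -/
structure StoresData (K N M : ℕ) (z : ℕ → ℕ → ℝ) (y : ℕ → ℝ) (m : Memory) : Prop where
  points : m.nat (K + 4) 0 0 = N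
  features : m.nat (K + 8) 0 0 = M
  estimate : ∀ i < N, ∀ j < M, m.real 5 i j / (m.nat (K + 17) 0 0 : ℝ) = z i j
  label : ∀ i < N, m.real 1 0 i = y i

section Descend

variable {K N M : ℕ} {z : ℕ → ℕ → ℝ} {y : ℕ → ℝ} {m m' : Memory}

lemma StoresData.congr (h : StoresData K N M z y m) (h4 : m'.nat (K + 4) = m.nat (K + 4))
    (h8 : m'.nat (K + 8) = m.nat (K + 8)) (h17 : m'.nat (K + 17) = m.nat (K + 17))
    (h5 : m'.real 5 = m.real 5) (h1 : m'.real 1 = m.real 1) : StoresData K N M z y m' :=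
  ⟨by rw [h4, h.points], by rw [h8, h.features], by rw [h5, h17]; exact h.estimate,
    by rw [h1]; exact h.label⟩

/-- In `he` the target entry still has its old value, which permits updates in place. -/
lemma terminates_mapRow {a : ℕ} {e : RealExpr} {f : ℕ → ℝ} (hM : m.nat (K + 8) 0 0 = M)
    (he : ∀ m' j, j < M → m'.nat (K + 20) 0 0 = j → Framed (mapRow K a e) m m' →
      m'.real a 0 j = m.real a 0 j → e.eval m' = f j) :
    Terminates (mapRow K a e) (M * 4 + 3) m fun m' => ∀ j < M, m'.real a 0 j = f j := by
  refine Terminates.forTo (N := M) (T := 1) (fun i m' => ∀ j < M, m'.real a 0 j =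
    if j < i then f j else m.real a 0 j) (by simp) ?_ ?_ ?_ ?_ ?_
  · intro i x m' h
    exact h
  · intro i m' hf _
    simp [hf.nat (K + 8) (by simp), hM]
  · simp
  · intro i m' hi hv hf hI
    refine .setReal fun j hj => ?_
    rw [he m' i hi hv hf (by simpa using hI i hi)]
    simp only [NatExpr.eval_natVar, NatExpr.eval_lit, hv, store_self, true_and]
    by_cases h : j = i
    · simp [h]
    · have : j < i ↔ j < i + 1 := by omega
      rw [if_neg h, hI j hj]
      simp [this]
  · intro m' _ h j hj
    rw [h j hj, if_pos hj]

lemma StoresData.framed_mapRow {a : ℕ} {e : RealExpr} (h : StoresData K N M z y m)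
    (hf : Framed (mapRow K a e) m m') (h1 : a ≠ 1) (h5 : a ≠ 5) : StoresData K N M z y m' :=
  h.congr (hf.nat _ (by simp [mapRow])) (hf.nat _ (by simp [mapRow])) (hf.nat _ (by simp [mapRow]))
    (hf.real _ (by simp [mapRow]; omega)) (hf.real _ (by simp [mapRow]; omega))

lemma terminates_computeResidual {α : ℕ → ℝ} {i : ℕ} (hD : StoresData K N M z y m)
    (hi : i < N) (hv : m.nat (K + 19) 0 0 = i) (hα : ∀ j < M, m.real 7 0 j = α j) :
    Terminates (computeResidual K) (M * 4 + 5) m fun m' =>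
      m'.real 10 0 0 = residual M z y α i := by
  refine Terminates.seq_of_le (T := 1) (T' := M * (1 + 3) + 3) (.setReal ?_) (by omega)
  refine Terminates.forTo (N := M) (fun r m' => m'.real 10 0 0 =
    ∑ j ∈ Finset.range r, α j * z i j - y i) (by simp) ?_ ?_ ?_ ?_ ?_
  · intro r x m' h
    exact h
  · intro r m' hf _
    simp [hf.nat (K + 8) (by simp), hD.features]
  · simp [store, hv, hD.label i hi]
  · intro r m' hr hv' hf hI
    refine .setReal ?_
    have e7 : m'.real 7 = m.real 7 :=
      by
      rw [hf.real 7 (by simp)]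
      funext r c
      simp [store]
    have e5 : m'.real 5 = m.real 5 :=
      by
      rw [hf.real 5 (by simp)]
      funext r c
      simp [store]
    have e19 : m'.nat (K + 19) = m.nat (K + 19) := hf.nat _ (by simp)
    have e17 : m'.nat (K + 17) = m.nat (K + 17) := hf.nat _ (by simp)
    simp only [entry, HVClassifier.estimate, RealExpr.eval_add, RealExpr.eval_mul, RealExpr.eval_div,
      RealExpr.eval_cell, RealExpr.eval_ofNat, RealExpr.eval_realVar, NatExpr.eval_natVar,
      NatExpr.eval_lit, store_self, and_self, if_true, e7, e5, e19, e17, hv, hv', hI,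
      hD.estimate i hi r hr, hα r hr, Finset.sum_range_succ]
    ring
  · exact fun m' _ h => h

lemma terminates_addSubgrad {α g : ℕ → ℝ} {i : ℕ} (hD : StoresData K N M z y m)
    (hi : i < N) (hv : m.nat (K + 19) 0 0 = i) (hα : ∀ j < M, m.real 7 0 j = α j)
    (hg : ∀ j < M, m.real 9 0 j = g j) :
    Terminates (addSubgrad K) (M * 8 + 10) m fun m' => ∀ j < M, m'.real 9 0 j =
      g j + if 0 ≤ residual M z y α i then z i j else -z i j := by
  refine Terminates.seq_of_le (T := M * 4 + 5) (T' := M * 4 + 3 + 1)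
    ((terminates_computeResidual hD hi hv hα).frame.imp ?_) (by omega)
  rintro m₁ ⟨hres, hf⟩
  have hD₁ : StoresData K N M z y m₁ := hD.congr (hf.nat _ (by simp [computeResidual]))
    (hf.nat _ (by simp [computeResidual])) (hf.nat _ (by simp [computeResidual]))
    (hf.real _ (by simp [computeResidual])) (hf.real _ (by simp [computeResidual]))
  have e9 : m₁.real 9 = m.real 9 := hf.real _ (by simp [computeResidual])
  have e19 : m₁.nat (K + 19) = m.nat (K + 19) := hf.nat _ (by simp [computeResidual])
  refine .ite (fun hb => ?_) fun hb => ?_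
  · have hb' : 0 ≤ residual M z y α i := by simpa [hres] using hb
    simp only [if_pos hb']
    refine terminates_mapRow hD₁.features fun m' j hj hv' hf' h9 => ?_
    have e19' := hf'.nat (K + 19) (by simp [mapRow])
    have e17' := hf'.nat (K + 17) (by simp [mapRow])
    have e5' := hf'.real 5 (by simp [mapRow])
    simp only [entry, HVClassifier.estimate, RealExpr.eval_add, RealExpr.eval_div,
      RealExpr.eval_cell, RealExpr.eval_ofNat, NatExpr.eval_natVar, NatExpr.eval_lit, e19', e17', e5',
      e19, hv, hv', h9, e9, hg j hj, hD₁.estimate i hi j hj]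
  · have hb' : ¬ 0 ≤ residual M z y α i := by simpa [hres] using hb
    simp only [if_neg hb']
    refine terminates_mapRow hD₁.features fun m' j hj hv' hf' h9 => ?_
    have e19' := hf'.nat (K + 19) (by simp [mapRow])
    have e17' := hf'.nat (K + 17) (by simp [mapRow])
    have e5' := hf'.real 5 (by simp [mapRow])
    simp only [entry, HVClassifier.estimate, RealExpr.eval_sub, RealExpr.eval_div,
      RealExpr.eval_cell, RealExpr.eval_ofNat, NatExpr.eval_natVar, NatExpr.eval_lit, e19', e17', e5',
      e19, hv, hv', h9, e9, hg j hj, hD₁.estimate i hi j hj, sub_eq_add_neg]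

/-- The running sum takes up the iterate before it is replaced, so after R steps it consists of the
iterates 0, …, R - 1. -/
lemma terminates_descentStep {α β : ℕ → ℝ} {s : ℝ} (hD : StoresData K N M z y m)
    (hs : m.real 11 0 0 = s) (hα : ∀ j < M, m.real 7 0 j = α j) (hβ : ∀ j < M, m.real 8 0 j = β j) :
    Terminates (descentStep K) (M * 12 + N * (M * 8 + 13) + 15) m fun m' =>
      (∀ j < M, m'.real 7 0 j = α j - s * subgrad N M z y α j) ∧
        ∀ j < M, m'.real 8 0 j = β j + α j := by
  refine Terminates.seq_of_le (T := M * 4 + 3) (T' := M * 8 + N * (M * 8 + 13) + 11)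
    ((terminates_mapRow (f := fun _ => 0) hD.features (by simp)).frame.imp ?_) (by omega)
  rintro m₁ ⟨h9, hf₁⟩
  have hD₁ := hD.framed_mapRow hf₁ (by omega) (by omega)
  have hα₁ : ∀ j < M, m₁.real 7 0 j = α j := by
    rw [hf₁.real 7 (by simp [mapRow])]; exact hα
  have hβ₁ : ∀ j < M, m₁.real 8 0 j = β j := by
    rw [hf₁.real 8 (by simp [mapRow])]; exact hβ
  have hs₁ : m₁.real 11 0 0 = s := by rw [hf₁.real 11 (by simp [mapRow])]; exact hs
  refine Terminates.seq_of_le (T := N * (M * 8 + 10 + 3) + 3) (T' := M * 8 + 7)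
    (Terminates.forTo (fun i m' => ∀ j < M, m'.real 9 0 j = ∑ i ∈ Finset.range i,
      if 0 ≤ residual M z y α i then z i j else -z i j)
      (by simp [addSubgrad, computeResidual, mapRow]) ?_ ?_ ?_ ?_ ?_) (by ring_nf; omega)
  · intro i x m' h
    exact h
  · intro i m' hf _
    simp [hf.nat (K + 4) (by simp [addSubgrad, computeResidual, mapRow]), hD₁.points]
  · simpa using h9
  · intro i m' hi hv hf hI
    have hD' : StoresData K N M z y m' :=
      hD₁.congr (hf.nat _ (by simp [addSubgrad, computeResidual, mapRow]))
        (hf.nat _ (by simp [addSubgrad, computeResidual, mapRow]))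
        (hf.nat _ (by simp [addSubgrad, computeResidual, mapRow]))
        (hf.real _ (by simp [addSubgrad, computeResidual, mapRow]))
        (hf.real _ (by simp [addSubgrad, computeResidual, mapRow]))
    have hα' : ∀ j < M, m'.real 7 0 j = α j := by
      rw [hf.real 7 (by simp [addSubgrad, computeResidual, mapRow])]; exact hα₁
    simp only [Finset.sum_range_succ]
    exact terminates_addSubgrad hD' hi hv hα' hI
  · intro m₂ hf₂ h9'
    have hD₂ : StoresData K N M z y m₂ :=
      hD₁.congr (hf₂.nat _ (by simp [addSubgrad, computeResidual, mapRow]))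
        (hf₂.nat _ (by simp [addSubgrad, computeResidual, mapRow]))
        (hf₂.nat _ (by simp [addSubgrad, computeResidual, mapRow]))
        (hf₂.real _ (by simp [addSubgrad, computeResidual, mapRow]))
        (hf₂.real _ (by simp [addSubgrad, computeResidual, mapRow]))
    have hα₂ : ∀ j < M, m₂.real 7 0 j = α j := by
      rw [hf₂.real 7 (by simp [addSubgrad, computeResidual, mapRow])]; exact hα₁
    have hβ₂ : ∀ j < M, m₂.real 8 0 j = β j := by
      rw [hf₂.real 8 (by simp [addSubgrad, computeResidual, mapRow])]; exact hβ₁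
    have hs₂ : m₂.real 11 0 0 = s := by
      rw [hf₂.real 11 (by simp [addSubgrad, computeResidual, mapRow])]; exact hs₁
    refine Terminates.seq_of_le (T := M * 4 + 3) (T' := M * 4 + 3)
      ((terminates_mapRow (f := fun j => β j + α j) hD₂.features
        fun m' j hj hv' hf' h8 => ?_).frame.imp ?_) (by omega)
    · have e7 := hf'.real 7 (by simp [mapRow])
      simp only [entry, RealExpr.eval_add, RealExpr.eval_cell, NatExpr.eval_natVar, NatExpr.eval_lit,
        e7, hv', h8, hβ₂ j hj, hα₂ j hj]
    · rintro m₃ ⟨h8, hf₃⟩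
      have hD₃ := hD₂.framed_mapRow hf₃ (by omega) (by omega)
      refine (terminates_mapRow (f := fun j => α j - s * subgrad N M z y α j) hD₃.features
        fun m' j hj hv' hf' h7 => ?_).frame.imp ?_
      · have e11 := hf'.real 11 (by simp [mapRow])
        have e9 := hf'.real 9 (by simp [mapRow])
        have e11' := hf₃.real 11 (by simp [mapRow])
        have e9' := hf₃.real 9 (by simp [mapRow])
        have e7' := hf₃.real 7 (by simp [mapRow])
        simp only [entry, RealExpr.eval_sub, RealExpr.eval_mul, RealExpr.eval_cell,
          RealExpr.eval_realVar, NatExpr.eval_natVar, NatExpr.eval_lit, hv', h7, e11, e9, e11', e9',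
          e7', hα₂ j hj, hs₂, h9' j hj]
        rfl
      · rintro m₄ ⟨h7, hf₄⟩
        refine ⟨h7, ?_⟩
        rw [hf₄.real 8 (by simp [mapRow])]
        exact h8

lemma terminates_descend {κ : ℝ} {R : ℕ} (hD : StoresData K N M z y m) (hκ : m.real 4 0 0 = κ)
    (hR : m.nat (K + 18) 0 0 = R) :
    Terminates (descend K) (M * 12 + R * (M * 12 + N * (M * 8 + 13) + 18) + 20) m fun m' =>
      m'.nat 0 0 0 = M ∧ m'.nat 1 = m.nat 1 ∧
        ∀ j < M, m'.real 0 0 j = descentAverage N M z y (κ / M / N) R j := by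
  refine Terminates.seq_of_le (T := 1)
    (T' := M * 12 + R * (M * 12 + N * (M * 8 + 13) + 18) + 18) (.setReal ?_) (by omega)
  simp only [NatExpr.eval_lit, RealExpr.eval_div, RealExpr.eval_realVar, RealExpr.eval_ofNat,
    NatExpr.eval_natVar, hκ, hD.features, hD.points]
  set s : ℝ := κ / M / N
  have hf₀ : ∀ a, a ≠ 11 → store m.real 11 0 0 s a = m.real a := fun a h => store_of_ne _ _ _ _ h
  have hs₀ : store m.real 11 0 0 s 11 0 0 = s := by simp [store]
  generalize hr : store m.real 11 0 0 s = real₀ at hf₀ hs₀ ⊢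
  have hD₀ : StoresData K N M z y ⟨m.nat, real₀⟩ :=
    hD.congr rfl rfl rfl (hf₀ 5 (by omega)) (hf₀ 1 (by omega))
  refine Terminates.seq_of_le (T := M * 4 + 3)
    (T' := M * 8 + R * (M * 12 + N * (M * 8 + 13) + 18) + 14)
    ((terminates_mapRow (f := fun _ => 0) hD₀.features (by simp)).frame.imp ?_) (by omega)
  rintro m₁ ⟨h7, hf₁⟩
  have hD₁ := hD₀.framed_mapRow hf₁ (by omega) (by omega)
  refine Terminates.seq_of_le (T := M * 4 + 3)
    (T' := M * 4 + R * (M * 12 + N * (M * 8 + 13) + 18) + 10)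
    ((terminates_mapRow (f := fun _ => 0) hD₁.features (by simp)).frame.imp ?_) (by omega)
  rintro m₂ ⟨h8, hf₂⟩
  have hD₂ := hD₁.framed_mapRow hf₂ (by omega) (by omega)
  have hs₂ : m₂.real 11 0 0 = s := by
    rw [hf₂.real 11 (by simp [mapRow]), hf₁.real 11 (by simp [mapRow])]; exact hs₀
  have h7₂ : ∀ j < M, m₂.real 7 0 j = 0 := by
    rw [hf₂.real 7 (by simp [mapRow])]; exact h7
  have hn₂ : ∀ a, a ≠ K + 20 → m₂.nat a = m.nat a := fun a ha => by
    rw [hf₂.nat a (by simp [mapRow, ha]), hf₁.nat a (by simp [mapRow, ha])]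
  refine Terminates.seq_of_le (T := R * (M * 12 + N * (M * 8 + 13) + 18) + 3)
    (T' := M * 4 + 5)
    (Terminates.forTo (fun t m' => (∀ j < M, m'.real 7 0 j = descent N M z y s t j) ∧
      ∀ j < M, m'.real 8 0 j = ∑ t ∈ Finset.range t, descent N M z y s t j)
      (by simp [descentStep, addSubgrad, computeResidual, mapRow]) ?_ ?_ ?_ ?_ ?_) (by omega)
  · intro i x m' h
    exact h
  · intro i m' hf _
    simp [hf.nat (K + 18) (by simp [descentStep, addSubgrad, computeResidual, mapRow]),
      hn₂ (K + 18) (by omega), hR]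
  · exact ⟨by simpa [descent] using h7₂, by simpa using h8⟩
  · rintro t m' ht hv hf ⟨hI7, hI8⟩
    have hD' : StoresData K N M z y m' :=
      hD₂.congr (hf.nat _ (by simp [descentStep, addSubgrad, computeResidual, mapRow]))
        (hf.nat _ (by simp [descentStep, addSubgrad, computeResidual, mapRow]))
        (hf.nat _ (by simp [descentStep, addSubgrad, computeResidual, mapRow]))
        (hf.real _ (by simp [descentStep, addSubgrad, computeResidual, mapRow]))
        (hf.real _ (by simp [descentStep, addSubgrad, computeResidual, mapRow]))
    have hs' : m'.real 11 0 0 = s := by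
      rw [hf.real 11 (by simp [descentStep, addSubgrad, computeResidual, mapRow])]; exact hs₂
    refine (terminates_descentStep hD' hs' hI7 hI8).imp ?_
    rintro m'' ⟨h1, h2⟩
    refine ⟨h1, fun j hj => ?_⟩
    rw [h2 j hj, Finset.sum_range_succ]
  · rintro m₃ hf₃ ⟨_, hI8⟩
    have e8 := hf₃.nat (K + 8) (by simp [descentStep, addSubgrad, computeResidual, mapRow])
    have e18 := hf₃.nat (K + 18) (by simp [descentStep, addSubgrad, computeResidual, mapRow])
    have e1 := hf₃.nat 1 (by simp [descentStep, addSubgrad, computeResidual, mapRow])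
    refine Terminates.seq_of_le (T := M * 4 + 3) (T' := 1)
      ((terminates_mapRow (f := fun j => descentAverage N M z y s R j)
        (by rw [e8]; exact hD₂.features) fun m' j hj hv' hf' _ => ?_).frame.imp ?_) (by omega)
    · have e8' := hf'.real 8 (by simp [mapRow])
      have e18' := hf'.nat (K + 18) (by simp [mapRow])
      simp only [entry, RealExpr.eval_div, RealExpr.eval_cell, RealExpr.eval_ofNat,
        NatExpr.eval_natVar, NatExpr.eval_lit, hv', e8', e18', e18, hn₂ (K + 18) (by omega), hR,
        hI8 j hj]
      rfl
    · rintro m₄ ⟨h0, hf₄⟩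
      refine .assign ⟨?_, ?_, h0⟩
      · rw [Memory.withVar_nat_self, NatExpr.eval_natVar, hf₄.nat (K + 8) (by simp [mapRow]), e8,
          hD₂.features]
      · rw [Memory.withVar_nat_of_ne _ _ (by omega), hf₄.nat 1 (by simp [mapRow]), e1,
          hn₂ 1 (by omega)]

end Descend

end HVClassifier
end
noncomputable section
namespace HVClassifier

/-! ## The preparation of the data -/

/-- The number of descent steps for `M` features and accuracy `κ`. -/
def iterations (M : ℕ) (κ : ℝ) : ℕ := ⌈4 * (M * M) / (κ * κ)⌉₊

/-- The number of measurements per entry. -/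
def samples (D M : ℕ) (κ : ℝ) (R : ℕ) : ℕ :=
  ⌈D * ((2 + κ / M * R) * (2 + κ / M * R) * (M * M) / (κ * κ))⌉₊

/-- The numbers of descent steps and of measurements. -/
def computeSizes (K D : ℕ) : Program :=
  .seq (.assignReal 4 (.div (realVar 2) (.lit 12)))
  (.seq (ceilInto (K + 18) (.div (.mul (.lit 4) (.mul (.ofNat (natVar (K + 8)))
      (.ofNat (natVar (K + 8))))) (.mul (realVar 4) (realVar 4))))
    (ceilInto (K + 17) (.mul (.ofNat (.lit D)) (.div (.mul (.mul
      (.add (.lit 2) (.mul (.div (realVar 4) (.ofNat (natVar (K + 8)))) (.ofNat (natVar (K + 18)))))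
      (.add (.lit 2) (.mul (.div (realVar 4) (.ofNat (natVar (K + 8)))) (.ofNat (natVar (K + 18))))))
      (.mul (.ofNat (natVar (K + 8))) (.ofNat (natVar (K + 8))))) (.mul (realVar 4) (realVar 4))))))

/-- Copy the variables of the input. -/
def readInput (K : ℕ) : Program :=
  .seq (.assign (K + 3) (.cell 0 (.lit 0) (.lit 0)))
  (.seq (.assign (K + 4) (.cell 0 (.lit 0) (.lit 1))) (.assignReal 2 (realVar 0)))

/-- The steps before the enumeration. -/
def readProblem (K a b : ℕ) : Program :=
  .seq (readInput K) (.seq (mergeEdges K) (computeRounds K a b))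

/-- All steps before the measurements. -/
def prepare (K a b D : ℕ) : Program :=
  .seq (readProblem K a b) (.seq (initList K) (.seq (enumerate K) (computeSizes K D)))

/-- The list of the Pauli strings that are measured. -/
def Problem.pauliList {n K : ℕ} {𝒳 : Type*} (P : Problem n K 𝒳) (W : ℕ) : List ((ℕ → ℕ) × ℕ) :=
  (extend P.edges n)^[W] [(fun _ => 0, n)]

/-- The memory after the preparation. -/
structure Prepared {n K : ℕ} {𝒳 : Type*} (P : Problem n K 𝒳) (ε : ℝ) (D W : ℕ) (m : Memory) :
    Prop where
  list : StoresList K n (P.pauliList W) m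
  points : m.nat (K + 4) 0 0 = P.size
  accuracy : m.real 4 0 0 = ε / 12
  steps : m.nat (K + 18) 0 0 = iterations (P.pauliList W).length (ε / 12)
  repeats : m.nat (K + 17) 0 0 = samples D (P.pauliList W).length (ε / 12)
    (iterations (P.pauliList W).length (ε / 12))
  label : ∀ i : Fin P.size, m.real 1 0 i = P.label i

/-- A witness known only in the final memory can be extracted beforehand, since the run is given
explicitly. This fixes the number w before the later time bounds, which depend on it. -/
lemma Terminates.exists_of_exists {α : Sort*} {p : Program} {T : ℕ} {m : Memory}
    {Q : α → Memory → Prop} (h : Terminates p T m fun m' => ∃ w, Q w m') :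
    ∃ w, Terminates p T m (Q w) := by
  obtain ⟨t, ht, m', hb, w, hw⟩ := h
  exact ⟨w, t, ht, m', hb, hw⟩

section Prepare

variable {n K : ℕ} {𝒳 : Type*} {P : Problem n K 𝒳} {ε : ℝ} {m m' : Memory}

lemma terminates_computeSizes {D M : ℕ} (hM : m.nat (K + 8) 0 0 = M) (hε : m.real 2 0 0 = ε) :
    Terminates (computeSizes K D) (iterations M (ε / 12) * 2 +
      samples D M (ε / 12) (iterations M (ε / 12)) * 2 + 9) m fun m' =>
      m'.real 4 0 0 = ε / 12 ∧ m'.nat (K + 18) 0 0 = iterations M (ε / 12) ∧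
      m'.nat (K + 17) 0 0 = samples D M (ε / 12) (iterations M (ε / 12)) := by
  refine Terminates.seq_of_le (T := 1) (T' := iterations M (ε / 12) * 2 +
    samples D M (ε / 12) (iterations M (ε / 12)) * 2 + 7) (.setReal ?_) (by omega)
  refine Terminates.seq_of_le (T := iterations M (ε / 12) * 2 + 3) (T' :=
    samples D M (ε / 12) (iterations M (ε / 12)) * 2 + 3) ?_ (by omega)
  refine terminates_ceilInto ?_ (terminates_ceilInto ?_ ⟨?_, ?_, ?_⟩)
  · intro x
    simp [Memory.withVar_real, Memory.withVar_nat_of_ne, store, hM, hε]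
  · intro x
    simp only [iterations, RealExpr.eval_mul, RealExpr.eval_div, RealExpr.eval_add,
      RealExpr.eval_ofNat, RealExpr.eval_lit, RealExpr.eval_realVar, NatExpr.eval_natVar,
      NatExpr.eval_lit, Memory.withVar_real]
    rw [Memory.withVar_nat_of_ne _ _ (show K + 8 ≠ K + 17 by omega),
      Memory.withVar_nat_of_ne _ _ (show K + 8 ≠ K + 18 by omega),
      Memory.withVar_nat_of_ne _ _ (show K + 18 ≠ K + 17 by omega), Memory.withVar_nat_self]
    simp [store, hε, hM]
  · simp [Memory.withVar_real, store, hε]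
  · rw [Memory.withVar_nat_of_ne _ _ (by omega), Memory.withVar_nat_self]
    rfl
  · rw [Memory.withVar_nat_self]
    rfl

lemma framed_mergeEdges_nat (hf : Framed (mergeEdges K) m m') {a : ℕ} (h5 : a ≠ K + 5)
    (h6 : a ≠ K + 6) (h13 : a ≠ K + 13) (h14 : a ≠ K + 14) : m'.nat a = m.nat a := by
  refine hf.nat a fun h => ?_
  simp only [mergeEdges, Program.writesNat_seq, Program.writesNat_forTo, Program.writesNat_setNat,
    Program.writesNat_assign] at h
  rcases h with h | h | h | h
  · omega
  · omega
  · omega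
  · have := writesNat_mergeHams h
    omega

lemma framed_mergeEdges_real (hf : Framed (mergeEdges K) m m') (a : ℕ) : m'.real a = m.real a :=
  hf.real a (by simp [mergeEdges, not_writesReal_mergeHams])

lemma terminates_readProblem {a b d : ℕ} (hdeg : ∀ k, (P.ham k).DegreeLE d) (hx : 2 ≤ n / ε) :
    Terminates (readProblem K a b) (n * 4 + K * (n * (d + 1) * (n * 4 + 12) + 4) +
      ⌈n / ε⌉₊ * 4 + 21) (inputMemory P ε) fun m => ∃ w : ℕ,
        StoresEdges K n P.edges m ∧ m.nat (K + 7) 0 0 = a * w + b ∧ n / ε ≤ 2 ^ w ∧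
        (2 : ℝ) ^ w ≤ 2 * (n / ε) ∧ m.nat (K + 4) 0 0 = P.size ∧ m.real 2 0 0 = ε ∧
        ∀ i : Fin P.size, m.real 1 0 i = P.label i := by
  have start : Terminates (readInput K) 5 (inputMemory P ε) fun m =>
      m.nat (K + 3) 0 0 = n ∧ m.nat (K + 4) 0 0 = P.size ∧ m.real 2 0 0 = ε ∧
        m.real 1 = (inputMemory P ε).real 1 ∧
        ∀ a, 1 ≤ a → a < K + 3 → m.nat a = (inputMemory P ε).nat a := by
    refine Terminates.seq (T := 1) (T' := 3) (.assign (Terminates.seq (T := 1) (T' := 1)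
      (.assign (.setReal ⟨?_, ?_, ?_, ?_, ?_⟩))))
    · rw [Memory.withVar_nat_of_ne _ _ (by omega), Memory.withVar_nat_self]
      rfl
    · rw [Memory.withVar_nat_self]
      simp only [NatExpr.eval_cell, NatExpr.eval_lit]
      rw [Memory.withVar_nat_of_ne _ _ (by omega)]
      rfl
    · simp only [Memory.withVar_real, NatExpr.eval_lit, store_self, and_self, if_true,
        RealExpr.eval_realVar]
      rfl
    · funext r c
      simp [store, Memory.withVar_real]
    · intro a h1 h2
      rw [Memory.withVar_nat_of_ne _ _ (by omega), Memory.withVar_nat_of_ne _ _ (by omega)]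
  refine Terminates.seq_of_le (T := 5) (T' := n * 4 + K * (n * (d + 1) * (n * 4 + 12) + 4) +
    ⌈n / ε⌉₊ * 4 + 15) (start.imp ?_) (by omega)
  rintro m₁ ⟨h3, h4, h2, h1, hin⟩
  refine Terminates.seq_of_le (T := n * 4 + K * (n * (d + 1) * (n * 4 + 12) + 4) + 9)
    (T' := ⌈n / ε⌉₊ * 4 + 5)
    ((terminates_mergeEdges (Problem.numTerms_le hdeg) h3 hin).frame.imp ?_) (by omega)
  rintro m₂ ⟨hE, hf⟩
  have hn : m₂.nat (K + 4) = m₁.nat (K + 4) :=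
    framed_mergeEdges_nat hf (by omega) (by omega) (by omega) (by omega)
  have hr := framed_mergeEdges_real hf
  refine (terminates_computeRounds (a := a) (b := b) hE.qubits (by rw [hr]; exact h2) hx).frame.imp ?_
  rintro m₃ ⟨⟨w, h7, hw1, hw2⟩, hf₃⟩
  refine ⟨w, hE.framed hf₃ (by simp [computeRounds]) (by simp [computeRounds])
    (by simp [computeRounds]), h7, hw1, hw2, ?_, ?_, fun i => ?_⟩
  · rw [hf₃.nat _ (by simp [computeRounds]), hn, h4]
  · rw [hf₃.real _ (by simp [computeRounds]), hr, h2]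
  · rw [hf₃.real _ (by simp [computeRounds]), hr, h1]
    simp [inputMemory]

lemma terminates_prepare {a b d D B : ℕ} (hdeg : ∀ k, (P.ham k).DegreeLE d) (hx : 2 ≤ n / ε)
    (hB : ∀ W, (P.pauliList W).length ≤ B ^ W) (hB1 : 1 ≤ B) :
    ∃ w : ℕ, n / ε ≤ 2 ^ w ∧ (2 : ℝ) ^ w ≤ 2 * (n / ε) ∧
      Terminates (prepare K a b D) (n * 4 + K * (n * (d + 1) * (n * 4 + 12) + 4) +
        ⌈n / ε⌉₊ * 4 + n * 4 + (a * w + b) * (B ^ (a * w + b) *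
          ((K * (n * (d + 1)) + 1) * (n * (n * 16 + 55) + 7) + 6) + 8) +
        iterations (P.pauliList (a * w + b)).length (ε / 12) * 2 +
        samples D (P.pauliList (a * w + b)).length (ε / 12)
          (iterations (P.pauliList (a * w + b)).length (ε / 12)) * 2 + 43) (inputMemory P ε)
        (Prepared P ε D (a * w + b)) := by
  obtain ⟨w, hw⟩ := (terminates_readProblem (a := a) (b := b) hdeg hx).exists_of_exists
  have hw' := hw
  obtain ⟨-, -, -, -, -, -, hw1, hw2, -⟩ := hw'
  refine ⟨w, hw1, hw2, ?_⟩
  set W := a * w + b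
  refine Terminates.seq_of_le (hw.imp ?_) (T' := n * 4 + W * (B ^ W *
    ((K * (n * (d + 1)) + 1) * (n * (n * 16 + 55) + 7) + 6) + 8) +
    iterations (P.pauliList W).length (ε / 12) * 2 +
    samples D (P.pauliList W).length (ε / 12)
      (iterations (P.pauliList W).length (ε / 12)) * 2 + 21) (by omega)
  rintro m₁ ⟨hE, h7, -, -, h4, h2, h1⟩
  refine Terminates.seq_of_le ((terminates_initList hE.qubits).frame.imp ?_) (T' := W * (B ^ W *
    ((K * (n * (d + 1)) + 1) * (n * (n * 16 + 55) + 7) + 6) + 8) +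
    iterations (P.pauliList W).length (ε / 12) * 2 +
    samples D (P.pauliList W).length (ε / 12)
      (iterations (P.pauliList W).length (ε / 12)) * 2 + 13) (by omega)
  rintro m₂ ⟨hL, hf₂⟩
  have hE₂ := hE.framed hf₂ (by simp [initList]) (by simp [initList]) (by simp [initList])
  have hlist := terminates_enumerate (W := W) (B := B ^ W) hE₂ hL (by simp)
    (by rw [hf₂.nat _ (by simp [initList]), h7])
    fun v hv => (hB v).trans (Nat.pow_le_pow_right hB1 hv)
  refine Terminates.seq_of_le (T := W * (B ^ W *
    ((K * (n * (d + 1)) + 1) * (n * (n * 16 + 55) + 7) + 6) + 8) + 3)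
    (T' := iterations (P.pauliList W).length (ε / 12) * 2 +
    samples D (P.pauliList W).length (ε / 12)
      (iterations (P.pauliList W).length (ε / 12)) * 2 + 9)
    ((hlist.frame.imp ?_).mono ?_ fun _ h => h) (by omega)
  · rintro m₃ ⟨hL₃, hf₃⟩
    have hr : ∀ c, m₃.real c = m₁.real c := fun c => by
      rw [hf₃.real c (by simp [enumerate, pushChild, pushCodes, pushEdge, pushRound]),
        hf₂.real c (by simp [initList])]
    refine (terminates_computeSizes (D := D) (ε := ε) hL₃.count
      (by rw [hr]; exact h2)).frame.imp ?_
    rintro m₄ ⟨⟨e4, e18, e17⟩, hf₄⟩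
    refine ⟨hL₃.congr (hf₄.nat _ (by simp [computeSizes, ceilInto]))
      (hf₄.nat _ (by simp [computeSizes, ceilInto]))
      (hf₄.nat _ (by simp [computeSizes, ceilInto])), ?_, e4, e18, e17, fun i => ?_⟩
    · rw [hf₄.nat _ (by simp [computeSizes, ceilInto]),
        hf₃.nat _ (by simp [enumerate, pushChild, pushCodes, pushEdge, pushRound]),
        hf₂.nat _ (by simp [initList]), h4]
    · rw [hf₄.real _ (by simp [computeSizes, ceilInto]), hr, h1]
  · have := Problem.length_edges_le hdeg
    gcongr

end Prepare

end HVClassifier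
end
noncomputable section
namespace HVClassifier

/-! ## The quality of the output -/

section Quality

variable {n K : ℕ} {𝒳 : Type*} {P : Problem n K 𝒳} {ε : ℝ} {m₀ : Memory}

lemma length_pauliList_pos (P : Problem n K 𝒳) (W : ℕ) : 0 < (P.pauliList W).length := by
  obtain ⟨x, hx, -⟩ := exists_mem_iterate_extend (E := P.edges) (n := n) (fun _ => 0) (by simp) []
    (by simp) (L := [(fun _ => 0, n)]) (List.mem_singleton.mpr rfl) (by simp) (Nat.zero_le W)
  exact List.length_pos_of_mem hx

/-- Off the walk both strings are the identity: the initial string is zero there, and p vanishes by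
hypothesis. -/
lemma exists_index_of_walk {W : ℕ} (hL : StoresList K n (P.pauliList W) m₀) {p : Fin n → Fin 4}
    {l : List ℕ} (hc : (n :: l).IsChain P.Linked) (hl : ∀ q ∈ l, q < n)
    (hp : ∀ q : Fin n, p q ≠ 0 → (q : ℕ) ∈ l) (hlW : l.length ≤ W) :
    ∃ j < (P.pauliList W).length, ∀ q < n, m₀.nat 1 j q = codes p q := by
  obtain ⟨x, hx, hxq⟩ := exists_mem_iterate_extend (E := P.edges) (n := n) (codes p)
    (fun q => by unfold codes; split_ifs <;> omega) l hl (L := [(fun _ => 0, n)])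
    (x := (fun _ => 0, n)) (List.mem_singleton.mpr rfl) hc hlW
  obtain ⟨j, hj⟩ := List.mem_iff_getElem?.mp hx
  refine ⟨j, (List.getElem?_eq_some_iff.mp hj).1, fun q hq => ?_⟩
  rw [hL.string j x hj q hq, hxq]
  split_ifs with h
  · rfl
  · by_contra h0
    refine h (hp ⟨q, hq⟩ fun h1 => h0 ?_)
    have := codes_apply p ⟨q, hq⟩
    simp only at this
    rw [this, h1]
    rfl

/-- Each Pauli operator with nonzero coefficient is assigned one row of the list, and other rows
with the same string get coefficient 0. A row determines the operator, so no two coefficients are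
added and the bound 2 survives. -/
lemma exists_coefficients {M : ℕ} {c : (Fin n → Fin 4) → ℝ} (hc : ∀ p, |c p| ≤ 2)
    (h : ∀ p, c p ≠ 0 → ∃ j < M, ∀ q < n, m₀.nat 1 j q = codes p q) {N : ℕ}
    (Φ : Fin N → PureState n) :
    ∃ β : ℕ → ℝ, (∀ j < M, |β j| ≤ 2) ∧ ∀ i (hi : i < N),
      ∑ j ∈ Finset.range M, β j * pauliMean Φ m₀ i j =
        ∑ p, c p * expectation (pauliString n (codes p)) (Φ ⟨i, hi⟩) := by
  classical
  choose! idx hM hidx using h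
  refine ⟨fun j => ∑ p ∈ (Finset.univ.filter fun p => c p ≠ 0).filter fun p => idx p = j, c p,
    fun j _ => ?_, fun i hi => ?_⟩
  · have hcard : ((Finset.univ.filter fun p => c p ≠ 0).filter fun p => idx p = j).card ≤ 1 := by
      rw [Finset.card_le_one]
      intro p hp p' hp'
      simp only [Finset.mem_filter, Finset.mem_univ, true_and] at hp hp'
      funext q
      have h1 := hidx p hp.1 q q.2
      have h2 := hidx p' hp'.1 q q.2
      rw [hp.2, codes_apply] at h1
      rw [hp'.2, codes_apply] at h2
      exact Fin.val_injective (h1.symm.trans h2)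
    refine (Finset.abs_sum_le_sum_abs _ _).trans ((Finset.sum_le_card_nsmul _ _ 2
      fun p _ => hc p).trans ?_)
    rw [nsmul_eq_mul]
    have : (((Finset.univ.filter fun p => c p ≠ 0).filter fun p => idx p = j).card : ℝ) ≤ 1 := by
      exact_mod_cast hcard
    linarith
  · have hmaps : ∀ p ∈ Finset.univ.filter fun p => c p ≠ 0, idx p ∈ Finset.range M := by
      intro p hp
      exact Finset.mem_range.mpr (hM p (Finset.mem_filter.mp hp).2)
    calc _ = ∑ j ∈ Finset.range M, ∑ p ∈ (Finset.univ.filter fun p => c p ≠ 0).filter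
          fun p => idx p = j, c p * expectation (pauliString n (codes p)) (Φ ⟨i, hi⟩) := by
          refine Finset.sum_congr rfl fun j _ => ?_
          rw [Finset.sum_mul]
          refine Finset.sum_congr rfl fun p hp => ?_
          simp only [Finset.mem_filter, Finset.mem_univ, true_and] at hp
          rw [pauliMean, dif_pos hi, pauliString_congr (p' := codes p)]
          intro q hq
          rw [← hp.2]
          exact hidx p hp.1 q hq
      _ = _ := by
          rw [Finset.sum_fiberwise_of_maps_to hmaps]
          refine Finset.sum_filter_of_ne fun p _ hp h0 => hp ?_
          rw [h0, zero_mul]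

lemma outputModel_density (m : Memory) (φ : PureState n) :
    outputModel n m φ.density = ∑ j ∈ Finset.range (m.nat 0 0 0),
      m.real 0 0 j * expectation (pauliString n (m.nat 1 j)) φ := by
  simp only [outputModel, trace_mul_density]

/-- The estimates of the expectation values that are held in a memory. -/
def estimates (S : ℕ) (m : Memory) (i j : ℕ) : ℝ := m.real 5 i j / S

/-- The memories are those before the measurements, after them, and at the end. The regression bound
is used with κ = ε/12, so its error 3κ is ε/4. -/
lemma modelError_le {D W : ℕ} {m₁ m₂ : Memory} {θ : Fin K → ℝ} (hε : 0 < ε)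
    (hprep : Prepared P ε D W m₀) {M S R : ℕ} (hM : M = (P.pauliList W).length)
    (hR : R = iterations M (ε / 12)) (hS : 0 < S)
    (hinv : MeasureInv K m₀ S (Finset.range P.size ×ˢ Finset.range M) m₁)
    (hnoise : (2 + ε / 12 / M * R) ^ 2 * M *
      (sqError P.state m₀ S (Finset.range P.size ×ˢ Finset.range M) m₁ / P.size) ≤ (ε / 12) ^ 2)
    (hcount : m₂.nat 0 0 0 = M) (hstr : m₂.nat 1 = m₁.nat 1)
    (hcoeff : ∀ j < M, m₂.real 0 0 j = descentAverage P.size M (estimates S m₁) (m₁.real 1 0)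
      (ε / 12 / M / P.size) R j)
    {c : (Fin n → Fin 4) → ℝ} (hc : ∀ p, |c p| ≤ 2)
    (hwalk : ∀ p, c p ≠ 0 → ∃ l : List ℕ, (n :: l).IsChain P.Linked ∧ (∀ q ∈ l, q < n) ∧
      (∀ q : Fin n, p q ≠ 0 → (q : ℕ) ∈ l) ∧ l.length ≤ W)
    (happrox : ∀ i, |P.prediction θ i -
      ∑ p, c p * expectation (pauliString n (codes p)) (P.state i)| ≤ ε / 12) :
    P.modelError (outputModel n m₂) θ ≤ 2 * P.loss θ + ε / 4 := by
  subst hM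
  set M := (P.pauliList W).length
  have hMpos : 0 < M := length_pauliList_pos P W
  have hS' : (0 : ℝ) < S := by exact_mod_cast hS
  obtain ⟨β, hβ, hsum⟩ := exists_coefficients (M := M) (m₀ := m₀) hc (fun p hp => by
    obtain ⟨l, h1, h2, h3, h4⟩ := hwalk p hp
    exact exists_index_of_walk hprep.list h1 h2 h3 h4) P.state
  have hstr₀ : m₁.nat 1 = m₀.nat 1 := hinv.frame.nat 1 (by omega) (by omega) (by omega)
  have hlab : ∀ i : Fin P.size, m₁.real 1 0 i = P.label i := fun i => by
    rw [hinv.frame.real 1 (by omega) (by omega)]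
    exact hprep.label i
  set f : ℕ → ℝ := fun i => if h : i < P.size then P.prediction θ ⟨i, h⟩ else 0 with hf
  have hfi : ∀ i : Fin P.size, f i = P.prediction θ i := fun i => by simp [hf]
  have key := sum_abs_model_sub_le (N := P.size) (M := M) (z := estimates S m₁)
    (y := m₁.real 1 0) (s := ε / 12 / M / P.size) (R := R) (κ := ε / 12) (β := β) (f := f)
    (μ := pauliMean P.state m₀) ?_ P.size_pos hMpos (by positivity) ?_ hβ rfl ?_ ?_
  · have e1 : (∑ i ∈ Finset.range P.size, |∑ j ∈ Finset.range M,
        descentAverage P.size M (estimates S m₁) (m₁.real 1 0) (ε / 12 / M / P.size) R j *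
          pauliMean P.state m₀ i j - f i|) / P.size = P.modelError (outputModel n m₂) θ := by
      rw [Problem.modelError, Finset.sum_range]
      congr 1
      refine Finset.sum_congr rfl fun i _ => ?_
      rw [hfi, outputModel_density, hcount]
      congr 2
      refine Finset.sum_congr rfl fun j hj => ?_
      rw [hcoeff j (Finset.mem_range.mp hj), hstr, hstr₀, pauliMean, dif_pos i.2]
    have e2 : (∑ i ∈ Finset.range P.size, |f i - m₁.real 1 0 i|) / P.size = P.loss θ := by
      rw [Problem.loss, Finset.sum_range]
      congr 1
      refine Finset.sum_congr rfl fun i _ => ?_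
      rw [hfi, hlab]
    rw [e1, e2] at key
    linarith
  · intro i hi j hj
    rw [estimates, abs_div, abs_of_pos hS', div_le_one hS']
    exact hinv.bound (i, j) (by simp [hi, hj])
  · rw [hR]
    refine le_trans (le_of_eq ?_) (Nat.le_ceil _)
    ring
  · intro i hi
    rw [hsum i hi]
    simp only [hf, dif_pos hi]
    exact happrox ⟨i, hi⟩
  · rwa [sqError, Finset.sum_product] at hnoise

end Quality

end HVClassifier
end
noncomputable section
namespace HVClassifier

/-! ## The classifier -/

open Classical in
/-- The cost `τ` for the final memories outside of `G`; computations that have not ended cost `∞`. -/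
def failureCost (τ : ℝ) (G : Memory → Prop) (c : Config) : ENNReal :=
  if c.Halted then if G c.mem then 0 else ENNReal.ofReal τ else ⊤

/-! ### From an expected cost to halting and a success probability. -/

section Failure

variable {n N : ℕ} {Φ : Fin N → PureState n} {G : Memory → Prop} {τ δ : ℝ}

lemma failureCost_of_good {m : Memory} (h : G m) : failureCost τ G ⟨[], m⟩ = 0 := by
  rw [failureCost, if_pos (show Config.Halted ⟨[], m⟩ from rfl), if_pos h]

lemma failureCost_le (τ : ℝ) (G : Memory → Prop) (m : Memory) :
    failureCost τ G ⟨[], m⟩ ≤ ENNReal.ofReal τ := by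
  rw [failureCost, if_pos (show Config.Halted ⟨[], m⟩ from rfl)]
  split_ifs <;> simp

/-- A finite expectation excludes unfinished computations from the support. For the rest, Markov's
inequality: failures cost τ each, at most δτ in expectation. -/
lemma halted_and_prob_of_optimalCost_le (hτ : 0 < τ) (hδ : 0 ≤ δ) {t : ℕ} {c : Config}
    (h : optimalCost Φ (failureCost τ G) t c ≤ ENNReal.ofReal (δ * τ)) :
    (∀ c' ∈ (run Φ t c).support, c'.Halted) ∧
      ENNReal.ofReal (1 - δ) ≤ prob (run Φ t c) fun c' => G c'.mem := by
  have hhalt : ∀ c', failureCost τ G c' ≠ ⊤ → c'.Halted := by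
    intro c' h'
    by_contra h''
    exact h' (if_neg h'')
  have hle := (expect_run_le (Φ := Φ) hhalt t c).trans h
  refine ⟨fun c' hc' => hhalt c' (mem_support_ne_top (ne_top_of_le_ne_top ENNReal.ofReal_ne_top hle)
    hc'), ?_⟩
  set μ := run Φ t c
  set τ' := ENNReal.ofReal τ with hτ'
  have h0 : τ' ≠ 0 := by simpa [hτ'] using hτ
  have key : τ' ≤ expect μ (failureCost τ G) + prob μ (fun c' => G c'.mem) * τ' := by
    rw [prob, PMF.toOuterMeasure_apply, expect, ← ENNReal.tsum_mul_right, ← ENNReal.tsum_add]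
    calc τ' = ∑' a, μ a * τ' := by rw [ENNReal.tsum_mul_right, μ.tsum_coe, one_mul]
      _ ≤ _ := by
        refine ENNReal.tsum_le_tsum fun a => ?_
        by_cases hG : G a.mem
        · rw [Set.indicator_of_mem (by exact hG)]
          exact le_add_self
        · refine le_add_right (mul_le_mul_right ?_ _)
          rw [failureCost, if_neg hG]
          split_ifs
          · exact le_rfl
          · exact le_top
  have h2 : 1 * τ' ≤ (ENNReal.ofReal δ + prob μ fun c' => G c'.mem) * τ' := by
    rw [one_mul, add_mul, ← ENNReal.ofReal_mul hδ]
    exact key.trans (add_le_add_left hle _)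
  have h3 := (ENNReal.mul_le_mul_iff_left h0 ENNReal.ofReal_ne_top).mp h2
  rw [ENNReal.ofReal_sub _ hδ, ENNReal.ofReal_one, tsub_le_iff_left]
  exact h3

lemma optimalCost_le_of_terminates {p : Program} {T s : ℕ} {m : Memory} {k : List Program}
    {Q : Memory → Prop} {F : Config → ENNReal} {v : ENNReal} (h : Terminates p T m Q)
    (hv : ∀ m', Q m' → optimalCost Φ F s ⟨k, m'⟩ ≤ v) :
    optimalCost Φ F (T + s) ⟨p :: k, m⟩ ≤ v := by
  obtain ⟨t, ht, m', hb, hQ⟩ := h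
  exact (optimalCost_antitone _ (Nat.add_le_add_right ht s)).trans
    ((hb.optimalCost_le k s).trans (hv m' hQ))

end Failure

/-- The whole computation for an accuracy below one. -/
def classify (K a b D : ℕ) : Program :=
  .seq (prepare K a b D) (.seq (measureAll K) (descend K))

/-- The classifier: accuracy one is reached by the zero model. -/
def classifier (K a b D : ℕ) : Program :=
  .ite (.realLE (.lit 1) (realVar 0)) (.assign 0 (.lit 0)) (classify K a b D)

/-- The running time per data point in terms of the sizes of all lists. -/
def runtime {α : Type*} [Semiring α] (K d n c W V M S R : α) : α :=
  n * 4 + K * (n * (d + 1) * (n * 4 + 12) + 4) + c * 4 + n * 4 + W * (V *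
    ((K * (n * (d + 1)) + 1) * (n * (n * 16 + 55) + 7) + 6) + 8) + R * 2 + S * 2 + 43 +
    (M * (S * (n + 6) + 8) + 9) + (M * 12 + R * (M * 12 + (M * 8 + 13) + 18) + 20) + 3

section Classifier

variable {n K : ℕ} {𝒳 : Type*} {P : Problem n K 𝒳} {ε δ T : ℝ}

/-- The output is accurate for all parameters with `|θ_k| ≤ T`. -/
def Problem.Accurate (P : Problem n K 𝒳) (T ε : ℝ) (m : Memory) : Prop :=
  ∀ θ : Fin K → ℝ, (∀ k, |θ k| ≤ T) → P.modelError (outputModel n m) θ ≤ 2 * P.loss θ + ε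

lemma samples_pos {D M R : ℕ} {κ : ℝ} (hD : 0 < D) (hM : 0 < M) (hκ : 0 < κ) :
    0 < samples D M κ R := by
  rw [samples, Nat.ceil_pos]
  positivity

lemma optimalCost_classifier_le {a b d D B : ℕ} (hdeg : ∀ k, (P.ham k).DegreeLE d) (hε : 0 < ε)
    (hε1 : ε < 1) (hx : 2 ≤ n / ε) (hn : 1 ≤ n) (hB : ∀ W, (P.pauliList W).length ≤ B ^ W) (hB1 : 1 ≤ B)
    (hδ : 0 < δ) (hD : 1 ≤ δ * D)
    (happrox : ∀ w : ℕ, ∀ θ : Fin K → ℝ, (∀ k, |θ k| ≤ T) → ∃ c : (Fin n → Fin 4) → ℝ,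
      (∀ p, |c p| ≤ 2) ∧ (∀ p, c p ≠ 0 → ∃ l : List ℕ, (n :: l).IsChain P.Linked ∧
        (∀ q ∈ l, q < n) ∧ (∀ q : Fin n, p q ≠ 0 → (q : ℕ) ∈ l) ∧ l.length ≤ a * w + b) ∧
      ∀ i, |P.prediction θ i - ∑ p, c p * expectation (pauliString n (codes p)) (P.state i)| ≤
        (1 / 2) ^ w / 12) :
    ∃ w M : ℕ, (2 : ℝ) ^ w ≤ 2 * (n / ε) ∧ 0 < M ∧ M ≤ B ^ (a * w + b) ∧ ∃ τ : ℝ, 0 < τ ∧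
      optimalCost P.state (failureCost τ (P.Accurate T (ε / 4))) (P.size *
        runtime K d n ⌈n / ε⌉₊ (a * w + b) (B ^ (a * w + b)) M
          (samples D M (ε / 12) (iterations M (ε / 12))) (iterations M (ε / 12)))
        ⟨[classifier K a b D], inputMemory P ε⟩ ≤ ENNReal.ofReal (δ * τ) := by
  obtain ⟨w, hw1, hw2, hprep⟩ := terminates_prepare (a := a) (b := b) (D := D) hdeg hx hB hB1
  set W := a * w + b with hW
  set M := (P.pauliList W).length with hM
  set R := iterations M (ε / 12) with hR
  set S := samples D M (ε / 12) R with hS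
  have hMpos : 0 < M := length_pauliList_pos P W
  have hDpos : 0 < D := by
    rcases Nat.eq_zero_or_pos D with rfl | h
    · norm_num at hD
    · exact h
  have hSpos : 0 < S := samples_pos hDpos hMpos (by positivity)
  have hN : (0 : ℝ) < P.size := by exact_mod_cast P.size_pos
  have hM' : (0 : ℝ) < M := by exact_mod_cast hMpos
  have hS' : (0 : ℝ) < S := by exact_mod_cast hSpos
  set g : ℝ := 2 + ε / 12 / M * R with hg
  have hgpos : 0 < g := by positivity
  -- The largest total squared error that the noise condition of the regression tolerates.
  set τ : ℝ := (ε / 12) ^ 2 * P.size / (g ^ 2 * M) with hτ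
  have hτpos : 0 < τ := by positivity
  refine ⟨w, M, hw2, hMpos, hB W, τ, hτpos, ?_⟩
  set T₁ := n * 4 + K * (n * (d + 1) * (n * 4 + 12) + 4) + ⌈n / ε⌉₊ * 4 + n * 4 +
    W * (B ^ W * ((K * (n * (d + 1)) + 1) * (n * (n * 16 + 55) + 7) + 6) + 8) + R * 2 + S * 2 + 43
    with hT₁
  set T₂ := P.size * (M * (S * (n + 6) + 8) + 6) + 3 with hT₂
  set T₃ := M * 12 + R * (M * 12 + P.size * (M * 8 + 13) + 18) + 20 with hT₃
  -- There is at least one data point, so costs that do not depend on their number may be multiplied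
  -- by it.
  have htime : T₁ + (T₂ + (T₃ + 0) + 1) + 1 + 1 ≤
      P.size * runtime K d n ⌈n / ε⌉₊ W (B ^ W) M S R := by
    obtain ⟨N, hN⟩ : ∃ N, P.size = N + 1 := ⟨P.size - 1, by have := P.size_pos; omega⟩
    have : P.size * runtime K d n ⌈n / ε⌉₊ W (B ^ W) M S R = T₁ + T₂ + T₃ + 3 +
        N * (T₁ + (M * 12 + R * (M * 12 + 18) + 20 + 6)) := by
      simp only [runtime, ← hT₁, hT₂, hT₃, hN]
      ring
    omega
  refine (optimalCost_antitone _ htime).trans ((optimalCost_of_step_eq_pure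
    (c' := ⟨[classify K a b D], inputMemory P ε⟩) ?_ _).trans ?_)
  · have : ¬ (Test.realLE (.lit 1) (realVar 0)).Holds (inputMemory P ε) := by
      simpa [inputMemory] using hε1
    simp [step, classifier, this]
  refine (optimalCost_of_step_eq_pure rfl _).trans ?_
  refine optimalCost_le_of_terminates hprep fun m₀ h₀ => ?_
  refine (optimalCost_of_step_eq_pure rfl _).trans ?_
  refine (hoare_measureAll (Φ := P.state) (m₀ := m₀) hSpos h₀.repeats h₀.points h₀.list.count _ _ _
    (fun m₁ => ?_) m₀).trans ?_
  · by_cases hinv : MeasureInv K m₀ S (Finset.range P.size ×ˢ Finset.range M) m₁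
    swap
    · exact le_top.trans (if_neg hinv).ge
    refine le_trans ?_ (guarded_of hinv _).ge
    have hfr : ∀ c, c ≠ 19 → c ≠ 20 → c ≠ 21 → m₁.nat (K + c) = m₀.nat (K + c) := fun c h1 h2 h3 =>
      hinv.frame.nat _ (by omega) (by omega) (by omega)
    have hdata : StoresData K P.size M (estimates S m₁) (m₁.real 1 0) m₁ := by
      refine ⟨?_, ?_, ?_, fun _ _ => rfl⟩
      · rw [hfr 4 (by omega) (by omega) (by omega), h₀.points]
      · rw [hfr 8 (by omega) (by omega) (by omega), h₀.list.count]
      · intro i _ j _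
        rw [hfr 17 (by omega) (by omega) (by omega), h₀.repeats]
        rfl
    have hκ : m₁.real 4 0 0 = ε / 12 := by
      rw [hinv.frame.real 4 (by omega) (by omega), h₀.accuracy]
    have hRm : m₁.nat (K + 18) 0 0 = R := by
      rw [hfr 18 (by omega) (by omega) (by omega), h₀.steps]
    refine optimalCost_le_of_terminates (terminates_descend hdata hκ hRm) fun m₂ ⟨h1, h2, h3⟩ => ?_
    -- Pointwise form of Markov's inequality: the cost is 0 if the error is within τ, and otherwise
    -- τ is below the error.
    by_cases hsq : sqError P.state m₀ S (Finset.range P.size ×ˢ Finset.range M) m₁ ≤ τ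
    · refine le_trans (le_of_eq (failureCost_of_good ?_)) (zero_le)
      intro θ hθ
      obtain ⟨c, hc, hwalk, hap⟩ := happrox w θ hθ
      refine modelError_le hε h₀ hM hR hSpos hinv ?_ h1 h2 h3 hc hwalk fun i => (hap i).trans ?_
      · have : g ^ 2 * M * (sqError P.state m₀ S (Finset.range P.size ×ˢ Finset.range M) m₁ /
            P.size) ≤ g ^ 2 * M * (τ / P.size) := by gcongr
        refine this.trans (le_of_eq ?_)
        rw [hτ]
        field_simp
      · have h4 : 1 / ε ≤ 2 ^ w := by
          refine le_trans ?_ hw1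
          gcongr
          exact_mod_cast hn
        rw [div_le_iff₀ hε] at h4
        have h5 : ((1 : ℝ) / 2) ^ w ≤ ε := by
          rw [div_pow, one_pow, div_le_iff₀ (by positivity)]
          linarith
        linarith
    · exact (failureCost_le _ _ _).trans (ENNReal.ofReal_le_ofReal (not_le.mp hsq).le)
  · refine (guarded_of rfl _).le.trans ?_
    refine ENNReal.ofReal_le_ofReal ?_
    -- With this number of samples the expected squared error N M / S is at most τ / D, and D ≥ 1/δ.
    have h1 : D * (g * g * (M * M) / (ε / 12 * (ε / 12))) ≤ S := Nat.le_ceil _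
    rw [div_le_iff₀ hS', hτ]
    have h2 : (P.size : ℝ) * M ≤ δ * D * (P.size * M) := by
      nlinarith [mul_pos hN hM']
    calc (P.size : ℝ) * M ≤ δ * D * (P.size * M) := h2
      _ = δ * ((ε / 12) ^ 2 * P.size / (g ^ 2 * M)) *
          (D * (g * g * (M * M) / (ε / 12 * (ε / 12)))) := by
        field_simp
      _ ≤ _ := by gcongr

lemma Problem.loss_nonneg (P : Problem n K 𝒳) (θ : Fin K → ℝ) : 0 ≤ P.loss θ :=
  div_nonneg (Finset.sum_nonneg fun _ _ => abs_nonneg _) (Nat.cast_nonneg _)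

/-- Predictions lie in [-1, 1], so the empty sum as model errs by at most 1. Two steps suffice, the
test and the assignment. -/
lemma optimalCost_classifier_of_one_le {a b D : ℕ} (hε : 1 ≤ ε) (τ : ℝ) :
    optimalCost P.state (failureCost τ fun m => ∀ θ, P.modelError (outputModel n m) θ ≤ 1) 2
      ⟨[classifier K a b D], inputMemory P ε⟩ ≤ 0 := by
  refine (optimalCost_of_step_eq_pure (c' := ⟨[.assign 0 (.lit 0)], inputMemory P ε⟩) ?_ 1).trans
    ((optimalCost_of_step_eq_pure rfl 0).trans (failureCost_of_good fun θ => ?_).le)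
  · have : (Test.realLE (.lit 1) (realVar 0)).Holds (inputMemory P ε) := by
      simpa [inputMemory] using hε
    simp [step, classifier, this]
  · rw [Problem.modelError, div_le_one (by exact_mod_cast P.size_pos)]
    refine (Finset.sum_le_card_nsmul _ _ 1 fun i _ => ?_).trans (by simp)
    simpa [outputModel, store] using P.abs_prediction_le θ i

lemma prob_mono {μ : PMF Config} {E E' : Config → Prop} (h : ∀ c, E c → E' c) :
    prob μ E ≤ prob μ E' := MeasureTheory.measure_mono fun _ hc => h _ hc

end Classifier

/-! ## The running time -/

/-- Bounded by a power on `[2, ∞)`. -/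
def PowerBounded (f : ℝ → ℝ) : Prop := ∃ C : ℕ, ∀ x, 2 ≤ x → 0 ≤ f x ∧ f x ≤ x ^ C

namespace PowerBounded

variable {f g : ℝ → ℝ}

lemma id : PowerBounded fun x => x := ⟨1, fun x hx => ⟨by linarith, by simp⟩⟩

lemma natCast (c : ℕ) : PowerBounded fun _ => (c : ℝ) := by
  refine ⟨c, fun x hx => ⟨by positivity, ?_⟩⟩
  calc (c : ℝ) ≤ 2 ^ c := by exact_mod_cast Nat.lt_two_pow_self.le
    _ ≤ x ^ c := by gcongr

lemma ofNat (c : ℕ) [c.AtLeastTwo] : PowerBounded fun _ => (OfNat.ofNat c : ℝ) := natCast c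

lemma one : PowerBounded fun _ => 1 := by simpa using natCast 1

lemma add (hf : PowerBounded f) (hg : PowerBounded g) : PowerBounded fun x => f x + g x := by
  obtain ⟨a, ha⟩ := hf
  obtain ⟨b, hb⟩ := hg
  refine ⟨max a b + 1, fun x hx => ⟨add_nonneg (ha x hx).1 (hb x hx).1, ?_⟩⟩
  have h1 : x ^ a ≤ x ^ max a b := pow_le_pow_right₀ (by linarith) (le_max_left a b)
  have h2 : x ^ b ≤ x ^ max a b := pow_le_pow_right₀ (by linarith) (le_max_right a b)
  have h3 : 0 ≤ x ^ max a b := by positivity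
  rw [pow_succ]
  nlinarith [(ha x hx).2, (hb x hx).2]

lemma mul (hf : PowerBounded f) (hg : PowerBounded g) : PowerBounded fun x => f x * g x := by
  obtain ⟨a, ha⟩ := hf
  obtain ⟨b, hb⟩ := hg
  refine ⟨a + b, fun x hx => ⟨mul_nonneg (ha x hx).1 (hb x hx).1, ?_⟩⟩
  rw [pow_add]
  exact mul_le_mul (ha x hx).2 (hb x hx).2 (hb x hx).1 (by positivity)

lemma pow (hf : PowerBounded f) (k : ℕ) : PowerBounded fun x => f x ^ k := by
  induction k with
  | zero => simpa using one
  | succ k ih => simpa only [pow_succ] using ih.mul hf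

lemma runtime {n c W V M S R : ℝ → ℝ} (hn : PowerBounded n) (hc : PowerBounded c)
    (hW : PowerBounded W) (hV : PowerBounded V) (hM : PowerBounded M) (hS : PowerBounded S)
    (hR : PowerBounded R) (K d : ℕ) : PowerBounded fun x =>
      HVClassifier.runtime (K : ℝ) d (n x) (c x) (W x) (V x) (M x) (S x) (R x) := by
  unfold HVClassifier.runtime
  repeat' first | exact hn | exact hc | exact hW | exact hV | exact hM | exact hS | exact hR |
    exact natCast _ | exact ofNat _ | exact one | apply add | apply mul

end PowerBounded

lemma runtime_mono {K d n c W V M S R n' c' W' V' M' S' R' : ℝ} (hK : 0 ≤ K) (hd : 0 ≤ d)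
    (hn : 0 ≤ n) (hW : 0 ≤ W) (hV : 0 ≤ V) (hM : 0 ≤ M) (hS : 0 ≤ S) (hR : 0 ≤ R)
    (hn' : n ≤ n') (hc' : c ≤ c') (hW' : W ≤ W') (hV' : V ≤ V') (hM' : M ≤ M') (hS' : S ≤ S')
    (hR' : R ≤ R') : runtime K d n c W V M S R ≤ runtime K d n' c' W' V' M' S' R' := by
  have hn0 := hn.trans hn'
  have hW0 := hW.trans hW'
  have hV0 := hV.trans hV'
  have hM0 := hM.trans hM'
  have hS0 := hS.trans hS'
  have hR0 := hR.trans hR'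
  unfold runtime
  gcongr

lemma exists_runtime_le (K d a b B D : ℕ) (hB : 1 ≤ B) :
    ∃ C : ℕ, ∀ (n w M : ℕ) (ε : ℝ), 0 < ε → ε < 1 → 1 ≤ n → 2 ≤ n / ε →
      (2 : ℝ) ^ w ≤ 2 * (n / ε) → 0 < M → M ≤ B ^ (a * w + b) →
      ((runtime K d n ⌈n / ε⌉₊ (a * w + b) (B ^ (a * w + b)) M
          (samples D M (ε / 12) (iterations M (ε / 12))) (iterations M (ε / 12)) : ℕ) : ℝ) ≤
        (n / ε) ^ C := by
  -- Majorants, as functions of x = n/ε, for the list length, the iterations and the samples. The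
  -- factors 12 x bound the inverse of ε/12, and the summands 1 account for the ceilings.
  set V : ℝ → ℝ := fun x => (2 * x) ^ (B * a) * (B ^ b : ℕ) with hV
  set R : ℝ → ℝ := fun x => 4 * (V x * V x) * ((12 * x) * (12 * x)) + 1 with hR
  set S : ℝ → ℝ := fun x => D * ((2 + R x) * (2 + R x) * (V x * V x) * ((12 * x) * (12 * x))) + 1
    with hS
  have pV : PowerBounded V :=
    ((PowerBounded.ofNat 2).mul .id).pow _ |>.mul (.natCast _)
  have p12 : PowerBounded fun x => (12 * x) * (12 * x) :=
    ((PowerBounded.ofNat 12).mul .id).mul ((PowerBounded.ofNat 12).mul .id)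
  have pR : PowerBounded R := (((PowerBounded.ofNat 4).mul (pV.mul pV)).mul p12).add .one
  have pS : PowerBounded S := ((PowerBounded.natCast D).mul
    (((((PowerBounded.ofNat 2).add pR).mul ((PowerBounded.ofNat 2).add pR)).mul
      (pV.mul pV)).mul p12)).add .one
  obtain ⟨C, hC⟩ := PowerBounded.runtime .id ((PowerBounded.ofNat 2).mul .id)
    (((PowerBounded.natCast a).mul ((PowerBounded.ofNat 2).mul .id)).add (.natCast b)) pV pV pS pR
    K d
  refine ⟨C, fun n w M ε hε hε1 hn hx hw hM hMB => le_trans ?_ (hC _ hx).2⟩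
  set x : ℝ := n / ε with hxdef
  have hn1 : (1 : ℝ) ≤ n := by exact_mod_cast hn
  have hM1 : (1 : ℝ) ≤ M := by exact_mod_cast hM
  have hnx : (n : ℝ) ≤ x := by
    rw [hxdef, le_div_iff₀ hε]
    nlinarith
  have hκx : (ε / 12)⁻¹ ≤ 12 * x := by
    rw [inv_div, hxdef, ← mul_div_assoc]
    gcongr
    linarith
  have hceil : (⌈x⌉₊ : ℝ) ≤ 2 * x := by
    have := Nat.ceil_lt_add_one (show 0 ≤ x by linarith)
    linarith
  have hwx : (w : ℝ) ≤ 2 * x := le_trans (by exact_mod_cast Nat.lt_two_pow_self.le) hw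
  have hBV : ((B ^ (a * w + b) : ℕ) : ℝ) ≤ V x := by
    -- An exponential in w is a power of 2^w, because B ≤ 2^B.
    have h1 : (B : ℝ) ^ (a * w) ≤ (2 * x) ^ (B * a) := by
      calc (B : ℝ) ^ (a * w) ≤ (2 ^ B) ^ (a * w) := by
            gcongr
            exact_mod_cast Nat.lt_two_pow_self.le
        _ = (2 ^ w) ^ (B * a) := by rw [← pow_mul, ← pow_mul]; congr 1; ring
        _ ≤ _ := by gcongr
    rw [hV, pow_add]
    push_cast
    gcongr
  have hMV : (M : ℝ) ≤ V x := le_trans (by exact_mod_cast hMB) hBV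
  set κ := ε / 12 with hκ
  have hκ0 : 0 < κ := by positivity
  have hx0 : 0 < x := by linarith
  have hV0 : 0 ≤ V x := by linarith
  have hRx : (iterations M κ : ℝ) ≤ R x := by
    have := Nat.ceil_lt_add_one (show 0 ≤ 4 * ((M : ℝ) * M) / (κ * κ) by positivity)
    refine this.le.trans ?_
    rw [div_eq_mul_inv, mul_inv]
    simp only [hR]
    gcongr
  have hR0 : 0 ≤ R x := le_trans (by positivity) hRx
  have hSx : (samples D M κ (iterations M κ) : ℝ) ≤ S x := by
    set I := iterations M κ
    have := Nat.ceil_lt_add_one (show 0 ≤ (D : ℝ) *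
      ((2 + κ / M * I) * (2 + κ / M * I) * (M * M) / (κ * κ)) by positivity)
    refine this.le.trans ?_
    have h1 : 2 + κ / M * I ≤ 2 + R x := by
      have : κ / M ≤ 1 := by
        rw [div_le_one (by linarith)]
        linarith
      nlinarith [show (0 : ℝ) ≤ I by positivity]
    rw [div_eq_mul_inv _ (κ * κ), mul_inv]
    simp only [hS]
    gcongr
  have hcast : ((runtime K d n ⌈x⌉₊ (a * w + b) (B ^ (a * w + b)) M (samples D M κ (iterations M κ))
      (iterations M κ) : ℕ) : ℝ) = runtime (K : ℝ) d n ⌈x⌉₊ (a * w + b : ℕ) (B ^ (a * w + b) : ℕ) M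
        (samples D M κ (iterations M κ)) (iterations M κ) := by
    simp [runtime]
  rw [hcast]
  apply runtime_mono <;> first | positivity | assumption | skip
  push_cast
  gcongr

/-- Here x^C = e^(C log x), and the base on the right is at least e. -/
lemma pow_le_rpow_log {K Λ d C : ℕ} {x : ℝ} (hd : 1 ≤ d) (hx : 1 ≤ x) :
    x ^ C ≤ ((4 : ℝ) ^ (K * Λ) * Real.exp 1 * d) ^ ((C : ℝ) * Real.log x) := by
  have hd' : (1 : ℝ) ≤ d := by exact_mod_cast hd
  have h4 : (1 : ℝ) ≤ 4 ^ (K * Λ) := one_le_pow₀ (by norm_num)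
  have he := Real.exp_pos 1
  have hbase : Real.exp 1 ≤ (4 : ℝ) ^ (K * Λ) * Real.exp 1 * d := by
    calc Real.exp 1 = 1 * Real.exp 1 * 1 := by ring
      _ ≤ _ := by gcongr
  refine le_trans (le_of_eq ?_) (Real.rpow_le_rpow he.le hbase
    (mul_nonneg (Nat.cast_nonneg C) (Real.log_nonneg hx)))
  rw [Real.exp_one_rpow, mul_comm, Real.exp_mul, Real.exp_log (by linarith), Real.rpow_natCast]

end HVClassifier
end

/-! ### Assembly of the main theorem. -/

theorem mainTheorem7 (K Λ d ℓ : ℕ) (hd : 1 ≤ d) (T : ℝ) (hT : 0 ≤ T) (δ : ℝ) (hδ : 0 < δ) :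
    ∃ (A : HVClassifier.Program) (C : ℝ), 0 < C ∧
      ∀ (n : ℕ) (𝒳 : Type*) (P : HVClassifier.Problem n K 𝒳) (ε : ℝ),
        (∀ k, (P.ham k).LocalityLE Λ) → (∀ k, (P.ham k).DegreeLE d) → P.obsSupp.card ≤ ℓ →
        0 < ε → 2 * ε ≤ n →
        ∃ t : ℕ,
          (t : ℝ) ≤ P.size *
            ((4 : ℝ) ^ (K * Λ) * Real.exp 1 * d) ^ (C * Real.log (n / ε)) ∧
          (∀ c ∈ (HVClassifier.execute A P ε t).support, c.Halted) ∧
          ENNReal.ofReal (1 - δ) ≤ HVClassifier.prob (HVClassifier.execute A P ε t) (fun c =>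
            ∀ θ : Fin K → ℝ, P.IsOptimal T θ →
              (P.loss θ ≤ ε / 3 → P.modelError (HVClassifier.outputModel n c.mem) θ ≤ ε) ∧
              P.modelError (HVClassifier.outputModel n c.mem) θ ≤ 2 * P.loss θ + ε) := by
  obtain ⟨a, b, happrox⟩ := HVClassifier.exists_pauli_approximation K Λ d ℓ T
  set D : ℕ := ⌈1 / δ⌉₊
  -- Growth of the list per round: edges at a position, times four codes for each position in an
  -- edge, plus the string itself.
  set B : ℕ := (K * (d + 1) + 1) * (4 * (ℓ + Λ + 1)) + 1 with hB
  obtain ⟨C, hC⟩ := HVClassifier.exists_runtime_le K d a b B D (by omega)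
  -- The exponent is raised by one for positivity; the additional factor n/ε ≥ 2 also pays for the
  -- two steps of the zero model.
  refine ⟨HVClassifier.classifier K a b D, (C + 1 : ℕ), by positivity,
    fun n 𝒳 P ε hloc hdeg hobs hε hεn => ?_⟩
  have hx : 2 ≤ n / ε := by rwa [le_div_iff₀ hε]
  have hN : (1 : ℝ) ≤ P.size := by exact_mod_cast P.size_pos
  have hbound : (n / ε) ^ (C + 1) ≤
      ((4 : ℝ) ^ (K * Λ) * Real.exp 1 * d) ^ (((C + 1 : ℕ) : ℝ) * Real.log (n / ε)) :=
    HVClassifier.pow_le_rpow_log hd (by linarith)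
  have hpow : (1 : ℝ) ≤ (n / ε) ^ C := one_le_pow₀ (by linarith)
  rcases le_or_gt 1 ε with hε1 | hε1
  · obtain ⟨h1, h2⟩ := HVClassifier.halted_and_prob_of_optimalCost_le one_pos hδ.le
      ((HVClassifier.optimalCost_classifier_of_one_le (P := P) (a := a) (b := b) (D := D) hε1
        1).trans (zero_le))
    refine ⟨2, ?_, h1, h2.trans (HVClassifier.prob_mono fun c h θ _ => ⟨fun _ => ?_, ?_⟩)⟩
    · rw [pow_succ] at hbound
      have h2 : (2 : ℝ) ≤ (n / ε) ^ C * (n / ε) := by nlinarith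
      refine (h2.trans hbound).trans (le_mul_of_one_le_left (by positivity) hN)
    · exact (h θ).trans hε1
    · linarith [h θ, P.loss_nonneg θ]
  · have hn : 1 ≤ n := by
      rcases Nat.eq_zero_or_pos n with rfl | h
      · norm_num at hx
      · exact h
    have hlist : ∀ W, (P.pauliList W).length ≤ B ^ W := fun W => by
      have := HVClassifier.length_iterate_extend_le (fun x => HVClassifier.length_children_le
        (E := P.edges) (n := n) (HVClassifier.Problem.card_le_of_mem_edges hloc hobs)
        (HVClassifier.Problem.countP_edges_le hdeg x.2)) [(fun _ => 0, n)] W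
      rwa [List.length_singleton, one_mul] at this
    have hD : 1 ≤ δ * D := by
      have := Nat.le_ceil (1 / δ)
      rwa [div_le_iff₀' hδ] at this
    obtain ⟨w, M, hw, hM, hMB, τ, hτ, hcost⟩ := HVClassifier.optimalCost_classifier_le (P := P)
      hdeg hε hε1 hx hn hlist (by omega) hδ hD
      fun w θ hθ => happrox n 𝒳 P hloc hdeg hobs θ hθ w
    obtain ⟨h1, h2⟩ := HVClassifier.halted_and_prob_of_optimalCost_le hτ hδ.le hcost
    refine ⟨_, ?_, h1, h2.trans (HVClassifier.prob_mono fun c h θ hθ => ?_)⟩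
    · have := hC n w M ε hε hε1 hn hx hw hM hMB
      rw [Nat.cast_mul]
      refine mul_le_mul_of_nonneg_left (this.trans (le_trans ?_ hbound)) (by positivity)
      exact pow_le_pow_right₀ (by linarith) (Nat.le_succ C)
    · have := h θ hθ.1
      -- If the loss is at most ε/3, then 2ε/3 + ε/16 ≤ ε, because accuracy ε/4 entered the bound 2
      -- · loss + ε/4.
      exact ⟨fun hl => by linarith, by linarith⟩
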